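/- **Setting.** Let $T>0$, let $f_1,f_2:\mathbb R^n\to\mathbb R^n$ and $h:\mathbb R^n\to\mathbb R$, and put $C=\{x: h(x)\le 0\}$. A *process* on $[0,T]$ is a pair $(x,u)$ where $u=(u_1,u_2):[0,T]\to\mathbb R^2$ is measurable with $|u|\le 1$ a.e. and $x$ is an absolutely continuous solution of $\dot x=f_1(x)u_1+f_2(x)u_2$. Let $\mathbb S=\{x\in C:\nabla h(x)\cdot f_1(x)=\nabla h(x)\cdot f_2(x)=0\}$, let $[f_1,f_2]=Df_2\,f_1-Df_1\,f_2$, and let $S(x)=(S_{\ell m}(x))_{\ell,m=1,2}$ be the symmetric part of $\Lambda_{\ell m}(x)=f_\ell(x)\cdot D^2h(x)f_m(x)+\nabla h(x)\cdot Df_\ell(x)f_m(x)$. Write $d_{\mathbb S}$ for the distance to $\mathbb S$. **Hypotheses.** (H1) $f_1,f_2$ are of class $C^2$ and Lipschitz, and $|f_1|+|f_2|$ is bounded. (H2) The controls take values in the closed unit disc of $\mathbb R^2$. (H3) $h$ is Lipschitz and of class $C^{2,1}$ ($C^2$ with locally Lipschitz $D^2h$), $C\neq\emptyset$, and $\nabla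 h(x)\ne 0$ whenever $h(x)=0$. (H4) There is $\alpha>0$ with $|\nabla h(x)\cdot[f_1,f_2](x)|>\alpha$ for all $x\in\mathbb S$. (H5) For every $x\in\mathbb S$ the quadratic form $S(x)$ is negative semidefinite (possibly definite or zero) or indefinite. (H6) There are $\delta,d_0>0$ with $\sqrt{(\nabla h(x)\cdot f_1(x))^2+(\nabla h(x)\cdot f_2(x))^2}\ge d_0\,d_{\mathbb S}(x)$ for every $x$ at distance at most $\delta$ from some point of $\mathbb S$. For a process $(\bar x,\bar u)$ with $h(\bar x(0))\le 0$ (a *reference process*) put $d=\max_{t\in[0,T]}\max\{h(\bar x(t)),0\}$, and let $\tau_1=T$ if $d=0$ and $\tau_1=\inf\{t\in(0,T]:h(\bar x(t))>0\}$ if $d>0$. **Theorem.** Assume (H1)–(H6), and let $X_0\subset\mathbb R^n$ be compact. There are constants $K$, $K'$ and $d_{\max}>0$ and a function $\tau(\cdot)\ge0$ with $\tau(d)\le K\sqrt d$, all depending only on $h,f_1,f_2,T$ and $X_0$, such that to every reference process $(\bar x,\bar u)$ with $\bar x(0)\in X_0$ and $d\le d_{\max}$ one can associate a process $(y,u)$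 with the following properties: 1. $y(t)=\bar x(t)$ for all $t\in[0,\tau_1]$; 2. $y(t)\in\operatorname{int} C$ and $h(y(t))<0$ for all $t\in(\tau_1,T]$; 3. $\|y-\bar x\|_{L^\infty(0,T)}\le K\sqrt d$; 4. $\|u-\bar u\|_{L^1(0,T)}\le K\big(\sqrt d+\|\bar u(\cdot-\tau(d))-\bar u\|_{L^1(\tau_1+\tau(d),T)}\big)$; 5. $\|\dot y-\dot{\bar x}\|_{L^1(0,T)}\le K\big(\sqrt d+\|\dot{\bar x}(\cdot-\tau(d))-\dot{\bar x}\|_{L^1(\tau_1+\tau(d),T)}\big)$; 6. $\|\dot y-\dot{\bar x}\|_{L^1(0,T)}\to0$ as $d\to0$, uniformly over the reference processes as above whose derivative $\dot{\bar x}$ belongs to a given compact subset of $L^1(0,T)$; 7. if $\dot{\bar x}$ has (a representative $v$ with) bounded variation on $[0,T]$, then $\|y-\bar x\|_{W^{1,1}(0,T)}\le K'\,(1+\operatorname{Var}_{[0,T]} v)\,\sqrt d$, where $\|x\|_{W^{1,1}(0,T)}=\|x(0)\|+\|\dot x\|_{L^1(0,T)}$. Moreover, for every reference process, if $\bar u$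 has a representative of bounded variation on $[0,T]$, then so has $\dot{\bar x}$. -/

import Mathlib

open MeasureTheory Set
open scoped ENNReal

noncomputable section

/-- The Euclidean space `ℝⁿ`. -/
abbrev Euc (n : ℕ) : Type := EuclideanSpace ℝ (Fin n)

/-- A state-control pair: a curve `x` in `ℝⁿ` and a control `u = (u₁, u₂)`. Only the values on
`[0, T]` matter below. -/
abbrev StateControl (n : ℕ) : Type := (ℝ → Euc n) × (ℝ → Euc 2)

/-- The right-hand side `u₁ f₁(x) + u₂ f₂(x)`; the vector fields are `f 0 = f₁` and `f 1 = f₂`. -/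
def dynamics {n : ℕ} (f : Fin 2 → Euc n → Euc n) (x : Euc n) (u : Euc 2) : Euc n :=
  ∑ i, u i • f i x

/-- `(x, u)` is a process on `[0, T]`: `u` is a measurable control with values in the closed unit
disc and `x` is the (absolutely continuous) Carathéodory solution of `ẋ = u₁ f₁(x) + u₂ f₂(x)`. -/
structure IsProcess {n : ℕ} (f : Fin 2 → Euc n → Euc n) (T : ℝ) (p : StateControl n) : Prop where
  control_measurable : AEStronglyMeasurable p.2 (volume.restrict (Icc 0 T))
  control_bound : ∀ᵐ t ∂(volume.restrict (Icc 0 T)), ‖p.2 t‖ ≤ 1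
  state_continuous : ContinuousOn p.1 (Icc 0 T)
  state_eq : ∀ t ∈ Icc 0 T, p.1 t = p.1 0 + ∫ s in (0 : ℝ)..t, dynamics f (p.1 s) (p.2 s)

/-- The constraint set `C = {h ≤ 0}`. -/
def constraintSet {n : ℕ} (h : Euc n → ℝ) : Set (Euc n) := {x | h x ≤ 0}

/-- The singular set: the points of `C` with `∇h · f₁ = ∇h · f₂ = 0`. Here `∇h(x) · v` is written
`fderiv ℝ h x v`. -/
def singularSet {n : ℕ} (f : Fin 2 → Euc n → Euc n) (h : Euc n → ℝ) : Set (Euc n) :=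
  {x | x ∈ constraintSet h ∧ ∀ i, fderiv ℝ h x (f i x) = 0}

/-- `Λ_{ℓm}(x) = f_ℓ(x) · D²h(x) f_m(x) + ∇h(x) · Df_ℓ(x) f_m(x)`. -/
def curvatureMatrix {n : ℕ} (f : Fin 2 → Euc n → Euc n) (h : Euc n → ℝ) (x : Euc n) :
    Matrix (Fin 2) (Fin 2) ℝ :=
  Matrix.of fun l m =>
    fderiv ℝ (fderiv ℝ h) x (f m x) (f l x) + fderiv ℝ h x (fderiv ℝ (f l) x (f m x))

/-- The symmetric part `S(x) = (Λ(x) + Λ(x)ᵀ) / 2`. -/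
def symmetricPart {n : ℕ} (f : Fin 2 → Euc n → Euc n) (h : Euc n → ℝ) (x : Euc n) :
    Matrix (Fin 2) (Fin 2) ℝ :=
  Matrix.of fun l m => (curvatureMatrix f h x l m + curvatureMatrix f h x m l) / 2

/-- Negative semidefiniteness of the quadratic form with matrix `Q`
(the negative definite and the zero form are included). -/
def IsNegSemidefForm (Q : Matrix (Fin 2) (Fin 2) ℝ) : Prop :=
  ∀ U : Fin 2 → ℝ, ∑ l, ∑ m, Q l m * U l * U m ≤ 0

/-- Indefiniteness of the quadratic form with symmetric matrix `Q`. -/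
def IsIndefiniteForm (Q : Matrix (Fin 2) (Fin 2) ℝ) : Prop :=
  Q 0 0 * Q 1 1 - Q 0 1 ^ 2 < 0

/-- `f₁`, `f₂` are `C²`, Lipschitz with a common constant, and `|f₁| + |f₂|` is bounded. -/
def HypH1 {n : ℕ} (f : Fin 2 → Euc n → Euc n) : Prop :=
  (∀ i, ContDiff ℝ 2 (f i)) ∧ (∃ kf : NNReal, ∀ i, LipschitzWith kf (f i)) ∧
    ∃ k₀ : ℝ, 0 < k₀ ∧ ∀ x, ‖f 0 x‖ + ‖f 1 x‖ ≤ k₀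

/-- `h` is of class `C^{2,1}` (`C²` with locally Lipschitz second derivative) and globally
Lipschitz, `C` is nonempty, and `∇h ≠ 0` on `{h = 0}`. -/
def HypH3 {n : ℕ} (h : Euc n → ℝ) : Prop :=
  ContDiff ℝ 2 h ∧ LocallyLipschitz (fun x => fderiv ℝ (fderiv ℝ h) x) ∧
    (∃ kh : NNReal, LipschitzWith kh h) ∧ (constraintSet h).Nonempty ∧
    ∀ x, h x = 0 → fderiv ℝ h x ≠ 0

/-- Uniform transversality of the Lie bracket `[f₁, f₂] = Df₂ f₁ - Df₁ f₂` on the singular set. -/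
def HypH4 {n : ℕ} (f : Fin 2 → Euc n → Euc n) (h : Euc n → ℝ) : Prop :=
  ∃ α : ℝ, 0 < α ∧ ∀ x ∈ singularSet f h,
    α < |fderiv ℝ h x (VectorField.lieBracket ℝ (f 0) (f 1) x)|

/-- On the singular set the form `S(x)` is negative semidefinite or indefinite. -/
def HypH5 {n : ℕ} (f : Fin 2 → Euc n → Euc n) (h : Euc n → ℝ) : Prop :=
  ∀ x ∈ singularSet f h,
    IsNegSemidefForm (symmetricPart f h x) ∨ IsIndefiniteForm (symmetricPart f h x)

/-- `√((∇h·f₁)² + (∇h·f₂)²) ≥ d₀ dist(x, 𝕊)` for all `x` in `𝕊 + δ𝔹`. -/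
def HypH6 {n : ℕ} (f : Fin 2 → Euc n → Euc n) (h : Euc n → ℝ) : Prop :=
  ∃ δ d₀ : ℝ, 0 < δ ∧ 0 < d₀ ∧ ∀ s ∈ singularSet f h, ∀ x ∈ Metric.closedBall s δ,
    d₀ * Metric.infDist x (singularSet f h) ≤
      √((fderiv ℝ h x (f 0 x)) ^ 2 + (fderiv ℝ h x (f 1 x)) ^ 2)

/-- The extent of the violation `d = max_{t ∈ [0,T]} max (h(x(t)), 0)`. -/
def violation {n : ℕ} (h : Euc n → ℝ) (T : ℝ) (x : ℝ → Euc n) : ℝ :=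
  sSup ((fun t => max (h (x t)) 0) '' Icc 0 T)

open Classical in
/-- The first violation time: `T` if `d = 0`, and `inf {t ∈ (0,T] : h(x(t)) > 0}` if `d > 0`. -/
def violationTime {n : ℕ} (h : Euc n → ℝ) (T : ℝ) (x : ℝ → Euc n) : ℝ :=
  if violation h T x = 0 then T else sInf {t | t ∈ Ioc 0 T ∧ 0 < h (x t)}

/-- The `L^p` norm on the set of times `I`, as an extended nonnegative number. -/
def normLp {m : ℕ} (p : ℝ≥0∞) (I : Set ℝ) (g : ℝ → Euc m) : ℝ≥0∞ :=
  eLpNorm g p (volume.restrict I)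

/-- The norm `‖x(0)‖ + ‖ẋ‖_{L¹(0,T)}` of `W^{1,1}(0,T)`. -/
def normW11 {n : ℕ} (T : ℝ) (x : ℝ → Euc n) : ℝ≥0∞ :=
  ‖x 0‖ₑ + normLp 1 (Ioo 0 T) (deriv x)

/-- `v` is a representative of bounded variation on `[0,T]` of the a.e. defined function `g`. -/
def IsBVRepresentative {m : ℕ} (T : ℝ) (g v : ℝ → Euc m) : Prop :=
  BoundedVariationOn v (Icc 0 T) ∧ g =ᵐ[volume.restrict (Icc 0 T)] v

/-- A reference process: a process on `[0,T]` whose initial point lies in `C`. -/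
def IsReference {n : ℕ} (f : Fin 2 → Euc n → Euc n) (h : Euc n → ℝ) (T : ℝ)
    (p : StateControl n) : Prop :=
  IsProcess f T p ∧ h (p.1 0) ≤ 0

/-- The process `q = (y, u)` is a neighbouring feasible process of `p = (x, v)`, with constant `K`
and time delay `τ`. -/
structure IsNeighbouring {n : ℕ} (f : Fin 2 → Euc n → Euc n) (h : Euc n → ℝ) (T K : ℝ)
    (τ : ℝ → ℝ) (p q : StateControl n) : Prop where
  isProcess : IsProcess f T q
  eq_before : ∀ t ∈ Icc 0 (violationTime h T p.1), q.1 t = p.1 t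
  interior_after : ∀ t ∈ Ioc (violationTime h T p.1) T,
    q.1 t ∈ interior (constraintSet h) ∧ h (q.1 t) < 0
  uniform_bound : normLp ∞ (Ioo 0 T) (fun t => q.1 t - p.1 t) ≤
    ENNReal.ofReal (K * √(violation h T p.1))
  control_bound : normLp 1 (Ioo 0 T) (fun t => q.2 t - p.2 t) ≤
    ENNReal.ofReal K * (ENNReal.ofReal √(violation h T p.1) +
      normLp 1 (Ioo (violationTime h T p.1 + τ (violation h T p.1)) T)
        (fun t => p.2 (t - τ (violation h T p.1)) - p.2 t))
  deriv_bound : normLp 1 (Ioo 0 T) (fun t => deriv q.1 t - deriv p.1 t) ≤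
    ENNReal.ofReal K * (ENNReal.ofReal √(violation h T p.1) +
      normLp 1 (Ioo (violationTime h T p.1 + τ (violation h T p.1)) T)
        (fun t => deriv p.1 (t - τ (violation h T p.1)) - deriv p.1 t))

end

/-!
The proof corrects the reference trajectory by inserting short *descent manoeuvres* and following
the original control with a delay.

At a point `x₀` of `{h ≤ 0}`, write `p_i = ∇h · f_i` (`lieDeriv`). By `HypH4` and compactness, on a
bounded set either `|p|` or `|∇h · [f₁, f₂]|` is bounded below (`exists_transversality_constant`).
In the first case the constant control `-p / |p|` lowers `h` at a linear rate. In the second case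
the control is that of a logarithmic loop `X(t) = t (1 - exp (i ω log (t / s))) v / Ω`, where `v` is
the direction of `-p`. Along it `h` changes, up to a small multiple of `t²`, by
`p · X + ½ S(X, X) + (∇h · [f₁, f₂]) ω t² / (4 Ω²)` (with an oscillating correction of the last
term, of relative order `1 / ω`), where `S` is the symmetric second-order form. The first term is
never positive, and for `|ω|` large with the right sign the last one beats the second at *every*
time `t`, because the loop is invariant under the scalings by `exp (2 π / |ω|)` and so sweeps area
at all scales near `0`. The loop is closed, so the state moves by
`O(s²)` only. In both cases `h` is lowered by `m` in time `O(√m)`, with a displacement `O(m)`, and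
`h < h x₀` throughout (`exists_descent`).

If a trajectory violates the constraint by at most `e`, such a manoeuvre with `m = 4 e` at a time
`t₀`, padded by rest (the system is driftless) to a given duration `τ` of order `√e`, followed by
the original control delayed by `τ`, yields a trajectory that stays `O(e)`-close to the delayed one.
The margin decays at a rate `O(e)`, so the new trajectory is strictly feasible during a time `σ`
independent of `e`, and later violates the constraint by at most `C e` (`exists_correction_step`).
Starting with `t₀ = τ₁` and repeating this `N ≥ T / σ` times at the times `τ₁ + j σ`, always with
the same delay `τ`, covers `(τ₁, T]` (`exists_iterated_correction`). With equal delays each step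
changes the `L¹` distance to the reference control by the recursion `E ↦ 3 E + O(√d) + W`, where `W`
is the `L¹` effect of the delay on the reference control, and similarly for the derivatives
(`lintegral_delay_le`), which gives the `L¹` estimates.

The convergence on compact families is the `L¹` continuity of translations
(`exists_translation_le_of_isCompact`), and the `W^{1,1}` estimate is the bound of the `L¹` effect
of a delay `τ` by `τ` times the variation (`lintegral_translation_le_variation`).
-/

/-! ### Trajectories on an arbitrary interval -/

/-- Quantitative form of the regularity of the vector fields: `L` is a common Lipschitz constant
and `k` bounds `|f₁| + |f₂|`. -/
structure FieldBounds {n : ℕ} (f : Fin 2 → Euc n → Euc n) (L k : ℝ) : Prop where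
  L_pos : 0 < L
  k_pos : 0 < k
  lip : ∀ i x y, ‖f i x - f i y‖ ≤ L * ‖x - y‖
  bdd : ∀ x, ‖f 0 x‖ + ‖f 1 x‖ ≤ k

/-- `x` is the trajectory on `[a, b]` of the control `u`: the analogue of `IsProcess` on an
arbitrary interval, so that processes can be restricted and shifted in time. -/
structure IsTrajectory {n : ℕ} (f : Fin 2 → Euc n → Euc n) (a b : ℝ) (u : ℝ → Euc 2)
    (x : ℝ → Euc n) : Prop where
  meas : AEStronglyMeasurable u (volume.restrict (Icc a b))
  bound : ∀ᵐ t ∂(volume.restrict (Icc a b)), ‖u t‖ ≤ 1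
  cont : ContinuousOn x (Icc a b)
  eq : ∀ t ∈ Icc a b, x t = x a + ∫ s in a..t, dynamics f (x s) (u s)

theorem isProcess_iff_isTrajectory {n : ℕ} {f : Fin 2 → Euc n → Euc n} {T : ℝ}
    {p : StateControl n} : IsProcess f T p ↔ IsTrajectory f 0 T p.2 p.1 :=
  ⟨fun h => ⟨h.1, h.2, h.3, h.4⟩, fun h => ⟨h.1, h.2, h.3, h.4⟩⟩

section Dynamics

variable {n : ℕ} {f : Fin 2 → Euc n → Euc n} {L k : ℝ}

theorem abs_coord_le_one {u : Euc 2} (hu : ‖u‖ ≤ 1) (i : Fin 2) : |u i| ≤ 1 := by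
  have := PiLp.norm_apply_le u i
  rw [Real.norm_eq_abs] at this
  exact this.trans hu

theorem dynamics_eq (f : Fin 2 → Euc n → Euc n) (x : Euc n) (u : Euc 2) :
    dynamics f x u = u 0 • f 0 x + u 1 • f 1 x := by
  simp [dynamics, Fin.sum_univ_two]

theorem FieldBounds.dynamics_norm_le (hf : FieldBounds f L k) (x : Euc n) {u : Euc 2}
    (hu : ‖u‖ ≤ 1) : ‖dynamics f x u‖ ≤ k := by
  rw [dynamics_eq]
  have h0 := abs_coord_le_one hu 0
  have h1 := abs_coord_le_one hu 1
  calc ‖u 0 • f 0 x + u 1 • f 1 x‖ ≤ |u 0| * ‖f 0 x‖ + |u 1| * ‖f 1 x‖ := by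
        refine (norm_add_le _ _).trans ?_
        rw [norm_smul, norm_smul, Real.norm_eq_abs, Real.norm_eq_abs]
    _ ≤ 1 * ‖f 0 x‖ + 1 * ‖f 1 x‖ := by gcongr
    _ ≤ k := by simpa using hf.bdd x

theorem FieldBounds.dynamics_sub_le (hf : FieldBounds f L k) (x y : Euc n) {u : Euc 2}
    (hu : ‖u‖ ≤ 1) : ‖dynamics f x u - dynamics f y u‖ ≤ 2 * L * ‖x - y‖ := by
  rw [dynamics_eq, dynamics_eq]
  have h0 := abs_coord_le_one hu 0
  have h1 := abs_coord_le_one hu 1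
  have hL := hf.L_pos
  calc ‖u 0 • f 0 x + u 1 • f 1 x - (u 0 • f 0 y + u 1 • f 1 y)‖
      = ‖u 0 • (f 0 x - f 0 y) + u 1 • (f 1 x - f 1 y)‖ := by
        congr 1; module
    _ ≤ |u 0| * ‖f 0 x - f 0 y‖ + |u 1| * ‖f 1 x - f 1 y‖ := by
        refine (norm_add_le _ _).trans ?_
        rw [norm_smul, norm_smul, Real.norm_eq_abs, Real.norm_eq_abs]
    _ ≤ 1 * (L * ‖x - y‖) + 1 * (L * ‖x - y‖) := by
        gcongr
        · exact hf.lip 0 x y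
        · exact hf.lip 1 x y
    _ = 2 * L * ‖x - y‖ := by ring

theorem FieldBounds.continuous (hf : FieldBounds f L k) (i : Fin 2) : Continuous (f i) := by
  refine (LipschitzWith.of_dist_le_mul (K := ⟨L, hf.L_pos.le⟩) fun x y => ?_).continuous
  rw [dist_eq_norm, dist_eq_norm]
  exact hf.lip i x y

theorem FieldBounds.continuous_dynamics (hf : FieldBounds f L k) :
    Continuous fun q : Euc n × Euc 2 => dynamics f q.1 q.2 := by
  simp only [dynamics_eq]
  have h0 := hf.continuous 0
  have h1 := hf.continuous 1
  fun_prop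

/-- For a continuous curve the velocity along a measurable control is measurable. -/
theorem FieldBounds.aestronglyMeasurable_dynamics (hf : FieldBounds f L k) {a b : ℝ}
    {u : ℝ → Euc 2} {x : ℝ → Euc n} (hx : ContinuousOn x (Icc a b))
    (hu : AEStronglyMeasurable u (volume.restrict (Icc a b))) :
    AEStronglyMeasurable (fun t => dynamics f (x t) (u t)) (volume.restrict (Icc a b)) :=
  hf.continuous_dynamics.comp_aestronglyMeasurable
    ((hx.aestronglyMeasurable measurableSet_Icc).prodMk hu)

theorem FieldBounds.integrableOn_dynamics (hf : FieldBounds f L k) {a b : ℝ}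
    {u : ℝ → Euc 2} {x : ℝ → Euc n} (hx : ContinuousOn x (Icc a b))
    (hu : AEStronglyMeasurable u (volume.restrict (Icc a b)))
    (hb : ∀ᵐ t ∂(volume.restrict (Icc a b)), ‖u t‖ ≤ 1) :
    IntegrableOn (fun t => dynamics f (x t) (u t)) (Icc a b) := by
  refine Integrable.of_bound (hf.aestronglyMeasurable_dynamics hx hu) k ?_
  filter_upwards [hb] with t ht using hf.dynamics_norm_le _ ht

end Dynamics

/-- Gronwall's inequality in integral form. -/
theorem gronwall_integral {φ : ℝ → ℝ} {a b A K : ℝ} (hK : 0 ≤ K)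
    (hφ : ContinuousOn φ (Icc a b))
    (h : ∀ t ∈ Icc a b, φ t ≤ A + K * ∫ s in a..t, φ s) :
    ∀ t ∈ Icc a b, φ t ≤ A * Real.exp (K * (t - a)) := by
  intro t ht
  have hab : a ≤ b := ht.1.trans ht.2
  have hint : IntervalIntegrable φ volume a b := hφ.intervalIntegrable_of_Icc hab
  set Ψ : ℝ → ℝ := fun t => A + K * ∫ s in a..t, φ s with hΨ
  have hcont : ContinuousOn Ψ (Icc a b) := by
    refine continuousOn_const.add (continuousOn_const.mul ?_)
    have := intervalIntegral.continuousOn_primitive_interval (μ := volume) (f := φ) (a := a)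
      (b := b) (by rw [uIcc_of_le hab]; exact hφ.integrableOn_Icc)
    rwa [uIcc_of_le hab] at this
  have hder : ∀ s ∈ Ico a b, HasDerivWithinAt Ψ (K * φ s) (Ici s) s := by
    intro s hs
    refine (HasDerivWithinAt.const_mul K ?_).const_add A
    have hsb : Icc s b ⊆ Icc a b := Icc_subset_Icc_left hs.1
    refine intervalIntegral.integral_hasDerivWithinAt_right (t := Ioi s)
      (hint.mono_set (by
        rw [uIcc_of_le hs.1, uIcc_of_le hab]; exact Icc_subset_Icc_right hs.2.le)) ?_ ?_
    · have : StronglyMeasurableAtFilter φ (nhdsWithin s (Icc s b)) volume :=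
        ⟨Icc a b, mem_nhdsWithin.2 ⟨univ, isOpen_univ, mem_univ _, by simpa using hsb⟩,
          hφ.aestronglyMeasurable measurableSet_Icc⟩
      exact this.filter_mono (by
        rw [← nhdsWithin_Ioc_eq_nhdsGT hs.2]
        exact nhdsWithin_mono _ Ioc_subset_Icc_self)
    · have hc : ContinuousWithinAt φ (Icc s b) s :=
        (hφ s ⟨hs.1, hs.2.le⟩).mono hsb
      have : ContinuousWithinAt φ (Ioc s b) s := hc.mono Ioc_subset_Icc_self
      exact (continuousWithinAt_Ioc_iff_Ioi hs.2).1 this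
  have key := le_gronwallBound_of_liminf_deriv_right_le (f := Ψ) (f' := fun s => K * φ s)
    (δ := A) (K := K) (ε := 0) (a := a) (b := b) hcont
    (fun s hs r hr => (hder s hs).liminf_right_slope_le hr)
    (by simp [hΨ])
    (fun s hs => by
      have := h s ⟨hs.1, hs.2.le⟩
      simp only [add_zero]
      exact mul_le_mul_of_nonneg_left this hK) t ht
  rw [gronwallBound_ε0] at key
  exact (h t ht).trans key

namespace IsTrajectory

variable {n : ℕ} {f : Fin 2 → Euc n → Euc n} {L k a b : ℝ} {u : ℝ → Euc 2} {x : ℝ → Euc n}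

theorem integrableOn (h : IsTrajectory f a b u x) (hf : FieldBounds f L k) :
    IntegrableOn (fun t => dynamics f (x t) (u t)) (Icc a b) :=
  hf.integrableOn_dynamics h.cont h.meas h.bound

theorem intervalIntegrable (h : IsTrajectory f a b u x) (hf : FieldBounds f L k) {s t : ℝ}
    (hs : s ∈ Icc a b) (ht : t ∈ Icc a b) :
    IntervalIntegrable (fun t => dynamics f (x t) (u t)) volume s t := by
  have hsub : uIcc s t ⊆ Icc a b := uIcc_subset_Icc hs ht
  exact ((h.integrableOn hf).mono_set hsub).intervalIntegrable

theorem sub_eq (h : IsTrajectory f a b u x) (hf : FieldBounds f L k) {s t : ℝ}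
    (hs : s ∈ Icc a b) (ht : t ∈ Icc a b) :
    x t - x s = ∫ r in s..t, dynamics f (x r) (u r) := by
  have ha : a ∈ Icc a b := ⟨le_rfl, hs.1.trans hs.2⟩
  have := intervalIntegral.integral_add_adjacent_intervals
    (h.intervalIntegrable hf ha hs) (h.intervalIntegrable hf hs ht)
  rw [h.eq t ht, h.eq s hs, ← this]
  abel

theorem restrict (h : IsTrajectory f a b u x) (hf : FieldBounds f L k) {c d : ℝ} (hc : a ≤ c)
    (hd : d ≤ b) : IsTrajectory f c d u x := by
  have hsub : Icc c d ⊆ Icc a b := Icc_subset_Icc hc hd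
  refine ⟨h.meas.mono_measure (Measure.restrict_mono hsub le_rfl),
    ae_mono (Measure.restrict_mono hsub le_rfl) h.bound, h.cont.mono hsub, fun t ht => ?_⟩
  have hcd : c ∈ Icc a b := ⟨hc, (ht.1.trans ht.2).trans hd⟩
  rw [← h.sub_eq hf hcd (hsub ht)]
  abel

theorem shift (h : IsTrajectory f a b u x) (τ : ℝ) :
    IsTrajectory f (a + τ) (b + τ) (fun t => u (t - τ)) (fun t => x (t - τ)) := by
  have hmp : MeasurePreserving (fun t : ℝ => t - τ) (volume.restrict (Icc (a + τ) (b + τ)))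
      (volume.restrict (Icc a b)) := by
    have := (measurePreserving_sub_right (volume : Measure ℝ) τ).restrict_preimage
      (measurableSet_Icc (a := a) (b := b))
    simpa using this
  refine ⟨h.meas.comp_measurePreserving hmp, hmp.quasiMeasurePreserving.ae h.bound, ?_, ?_⟩
  · refine h.cont.comp (by fun_prop) fun t ht => ?_
    exact ⟨by linarith [ht.1], by linarith [ht.2]⟩
  · intro t ht
    have h1 := h.eq (t - τ) ⟨by linarith [ht.1], by linarith [ht.2]⟩
    rw [intervalIntegral.integral_comp_sub_right (fun s => dynamics f (x s) (u s)) τ]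
    simpa using h1

theorem congr_control (h : IsTrajectory f a b u x) {w : ℝ → Euc 2}
    (hw : ∀ t ∈ Ioo a b, w t = u t) : IsTrajectory f a b w x := by
  have hae : u =ᵐ[volume.restrict (Icc a b)] w := by
    rw [← restrict_Ioo_eq_restrict_Icc]
    filter_upwards [ae_restrict_mem measurableSet_Ioo] with t ht using (hw t ht).symm
  refine ⟨h.meas.congr hae, ?_, h.cont, fun t ht => ?_⟩
  · filter_upwards [h.bound, hae] with t h1 h2 using h2 ▸ h1
  · rw [h.eq t ht]
    congr 1
    refine intervalIntegral.integral_congr_ae ?_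
    have h2 := (ae_restrict_iff' measurableSet_Icc).1 hae
    filter_upwards [h2] with s hs hst
    rw [uIoc_of_le ht.1] at hst
    rw [hs ⟨hst.1.le, hst.2.trans ht.2⟩]

theorem norm_sub_le (h : IsTrajectory f a b u x) (hf : FieldBounds f L k) {s t : ℝ}
    (hs : s ∈ Icc a b) (ht : t ∈ Icc a b) : ‖x t - x s‖ ≤ k * |t - s| := by
  rw [h.sub_eq hf hs ht]
  refine intervalIntegral.norm_integral_le_of_norm_le_const_ae ?_
  have h2 := (ae_restrict_iff' measurableSet_Icc).1 h.bound
  filter_upwards [h2] with r hr hrst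
  exact hf.dynamics_norm_le _ (hr (uIcc_subset_Icc hs ht (uIoc_subset_uIcc hrst)))

theorem ae_hasDerivAt (h : IsTrajectory f a b u x) (hf : FieldBounds f L k) :
    ∀ᵐ t ∂(volume.restrict (Icc a b)), HasDerivAt x (dynamics f (x t) (u t)) t := by
  rcases le_or_gt a b with hab | hab
  swap
  · simp [Icc_eq_empty (not_le.2 hab)]
  have ha : a ∈ Icc a b := ⟨le_rfl, hab⟩
  have hb : b ∈ Icc a b := ⟨hab, le_rfl⟩
  have h1 := (h.intervalIntegrable hf ha hb).ae_hasDerivAt_integral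
  rw [← restrict_Ioo_eq_restrict_Icc, ae_restrict_iff' measurableSet_Ioo]
  filter_upwards [h1] with t ht hmem
  rw [uIcc_of_le hab] at ht
  have h2 := (ht (Ioo_subset_Icc_self hmem) a ha).const_add (x a)
  refine h2.congr_of_eventuallyEq ?_
  filter_upwards [Ioo_mem_nhds hmem.1 hmem.2] with r hr
  exact h.eq r (Ioo_subset_Icc_self hr)

/-- The chain rule along a trajectory, in integrated form. -/
theorem comp_sub_eq (h : IsTrajectory f a b u x) (hf : FieldBounds f L k) {F : Euc n → ℝ}
    (hF : ContDiff ℝ 1 F) {s t : ℝ} (hs : s ∈ Icc a b) (ht : t ∈ Icc a b) :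
    F (x t) - F (x s) = ∫ r in s..t, fderiv ℝ F (x r) (dynamics f (x r) (u r)) := by
  have hsub : uIcc s t ⊆ Icc a b := uIcc_subset_Icc hs ht
  have hxl : LipschitzOnWith ⟨k, hf.k_pos.le⟩ x (uIcc s t) := by
    refine LipschitzOnWith.of_dist_le_mul fun r hr r' hr' => ?_
    rw [dist_eq_norm, dist_eq_norm]
    exact h.norm_sub_le hf (hsub hr') (hsub hr)
  have hcomp : IsCompact (x '' uIcc s t) := isCompact_uIcc.image_of_continuousOn (h.cont.mono hsub)
  obtain ⟨R, hR⟩ := hcomp.isBounded.subset_closedBall 0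
  obtain ⟨K, hK⟩ := hF.contDiffOn.exists_lipschitzOnWith (s := Metric.closedBall (0 : Euc n) R)
    (by decide) (convex_closedBall _ _) (isCompact_closedBall _ _)
  have hac : AbsolutelyContinuousOnInterval (F ∘ x) s t :=
    (hK.comp hxl (fun r hr => hR (mem_image_of_mem x hr))).absolutelyContinuousOnInterval
  rw [show F (x t) - F (x s) = (F ∘ x) t - (F ∘ x) s from rfl, ← hac.integral_deriv_eq_sub]
  refine intervalIntegral.integral_congr_ae ?_
  have h2 := (ae_restrict_iff' measurableSet_Icc).1 (h.ae_hasDerivAt hf)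
  filter_upwards [h2] with r hr hrst
  have h3 := hr (hsub (uIoc_subset_uIcc hrst))
  exact (((hF.differentiable (by decide)) (x r)).hasFDerivAt.comp_hasDerivAt r h3).deriv

/-- Two trajectories of the same control stay within an exponential factor of each other. -/
theorem norm_sub_le_exp (h : IsTrajectory f a b u x) (hf : FieldBounds f L k) {y : ℝ → Euc n}
    (hy : IsTrajectory f a b u y) {t : ℝ} (ht : t ∈ Icc a b) :
    ‖y t - x t‖ ≤ ‖y a - x a‖ * Real.exp (2 * L * (t - a)) := by
  have hL := hf.L_pos
  refine gronwall_integral (φ := fun t => ‖y t - x t‖) (by positivity)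
    (hy.cont.sub h.cont).norm (fun r hr => ?_) t ht
  have ha : a ∈ Icc a b := ⟨le_rfl, hr.1.trans hr.2⟩
  have hsub : Icc a r ⊆ Icc a b := Icc_subset_Icc_right hr.2
  have e : y r - x r = (y a - x a) +
      ∫ s in a..r, (dynamics f (y s) (u s) - dynamics f (x s) (u s)) := by
    rw [intervalIntegral.integral_sub (hy.intervalIntegrable hf ha hr)
      (h.intervalIntegrable hf ha hr), h.eq r hr, hy.eq r hr]
    abel
  rw [e]
  refine (norm_add_le _ _).trans (add_le_add_right ?_ _)
  rw [← intervalIntegral.integral_const_mul]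
  refine intervalIntegral.norm_integral_le_of_norm_le hr.1 ?_ ?_
  · have h2 := (ae_restrict_iff' measurableSet_Icc).1 h.bound
    filter_upwards [h2] with s hs hsr
    exact hf.dynamics_sub_le _ _ (hs (hsub (Ioc_subset_Icc_self hsr)))
  · refine ContinuousOn.intervalIntegrable_of_Icc hr.1 ?_
    exact continuousOn_const.mul ((hy.cont.sub h.cont).norm.mono hsub)

theorem norm_sub_shift_le (h : IsTrajectory f a b u x) (hf : FieldBounds f L k) {y : ℝ → Euc n}
    {τ : ℝ} (hy : IsTrajectory f (a + τ) (b + τ) (fun t => u (t - τ)) y) {t : ℝ}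
    (ht : t ∈ Icc (a + τ) (b + τ)) :
    ‖y t - x (t - τ)‖ ≤ ‖y (a + τ) - x a‖ * Real.exp (2 * L * (t - (a + τ))) := by
  have := (h.shift τ).norm_sub_le_exp hf hy ht
  simpa using this

end IsTrajectory

/-- Every admissible control has a trajectory from every initial point. The right-hand side is only
measurable in time, so the solution is the fixed point of the integral operator, a contraction for
the exponentially weighted supremum norm; the weight is absorbed in the unknown
`w t = exp (-4 L (t - a)) x t`. -/
theorem exists_isTrajectory {n : ℕ} {f : Fin 2 → Euc n → Euc n} {L k a b : ℝ}
    (hf : FieldBounds f L k) (hab : a ≤ b) {u : ℝ → Euc 2}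
    (hu : AEStronglyMeasurable u (volume.restrict (Icc a b)))
    (hb : ∀ᵐ t ∂(volume.restrict (Icc a b)), ‖u t‖ ≤ 1) (x₀ : Euc n) :
    ∃ x, x a = x₀ ∧ IsTrajectory f a b u x := by
  have hL := hf.L_pos
  set lam : ℝ := 4 * L with hlam
  have hlampos : 0 < lam := by positivity
  have ha : a ∈ Icc a b := ⟨le_rfl, hab⟩
  -- the curve of a weighted unknown, extended by constants outside `[a, b]`
  let ext : C(Icc a b, Euc n) → ℝ → Euc n :=
    fun w t => Real.exp (lam * (t - a)) • IccExtend hab w t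
  have hext : ∀ w, Continuous (ext w) := fun w => by
    have : Continuous (IccExtend hab w) := w.continuous.Icc_extend'
    fun_prop
  have hii : ∀ w, ∀ t ∈ Icc a b,
      IntervalIntegrable (fun s => dynamics f (ext w s) (u s)) volume a t := fun w t ht =>
    ((hf.integrableOn_dynamics (hext w).continuousOn hu hb).mono_set
      (uIcc_subset_Icc ha ht)).intervalIntegrable
  let G : C(Icc a b, Euc n) → C(Icc a b, Euc n) := fun w =>
    ⟨fun t => Real.exp (-(lam * (t - a))) •
      (x₀ + ∫ s in a..(t : ℝ), dynamics f (ext w s) (u s)), by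
      have h1 := intervalIntegral.continuousOn_primitive_interval (μ := volume)
        (f := fun s => dynamics f (ext w s) (u s)) (a := a) (b := b)
        (by rw [uIcc_of_le hab]; exact hf.integrableOn_dynamics (hext w).continuousOn hu hb)
      rw [uIcc_of_le hab] at h1
      have h2 := continuousOn_iff_continuous_domRestrict.1 h1
      have h3 : Continuous fun t : Icc a b =>
          ∫ s in a..(t : ℝ), dynamics f (ext w s) (u s) := h2
      fun_prop⟩
  have hG : ContractingWith (1 / 2) G := by
    refine ⟨by rw [← NNReal.coe_lt_coe]; norm_num, LipschitzWith.of_dist_le_mul fun w w' => ?_⟩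
    rw [ContinuousMap.dist_le (by positivity)]
    rintro ⟨t, ht⟩
    simp only [G, ContinuousMap.coe_mk]
    rw [dist_eq_norm, ← smul_sub, norm_smul, Real.norm_eq_abs, Real.abs_exp,
      add_sub_add_left_eq_sub,
      ← intervalIntegral.integral_sub (hii w t ht) (hii w' t ht)]
    have h1 : ‖∫ s in a..t, (dynamics f (ext w s) (u s) - dynamics f (ext w' s) (u s))‖ ≤
        ∫ s in a..t, 2 * L * dist w w' * Real.exp (lam * (s - a)) := by
      refine intervalIntegral.norm_integral_le_of_norm_le ht.1 ?_
        (Continuous.intervalIntegrable (by fun_prop) _ _)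
      have h2 := (ae_restrict_iff' measurableSet_Icc).1 hb
      filter_upwards [h2] with s hs hst
      have hsm : s ∈ Icc a b := ⟨hst.1.le, hst.2.trans ht.2⟩
      refine (hf.dynamics_sub_le _ _ (hs hsm)).trans ?_
      simp only [ext]
      rw [← smul_sub, norm_smul, Real.norm_eq_abs, Real.abs_exp, IccExtend_of_mem hab _ hsm,
        IccExtend_of_mem hab _ hsm, ← dist_eq_norm]
      have := ContinuousMap.dist_apply_le_dist (f := w) (g := w') ⟨s, hsm⟩
      calc _ ≤ 2 * L * (Real.exp (lam * (s - a)) * dist w w') := by gcongr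
        _ = _ := by ring
    have h3 : ∫ s in a..t, 2 * L * dist w w' * Real.exp (lam * (s - a)) =
        2 * L * dist w w' * ((Real.exp (lam * (t - a)) - 1) / lam) := by
      rw [intervalIntegral.integral_const_mul]
      congr 1
      have hd : ∀ s ∈ uIcc a t, HasDerivAt (fun s => Real.exp (lam * (s - a)) / lam)
          (Real.exp (lam * (s - a))) s := by
        intro s _
        have h5 : HasDerivAt (fun s => lam * (s - a)) lam s := by
          simpa using ((hasDerivAt_id s).sub_const a).const_mul lam
        have := (h5.exp).div_const lam
        rwa [mul_div_assoc, div_self hlampos.ne', mul_one] at this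
      rw [intervalIntegral.integral_eq_sub_of_hasDerivAt hd
        (Continuous.intervalIntegrable (by fun_prop) _ _)]
      simp
      ring
    rw [h3] at h1
    calc Real.exp (-(lam * (t - a))) * _ ≤ Real.exp (-(lam * (t - a))) *
          (2 * L * dist w w' * ((Real.exp (lam * (t - a))) / lam)) := by
          gcongr
          refine h1.trans ?_
          gcongr
          linarith
      _ = (Real.exp (-(lam * (t - a))) * Real.exp (lam * (t - a))) * (2 * L / lam) *
            dist w w' := by ring
      _ = 1 / 2 * dist w w' := by
          rw [← Real.exp_add, neg_add_cancel, Real.exp_zero, hlam]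
          field_simp
          norm_num
      _ = _ := by simp
  obtain ⟨w, hw⟩ : ∃ w, G w = w := ⟨_, hG.fixedPoint_isFixedPt⟩
  have hval : ∀ t ∈ Icc a b, ext w t = x₀ + ∫ s in a..t, dynamics f (ext w s) (u s) := by
    intro t ht
    have h1 : G w ⟨t, ht⟩ = w ⟨t, ht⟩ := by rw [hw]
    simp only [G, ContinuousMap.coe_mk] at h1
    have h2 : ext w t = Real.exp (lam * (t - a)) • w ⟨t, ht⟩ := by
      simp only [ext]
      rw [IccExtend_of_mem hab _ ht]
    rw [h2, ← h1, smul_smul, ← Real.exp_add, add_neg_cancel, Real.exp_zero, one_smul]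
  have h0 : ext w a = x₀ := by simpa using hval a ha
  refine ⟨ext w, h0, hu, hb, (hext w).continuousOn, fun t ht => ?_⟩
  rw [h0]
  exact hval t ht

/-! ### Derivatives of the constraint function along the vector fields -/

/-- The derivative `∇h · f_i` of the constraint function along the `i`-th vector field. -/
noncomputable def lieDeriv {n : ℕ} (f : Fin 2 → Euc n → Euc n) (h : Euc n → ℝ)
    (i : Fin 2) (x : Euc n) : ℝ :=
  fderiv ℝ h x (f i x)

section LieDeriv

variable {n : ℕ} {f : Fin 2 → Euc n → Euc n} {h : Euc n → ℝ}

theorem contDiff_lieDeriv (hf : ∀ i, ContDiff ℝ 2 (f i)) (hh : ContDiff ℝ 2 h) (i : Fin 2) :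
    ContDiff ℝ 1 (lieDeriv f h i) := by
  have h1 : ContDiff ℝ 1 (fderiv ℝ h) := hh.fderiv_right (by norm_num)
  exact h1.clm_apply ((hf i).of_le (by norm_num))

theorem fderiv_lieDeriv_apply (hf : ∀ i, ContDiff ℝ 2 (f i)) (hh : ContDiff ℝ 2 h) (i : Fin 2)
    (x v : Euc n) : fderiv ℝ (lieDeriv f h i) x v =
      fderiv ℝ (fderiv ℝ h) x v (f i x) + fderiv ℝ h x (fderiv ℝ (f i) x v) := by
  have h1 : ContDiff ℝ 1 (fderiv ℝ h) := hh.fderiv_right (by norm_num)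
  have hd1 := (h1.differentiable (by norm_num)) x
  have hd2 := ((hf i).differentiable (by norm_num)) x
  have := hd1.hasFDerivAt.clm_apply hd2.hasFDerivAt
  rw [show lieDeriv f h i = fun y => fderiv ℝ h y (f i y) from rfl, this.fderiv]
  simp [add_comm]

/-- The antisymmetric part of the second-order coefficients is the derivative of `h` along the
Lie bracket, because `D²h` is symmetric. -/
theorem fderiv_lieDeriv_sub (hf : ∀ i, ContDiff ℝ 2 (f i)) (hh : ContDiff ℝ 2 h) (x : Euc n) :
    fderiv ℝ (lieDeriv f h 0) x (f 1 x) - fderiv ℝ (lieDeriv f h 1) x (f 0 x) =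
      -fderiv ℝ h x (VectorField.lieBracket ℝ (f 0) (f 1) x) := by
  have hs : IsSymmSndFDerivAt ℝ h x := hh.contDiffAt.isSymmSndFDerivAt (by simp)
  rw [fderiv_lieDeriv_apply hf hh, fderiv_lieDeriv_apply hf hh, hs.eq (f 1 x) (f 0 x)]
  simp only [VectorField.lieBracket, map_sub]
  ring

theorem fderiv_dynamics (x : Euc n) (u : Euc 2) :
    fderiv ℝ h x (dynamics f x u) = u 0 * lieDeriv f h 0 x + u 1 * lieDeriv f h 1 x := by
  simp [dynamics_eq, lieDeriv]

end LieDeriv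

/-- First-order Taylor expansion of a `C¹` function, uniform on a ball. -/
theorem uniform_taylor {n : ℕ} {F : Euc n → ℝ} (hF : ContDiff ℝ 1 F) (R : ℝ) {ε : ℝ}
    (hε : 0 < ε) : ∃ ρ > 0, ∀ x ∈ Metric.closedBall (0 : Euc n) R,
      ∀ y ∈ Metric.closedBall (0 : Euc n) R, ‖y - x‖ ≤ ρ →
        |F y - F x - fderiv ℝ F x (y - x)| ≤ ε * ‖y - x‖ := by
  have hc : Continuous (fderiv ℝ F) := hF.continuous_fderiv (by norm_num)
  have huc := (isCompact_closedBall (0 : Euc n) R).uniformContinuousOn_of_continuous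
    hc.continuousOn
  rw [Metric.uniformContinuousOn_iff_le] at huc
  obtain ⟨ρ, hρ, H⟩ := huc ε hε
  refine ⟨ρ, hρ, fun x hx y hy hxy => ?_⟩
  have hconv : Convex ℝ (Metric.closedBall (0 : Euc n) R ∩ Metric.closedBall x ρ) :=
    (convex_closedBall _ _).inter (convex_closedBall _ _)
  have := hconv.norm_image_sub_le_of_norm_hasFDerivWithin_le' (f := F) (f' := fderiv ℝ F)
    (φ := fderiv ℝ F x) (C := ε) (x := x) (y := y)
    (fun z _ => ((hF.differentiable (by norm_num)) z).hasFDerivAt.hasFDerivWithinAt)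
    (fun z hz => by
      rw [← dist_eq_norm]
      exact H z hz.1 x hx hz.2)
    ⟨hx, Metric.mem_closedBall_self hρ.le⟩
    ⟨hy, by rwa [Metric.mem_closedBall, dist_eq_norm]⟩
  simpa [Real.norm_eq_abs] using this

theorem exists_fderiv_bound {n : ℕ} {F : Euc n → ℝ} (hF : ContDiff ℝ 1 F) (R : ℝ) :
    ∃ D > 0, ∀ x ∈ Metric.closedBall (0 : Euc n) R, ‖fderiv ℝ F x‖ ≤ D := by
  have hc : Continuous (fderiv ℝ F) := hF.continuous_fderiv (by norm_num)
  obtain ⟨D, hD⟩ := (isCompact_closedBall (0 : Euc n) R).exists_bound_of_continuousOn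
    hc.continuousOn
  exact ⟨max D 1, by positivity, fun x hx => (hD x hx).trans (le_max_left _ _)⟩

theorem abs_sub_le_of_fderiv_bound {n : ℕ} {F : Euc n → ℝ} (hF : ContDiff ℝ 1 F) {R D : ℝ}
    (hD : ∀ x ∈ Metric.closedBall (0 : Euc n) R, ‖fderiv ℝ F x‖ ≤ D) {x y : Euc n}
    (hx : x ∈ Metric.closedBall (0 : Euc n) R) (hy : y ∈ Metric.closedBall (0 : Euc n) R) :
    |F y - F x| ≤ D * ‖y - x‖ :=
  (convex_closedBall (0 : Euc n) R).norm_image_sub_le_of_norm_fderiv_le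
    (fun z _ => (hF.differentiable (by norm_num)) z) hD hx hy

/-! ### Descent controls -/

/-- The trajectories of `U` from `x₀` inside `B` enter `{h < h x₀}` at once, and from time `s` on
they have lowered `h` by `m` and moved by at most `C m`. The terminal time `t₁` is arbitrary, since
the time horizon may interrupt the descent. -/
def IsDescentControl {n : ℕ} (f : Fin 2 → Euc n → Euc n) (h : Euc n → ℝ) (B : Set (Euc n))
    (x₀ : Euc n) (s m C : ℝ) (U : ℝ → Euc 2) : Prop :=
  Measurable U ∧ (∀ t, ‖U t‖ ≤ 1) ∧ ∀ t₁ z, IsTrajectory f 0 t₁ U z → z 0 = x₀ →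
    (∀ t ∈ Icc 0 t₁, z t ∈ B) →
      (∀ t ∈ Ioc 0 t₁, h (z t) < h x₀) ∧
        ∀ t ∈ Icc 0 t₁, s ≤ t → h (z t) ≤ h x₀ - m ∧ ‖z t - x₀‖ ≤ C * m

theorem IsDescentControl.mono {n : ℕ} {f : Fin 2 → Euc n → Euc n} {h : Euc n → ℝ}
    {B : Set (Euc n)} {x₀ : Euc n} {s s' m C C' : ℝ} {U : ℝ → Euc 2}
    (hU : IsDescentControl f h B x₀ s m C U) (hs : s ≤ s') (hm : 0 ≤ m) (hC : C ≤ C') :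
    IsDescentControl f h B x₀ s' m C' U := by
  refine ⟨hU.1, hU.2.1, fun t₁ z hz h0 hB => ⟨(hU.2.2 t₁ z hz h0 hB).1, fun t ht hst => ?_⟩⟩
  obtain ⟨h1, h2⟩ := (hU.2.2 t₁ z hz h0 hB).2 t ht (hs.trans hst)
  exact ⟨h1, h2.trans (by gcongr)⟩

/-- The system is driftless, so a trajectory rests while the control vanishes. -/
theorem IsTrajectory.eq_of_control_eq_zero {n : ℕ} {f : Fin 2 → Euc n → Euc n} {L k a b : ℝ}
    {u : ℝ → Euc 2} {x : ℝ → Euc n} (hx : IsTrajectory f a b u x) (hf : FieldBounds f L k)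
    {s t : ℝ} (hs : s ∈ Icc a b) (ht : t ∈ Icc a b) (hst : s ≤ t)
    (hu : ∀ r ∈ Ioc s t, u r = 0) : x t = x s := by
  rw [← sub_eq_zero, hx.sub_eq hf hs ht]
  rw [intervalIntegral.integral_of_le hst]
  refine setIntegral_eq_zero_of_forall_eq_zero fun r hr => ?_
  simp [hu r hr, dynamics]

/-- To check that "apply `V` up to time `s`, then rest" is a descent control, it is enough to follow
the trajectories of `V` up to time `s`. -/
theorem isDescentControl_of_le {n : ℕ} {f : Fin 2 → Euc n → Euc n} {h : Euc n → ℝ} {L k : ℝ}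
    (hf : FieldBounds f L k) {B : Set (Euc n)} {x₀ : Euc n} {s m C : ℝ} (hs : 0 < s)
    {V : ℝ → Euc 2} (hV : Measurable V) (hV1 : ∀ t, ‖V t‖ ≤ 1)
    (H : ∀ t₁ z, t₁ ≤ s → IsTrajectory f 0 t₁ V z → z 0 = x₀ → (∀ t ∈ Icc 0 t₁, z t ∈ B) →
      (∀ t ∈ Ioc 0 t₁, h (z t) < h x₀) ∧ (t₁ = s → h (z s) ≤ h x₀ - m ∧ ‖z s - x₀‖ ≤ C * m))
    (hm : 0 < m) :
    IsDescentControl f h B x₀ s m C (fun t => if t ≤ s then V t else 0) := by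
  refine ⟨Measurable.ite measurableSet_Iic hV measurable_const, fun t => ?_, ?_⟩
  · dsimp only
    split_ifs
    · exact hV1 t
    · simp
  intro t₁ z hz h0 hB
  have hres : IsTrajectory f 0 (min t₁ s) V z :=
    (hz.restrict hf le_rfl (min_le_left _ _)).congr_control fun t ht => by
      rw [if_pos (ht.2.le.trans (min_le_right _ _))]
  obtain ⟨h1, h2⟩ := H (min t₁ s) z (min_le_right _ _) hres h0 fun t ht =>
    hB t ⟨ht.1, ht.2.trans (min_le_left _ _)⟩
  have hrest : ∀ t ∈ Icc 0 t₁, s ≤ t → z t = z s := fun t ht hst =>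
    hz.eq_of_control_eq_zero hf ⟨hs.le, hst.trans ht.2⟩ ht hst fun r hr => by
      rw [if_neg (not_le.2 hr.1)]
  have hend : ∀ t ∈ Icc 0 t₁, s ≤ t → h (z t) ≤ h x₀ - m ∧ ‖z t - x₀‖ ≤ C * m := fun t ht hst => by
    rw [hrest t ht hst]
    exact h2 (min_eq_right (hst.trans ht.2))
  refine ⟨fun t ht => ?_, hend⟩
  rcases le_total t s with hts | hts
  · exact h1 t ⟨ht.1, le_min ht.2 hts⟩
  · exact (hend t ⟨ht.1.le, ht.2⟩ hts).1.trans_lt (by linarith)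

/-- Where a derivative along the fields is bounded away from zero, steepest descent with a constant
control lowers `h` at a linear rate. -/
theorem exists_descent_of_lieDeriv {n : ℕ} {f : Fin 2 → Euc n → Euc n} {h : Euc n → ℝ} {L k : ℝ}
    (hf : FieldBounds f L k) (hf2 : ∀ i, ContDiff ℝ 2 (f i)) (hh : ContDiff ℝ 2 h) (R : ℝ) {c : ℝ}
    (hc : 0 < c) : ∃ κ > 0, ∃ C > 0, ∃ m₀ > 0, ∀ x₀ ∈ Metric.closedBall (0 : Euc n) R,
      c ≤ √(lieDeriv f h 0 x₀ ^ 2 + lieDeriv f h 1 x₀ ^ 2) → ∀ m ∈ Ioc 0 m₀,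
        ∃ U, IsDescentControl f h (Metric.closedBall 0 R) x₀ (κ * √m) m C U := by
  have hk := hf.k_pos
  obtain ⟨D₀, hD₀, hb₀⟩ := exists_fderiv_bound (contDiff_lieDeriv hf2 hh 0) R
  obtain ⟨D₁, hD₁, hb₁⟩ := exists_fderiv_bound (contDiff_lieDeriv hf2 hh 1) R
  set D := D₀ + D₁ with hDdef
  have hD : 0 < D := by positivity
  refine ⟨2 / c, by positivity, 2 * k / c, by positivity, min 1 (c ^ 2 / (4 * D * k)),
    by positivity, fun x₀ hx₀ hpc m hm => ?_⟩
  have hm0 := hm.1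
  have hm1 : m ≤ 1 := hm.2.trans (min_le_left _ _)
  have hm2 : m * (4 * D * k) ≤ c ^ 2 := by
    rw [← le_div_iff₀ (by positivity)]; exact hm.2.trans (min_le_right _ _)
  set p₀ := lieDeriv f h 0 x₀
  set p₁ := lieDeriv f h 1 x₀
  set q := √(p₀ ^ 2 + p₁ ^ 2) with hq
  have hq0 : 0 < q := hc.trans_le hpc
  have hqq : q ^ 2 = p₀ ^ 2 + p₁ ^ 2 := Real.sq_sqrt (by positivity)
  have hs : 0 < 2 * m / c := by positivity
  set V : ℝ → Euc 2 := fun _ => !₂[-p₀ / q, -p₁ / q] with hVdef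
  have hV1 : ∀ t, ‖V t‖ ≤ 1 := fun t => by
    have : ‖V t‖ ^ 2 = 1 := by
      rw [EuclideanSpace.norm_sq_eq]
      simp only [hVdef, Fin.sum_univ_two, Real.norm_eq_abs, sq_abs]
      simp only [Matrix.cons_val_zero, Matrix.cons_val_one]
      field_simp
      linarith
    nlinarith [norm_nonneg (V t)]
  refine ⟨_, (isDescentControl_of_le hf (C := 2 * k / c) hs (V := V) measurable_const hV1
    ?_ hm0).mono ?_ hm0.le le_rfl⟩
  · intro t₁ z ht₁ hz hz0 hzB
    -- the descent rate is at least `c / 2` as long as `t ≤ 2 m / c`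
    have hdesc : ∀ t ∈ Icc 0 t₁, h (z t) - h x₀ ≤ -(c / 2) * t := by
      intro t ht
      have h0m : (0 : ℝ) ∈ Icc 0 t₁ := ⟨le_rfl, ht.1.trans ht.2⟩
      have hcomp := hz.comp_sub_eq hf (hh.of_le (by norm_num)) h0m ht
      rw [hz0] at hcomp
      rw [hcomp]
      have hrate : ∀ r ∈ Icc 0 t, fderiv ℝ h (z r) (dynamics f (z r) (V r)) ≤ -(c / 2) := by
        intro r hr
        have hrm : r ∈ Icc 0 t₁ := ⟨hr.1, hr.2.trans ht.2⟩
        have hdist : ‖z r - x₀‖ ≤ k * r := by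
          have := hz.norm_sub_le hf h0m hrm
          rwa [hz0, sub_zero, abs_of_nonneg hr.1] at this
        have e0 := abs_sub_le_of_fderiv_bound (contDiff_lieDeriv hf2 hh 0) hb₀ hx₀ (hzB r hrm)
        have e1 := abs_sub_le_of_fderiv_bound (contDiff_lieDeriv hf2 hh 1) hb₁ hx₀ (hzB r hrm)
        have v0 : |(V r) 0| ≤ 1 := abs_coord_le_one (hV1 r) 0
        have v1 : |(V r) 1| ≤ 1 := abs_coord_le_one (hV1 r) 1
        rw [fderiv_dynamics]
        have w0 : (V r) 0 * (lieDeriv f h 0 (z r) - p₀) ≤ D₀ * (k * r) := by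
          refine (le_abs_self _).trans ?_
          rw [abs_mul]
          calc _ ≤ 1 * (D₀ * ‖z r - x₀‖) := by gcongr
            _ ≤ _ := by rw [one_mul]; gcongr
        have w1 : (V r) 1 * (lieDeriv f h 1 (z r) - p₁) ≤ D₁ * (k * r) := by
          refine (le_abs_self _).trans ?_
          rw [abs_mul]
          calc _ ≤ 1 * (D₁ * ‖z r - x₀‖) := by gcongr
            _ ≤ _ := by rw [one_mul]; gcongr
        have hsum : (V r) 0 * p₀ + (V r) 1 * p₁ = -q := by
          simp only [hVdef, PiLp.toLp_apply, Matrix.cons_val_zero, Matrix.cons_val_one]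
          field_simp
          linarith
        have hr2 : r ≤ 2 * m / c := hrm.2.trans ht₁
        have : D * (k * r) ≤ c / 2 := by
          calc D * (k * r) ≤ D * (k * (2 * m / c)) := by gcongr
            _ = m * (4 * D * k) / (2 * c) := by field_simp; ring
            _ ≤ c ^ 2 / (2 * c) := by gcongr
            _ = c / 2 := by field_simp
        have : D * (k * r) = D₀ * (k * r) + D₁ * (k * r) := by rw [hDdef]; ring
        linarith
      have hint : IntervalIntegrable (fun r => fderiv ℝ h (z r) (dynamics f (z r) (V r)))
          volume 0 t := by
        refine ContinuousOn.intervalIntegrable_of_Icc ht.1 ?_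
        have hzc : ContinuousOn z (Icc 0 t) := hz.cont.mono (Icc_subset_Icc_right ht.2)
        have h1 : Continuous fun y : Euc n => fderiv ℝ h y (dynamics f y (V 0)) := by
          simp only [fderiv_dynamics]
          have := (contDiff_lieDeriv hf2 hh 0).continuous
          have := (contDiff_lieDeriv hf2 hh 1).continuous
          fun_prop
        exact h1.comp_continuousOn hzc
      have := intervalIntegral.integral_mono_on ht.1 hint
        (intervalIntegrable_const (c := -(c / 2))) hrate
      rw [intervalIntegral.integral_const, sub_zero, smul_eq_mul] at this
      linarith
    refine ⟨fun t ht => ?_, fun heq => ?_⟩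
    · have := hdesc t ⟨ht.1.le, ht.2⟩
      have : 0 < c / 2 * t := mul_pos (by positivity) ht.1
      linarith
    · rw [heq] at hdesc hz
      have hsm : 2 * m / c ∈ Icc 0 (2 * m / c) := ⟨hs.le, le_rfl⟩
      have h1 := hdesc _ hsm
      have h2 : c / 2 * (2 * m / c) = m := by field_simp
      have h3 := hz.norm_sub_le hf (left_mem_Icc.2 hs.le) hsm
      rw [hz0, sub_zero, abs_of_pos hs] at h3
      exact ⟨by linarith, h3.trans (le_of_eq (by ring))⟩
  · have : m ≤ √m := Real.le_sqrt_of_sq_le (by nlinarith)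
    calc 2 * m / c = 2 / c * m := by ring
      _ ≤ 2 / c * √m := by gcongr

/-! ### The logarithmic loop -/

theorem continuous_mul_comp_log {g : ℝ → ℝ} (hg : Continuous g) {M : ℝ} (hM : ∀ y, |g y| ≤ M)
    (ω : ℝ) {s : ℝ} (hs : 0 < s) : Continuous fun t => t * g (ω * Real.log (t / s)) := by
  rw [continuous_iff_continuousAt]
  intro t
  rcases eq_or_ne t 0 with rfl | ht
  · have h0 : Filter.Tendsto (fun t : ℝ => |t| * M) (nhds 0) (nhds 0) := by
      have : Continuous fun t : ℝ => |t| * M := by fun_prop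
      simpa using this.tendsto 0
    have : Filter.Tendsto (fun t => t * g (ω * Real.log (t / s))) (nhds 0) (nhds 0) := by
      refine squeeze_zero_norm (fun t => ?_) h0
      rw [Real.norm_eq_abs, abs_mul]
      gcongr
      exact hM _
    simpa [ContinuousAt] using this
  · have : ContinuousAt (fun t => Real.log (t / s)) t :=
      ContinuousAt.log (by fun_prop) (div_ne_zero ht hs.ne')
    exact continuousAt_id.mul (hg.continuousAt.comp (this.const_mul ω))

/-- The angle `ω log (t / s)` of the logarithmic loop of duration `s`. -/
noncomputable def loopAngle (ω s t : ℝ) : ℝ := ω * Real.log (t / s)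

/-- First coordinate, in the frame of the loop, of the logarithmic loop
`t (1 - exp (i ω log (t / s))) / Ω`, which is closed: it is at `0` at times `0` and `s`. -/
noncomputable def loopFst (ω Ω s t : ℝ) : ℝ := t * (1 - Real.cos (loopAngle ω s t)) / Ω

/-- Second coordinate of the logarithmic loop, see `loopFst`. -/
noncomputable def loopSnd (ω Ω s t : ℝ) : ℝ := -(t * Real.sin (loopAngle ω s t)) / Ω

/-- The velocity of `loopFst`. -/
noncomputable def loopFstVel (ω Ω s t : ℝ) : ℝ :=
  (1 - Real.cos (loopAngle ω s t) + ω * Real.sin (loopAngle ω s t)) / Ω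

/-- The velocity of `loopSnd`. -/
noncomputable def loopSndVel (ω Ω s t : ℝ) : ℝ :=
  -(Real.sin (loopAngle ω s t) + ω * Real.cos (loopAngle ω s t)) / Ω

/-- The integral over `[0, t]` of `r (1 - cos (ω log (r / s)))`, which is, up to the factor
`ω / Ω²`, twice the signed area swept by the loop. -/
noncomputable def loopArea (ω s t : ℝ) : ℝ :=
  t ^ 2 / 2 - t ^ 2 * (2 * Real.cos (loopAngle ω s t) + ω * Real.sin (loopAngle ω s t)) /
    (4 + ω ^ 2)

section Loop

variable {ω Ω s t : ℝ}

theorem hasDerivAt_loopAngle (hs : 0 < s) (ht : 0 < t) :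
    HasDerivAt (loopAngle ω s) (ω / t) t := by
  have h1 : HasDerivAt (fun t => t / s) (1 / s) t := (hasDerivAt_id t).div_const s
  have h2 := (h1.log (div_ne_zero ht.ne' hs.ne')).const_mul ω
  refine h2.congr_deriv ?_
  field_simp

theorem hasDerivAt_loopFst (hs : 0 < s) (ht : 0 < t) :
    HasDerivAt (loopFst ω Ω s) (loopFstVel ω Ω s t) t := by
  have h1 := hasDerivAt_loopAngle (ω := ω) hs ht
  have h2 := ((hasDerivAt_id t).mul (h1.cos.const_sub 1)).div_const Ω
  refine h2.congr_deriv ?_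
  simp only [loopFstVel, id]
  field_simp

theorem hasDerivAt_loopSnd (hs : 0 < s) (ht : 0 < t) :
    HasDerivAt (loopSnd ω Ω s) (loopSndVel ω Ω s t) t := by
  have h1 := hasDerivAt_loopAngle (ω := ω) hs ht
  have h2 := ((hasDerivAt_id t).mul h1.sin).neg.div_const Ω
  refine h2.congr_deriv ?_
  simp only [loopSndVel, id]
  field_simp

theorem hasDerivAt_loopArea (hs : 0 < s) (ht : 0 < t) :
    HasDerivAt (loopArea ω s) (t * (1 - Real.cos (loopAngle ω s t))) t := by
  have h1 := hasDerivAt_loopAngle (ω := ω) hs ht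
  have hsq : HasDerivAt (fun t : ℝ => t ^ 2) (2 * t) t := by simpa using hasDerivAt_pow 2 t
  have h2 := (hsq.div_const 2).sub
    ((hsq.mul ((h1.cos.const_mul 2).add (h1.sin.const_mul ω))).div_const (4 + ω ^ 2))
  refine h2.congr_deriv ?_
  have : (4 + ω ^ 2) ≠ 0 := by positivity
  simp only [Pi.add_apply]
  field_simp
  ring

theorem continuous_loopFst (hs : 0 < s) : Continuous (loopFst ω Ω s) := by
  refine (continuous_mul_comp_log (g := fun y => 1 - Real.cos y) (M := 2) (by fun_prop)
    (fun y => ?_) ω hs).div_const Ω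
  rw [abs_le]
  constructor <;> linarith [Real.neg_one_le_cos y, Real.cos_le_one y]

theorem continuous_loopSnd (hs : 0 < s) : Continuous (loopSnd ω Ω s) :=
  (continuous_mul_comp_log (g := Real.sin) (M := 1) Real.continuous_sin Real.abs_sin_le_one
    ω hs).neg.div_const Ω

theorem continuous_loopArea (hs : 0 < s) : Continuous (loopArea ω s) := by
  have h1 : Continuous fun t => t * Real.cos (loopAngle ω s t) :=
    continuous_mul_comp_log (g := Real.cos) (M := 1) Real.continuous_cos Real.abs_cos_le_one ω hs
  have h2 : Continuous fun t => t * Real.sin (loopAngle ω s t) :=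
    continuous_mul_comp_log (g := Real.sin) (M := 1) Real.continuous_sin Real.abs_sin_le_one ω hs
  have h3 : loopArea ω s = fun t => t ^ 2 / 2 - t * (2 * (t * Real.cos (loopAngle ω s t)) +
      ω * (t * Real.sin (loopAngle ω s t))) / (4 + ω ^ 2) := by
    funext t; simp only [loopArea]; ring
  rw [h3]
  fun_prop

theorem measurable_loopAngle : Measurable (loopAngle ω s) := by
  unfold loopAngle
  fun_prop

theorem measurable_loopFstVel : Measurable (loopFstVel ω Ω s) := by
  have := measurable_loopAngle (ω := ω) (s := s)
  unfold loopFstVel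
  fun_prop

theorem measurable_loopSndVel : Measurable (loopSndVel ω Ω s) := by
  have := measurable_loopAngle (ω := ω) (s := s)
  unfold loopSndVel
  fun_prop

theorem loopVel_sq_le (hΩ : Ω = 2 + |ω|) :
    loopFstVel ω Ω s t ^ 2 + loopSndVel ω Ω s t ^ 2 ≤ 1 := by
  have hΩ0 : 0 < Ω := by rw [hΩ]; positivity
  have e : loopFstVel ω Ω s t ^ 2 + loopSndVel ω Ω s t ^ 2 =
      (2 + ω ^ 2 - 2 * Real.cos (loopAngle ω s t) + 2 * (ω * Real.sin (loopAngle ω s t))) /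
        Ω ^ 2 := by
    simp only [loopFstVel, loopSndVel]
    field_simp
    linear_combination (1 + ω ^ 2) * Real.sin_sq_add_cos_sq (loopAngle ω s t)
  rw [e, div_le_one (by positivity), hΩ]
  have h1 : ω * Real.sin (loopAngle ω s t) ≤ |ω| := by
    refine (le_abs_self _).trans ?_
    rw [abs_mul]
    exact mul_le_of_le_one_right (abs_nonneg _) (Real.abs_sin_le_one _)
  nlinarith [Real.neg_one_le_cos (loopAngle ω s t), sq_abs ω, abs_nonneg ω]

theorem loopFst_nonneg (hΩ : 0 < Ω) (ht : 0 ≤ t) : 0 ≤ loopFst ω Ω s t := by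
  have := Real.cos_le_one (loopAngle ω s t)
  exact div_nonneg (mul_nonneg ht (by linarith)) hΩ.le

theorem loop_sq_le (hΩ : 0 < Ω) :
    loopFst ω Ω s t ^ 2 + loopSnd ω Ω s t ^ 2 ≤ 4 * t ^ 2 / Ω ^ 2 := by
  have e : loopFst ω Ω s t ^ 2 + loopSnd ω Ω s t ^ 2 =
      t ^ 2 * (2 - 2 * Real.cos (loopAngle ω s t)) / Ω ^ 2 := by
    simp only [loopFst, loopSnd]
    field_simp
    linear_combination t ^ 2 * Real.sin_sq_add_cos_sq (loopAngle ω s t)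
  rw [e]
  refine div_le_div_of_nonneg_right ?_ (sq_nonneg Ω)
  nlinarith [Real.neg_one_le_cos (loopAngle ω s t), sq_nonneg t]

theorem loopArea_ge (hω : 6 ≤ |ω|) : t ^ 2 / 4 ≤ loopArea ω s t := by
  have h1 : 2 * Real.cos (loopAngle ω s t) + ω * Real.sin (loopAngle ω s t) ≤ 2 + |ω| := by
    have : ω * Real.sin (loopAngle ω s t) ≤ |ω| := by
      refine (le_abs_self _).trans ?_
      rw [abs_mul]
      exact mul_le_of_le_one_right (abs_nonneg _) (Real.abs_sin_le_one _)
    linarith [Real.cos_le_one (loopAngle ω s t)]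
  have h2 : (2 * Real.cos (loopAngle ω s t) + ω * Real.sin (loopAngle ω s t)) / (4 + ω ^ 2)
      ≤ 1 / 4 := by
    rw [div_le_iff₀ (by positivity)]
    nlinarith [sq_abs ω]
  have h3 := mul_le_mul_of_nonneg_left h2 (sq_nonneg t)
  simp only [loopArea]
  rw [mul_div_assoc]
  linarith

theorem loop_wronskian (hΩ : Ω ≠ 0) :
    loopFst ω Ω s t * loopSndVel ω Ω s t - loopSnd ω Ω s t * loopFstVel ω Ω s t =
      ω / Ω ^ 2 * (t * (1 - Real.cos (loopAngle ω s t))) := by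
  simp only [loopFst, loopSnd, loopFstVel, loopSndVel]
  field_simp
  linear_combination ω * t * Real.sin_sq_add_cos_sq (loopAngle ω s t)

theorem loopFst_zero : loopFst ω Ω s 0 = 0 := by simp [loopFst]

theorem loopSnd_zero : loopSnd ω Ω s 0 = 0 := by simp [loopSnd]

theorem loopArea_zero : loopArea ω s 0 = 0 := by simp [loopArea]

theorem loopFst_end (hs : s ≠ 0) : loopFst ω Ω s s = 0 := by simp [loopFst, loopAngle, hs]

theorem loopSnd_end (hs : s ≠ 0) : loopSnd ω Ω s s = 0 := by simp [loopSnd, loopAngle, hs]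

end Loop

/-- The fundamental theorem of calculus on `[0, t]` for a bounded measurable derivative that may
be undefined at `0`. -/
theorem integral_eq_of_hasDerivAt_of_bounded {F F' : ℝ → ℝ} {t M : ℝ} (ht : 0 ≤ t)
    (hF : Continuous F) (hd : ∀ r, 0 < r → HasDerivAt F (F' r) r) (hm : Measurable F')
    (hM : ∀ r ∈ Icc 0 t, |F' r| ≤ M) (h0 : F 0 = 0) :
    IntervalIntegrable F' volume 0 t ∧ ∫ r in 0..t, F' r = F t := by
  have hi : IntervalIntegrable F' volume 0 t := by
    rw [intervalIntegrable_iff_integrableOn_Icc_of_le ht]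
    refine Integrable.of_bound hm.aestronglyMeasurable M ?_
    filter_upwards [ae_restrict_mem measurableSet_Icc] with r hr using hM r hr
  refine ⟨hi, ?_⟩
  rw [intervalIntegral.integral_eq_sub_of_hasDerivAt_of_le ht hF.continuousOn
    (fun r hr => hd r hr.1) hi, h0, sub_zero]

/-- Along a trajectory from `x₀` whose control has primitive `X`, the displacement is
`X₁ f₁(x₀) + X₂ f₂(x₀)` up to a second-order error. -/
theorem IsTrajectory.norm_sub_frozen_le {n : ℕ} {f : Fin 2 → Euc n → Euc n} {L k t : ℝ}
    {u : ℝ → Euc 2} {z : ℝ → Euc n} (hz : IsTrajectory f 0 t u z) (hf : FieldBounds f L k)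
    (ht : 0 ≤ t) {X₀ X₁ : ℝ}
    (h0 : IntervalIntegrable (fun r => u r 0) volume 0 t) (h0' : ∫ r in 0..t, u r 0 = X₀)
    (h1 : IntervalIntegrable (fun r => u r 1) volume 0 t) (h1' : ∫ r in 0..t, u r 1 = X₁) :
    ‖z t - z 0 - (X₀ • f 0 (z 0) + X₁ • f 1 (z 0))‖ ≤ 2 * L * k * t ^ 2 := by
  have hL := hf.L_pos
  have hk := hf.k_pos
  have h0m : (0 : ℝ) ∈ Icc 0 t := ⟨le_rfl, ht⟩
  have htm : t ∈ Icc 0 t := ⟨ht, le_rfl⟩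
  have i0 : IntervalIntegrable (fun r => u r 0 • f 0 (z 0)) volume 0 t :=
    ⟨Integrable.smul_const h0.1 _, Integrable.smul_const h0.2 _⟩
  have i1 : IntervalIntegrable (fun r => u r 1 • f 1 (z 0)) volume 0 t :=
    ⟨Integrable.smul_const h1.1 _, Integrable.smul_const h1.2 _⟩
  have hfrozen : ∫ r in 0..t, dynamics f (z 0) (u r) = X₀ • f 0 (z 0) + X₁ • f 1 (z 0) := by
    simp only [dynamics_eq]
    rw [intervalIntegral.integral_add i0 i1,
      intervalIntegral.integral_smul_const, intervalIntegral.integral_smul_const, h0', h1']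
  have hfi : IntervalIntegrable (fun r => dynamics f (z 0) (u r)) volume 0 t := by
    simp only [dynamics_eq]
    exact i0.add i1
  rw [← hfrozen, hz.sub_eq hf h0m htm,
    ← intervalIntegral.integral_sub (hz.intervalIntegrable hf h0m htm) hfi]
  have := intervalIntegral.norm_integral_le_of_norm_le_const_ae (a := 0) (b := t)
    (f := fun r => dynamics f (z r) (u r) - dynamics f (z 0) (u r)) (C := 2 * L * (k * t)) ?_
  · refine this.trans (le_of_eq ?_)
    rw [sub_zero, abs_of_nonneg ht]
    ring
  · have h2 := (ae_restrict_iff' measurableSet_Icc).1 hz.bound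
    filter_upwards [h2] with r hr hrt
    rw [uIoc_of_le ht] at hrt
    have hrm : r ∈ Icc 0 t := Ioc_subset_Icc_self hrt
    refine (hf.dynamics_sub_le _ _ (hr hrm)).trans ?_
    gcongr
    refine (hz.norm_sub_le hf h0m hrm).trans ?_
    rw [sub_zero, abs_of_nonneg hrm.1]
    gcongr
    exact hrm.2

/-- Algebra behind the loop: with `p = -q v` for a unit vector `v` and with velocity `(A', B')` at
position `(A, B)` in the frame `(v, J v)`, the second-order expansion of the rate of change of `h`
is the derivative of `-q A + ½ Λ(X, X)` plus the bracket times the areal velocity. -/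
theorem loop_rate_eq {v₀ v₁ q A B A' B' l₀₀ l₀₁ l₁₀ l₁₁ b : ℝ} (hv : v₀ ^ 2 + v₁ ^ 2 = 1)
    (hb : l₀₁ - l₁₀ = -b) :
    (A' * v₀ - B' * v₁) * (-(q * v₀) + (l₀₀ * (A * v₀ - B * v₁) + l₀₁ * (A * v₁ + B * v₀))) +
      (A' * v₁ + B' * v₀) * (-(q * v₁) + (l₁₀ * (A * v₀ - B * v₁) + l₁₁ * (A * v₁ + B * v₀))) =
    -(q * A') +
      1 / 2 * (l₀₀ * ((A' * v₀ - B' * v₁) * (A * v₀ - B * v₁) +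
          (A * v₀ - B * v₁) * (A' * v₀ - B' * v₁)) +
        (l₀₁ + l₁₀) * ((A' * v₀ - B' * v₁) * (A * v₁ + B * v₀) +
          (A * v₀ - B * v₁) * (A' * v₁ + B' * v₀)) +
        l₁₁ * ((A' * v₁ + B' * v₀) * (A * v₁ + B * v₀) +
          (A * v₁ + B * v₀) * (A' * v₁ + B' * v₀))) +
      b / 2 * (A * B' - B * A') := by
  linear_combination (-(q * A') + b / 2 * (A * B' - B * A')) * hv
    + (1 / 2) * ((A' * v₀ - B' * v₁) * (A * v₁ + B * v₀) -
      (A' * v₁ + B' * v₀) * (A * v₀ - B * v₁)) * hb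

theorem half_quadratic_le {l₀₀ l₀₁ l₁₀ l₁₁ M X Y : ℝ} (h00 : |l₀₀| ≤ M) (h01 : |l₀₁| ≤ M)
    (h10 : |l₁₀| ≤ M) (h11 : |l₁₁| ≤ M) :
    1 / 2 * (l₀₀ * (X * X) + (l₀₁ + l₁₀) * (X * Y) + l₁₁ * (Y * Y)) ≤ M * (X ^ 2 + Y ^ 2) := by
  have hs : |l₀₁ + l₁₀| ≤ 2 * M := (abs_add_le _ _).trans (by linarith)
  have h1 : (l₀₁ + l₁₀) * (X * Y) ≤ 2 * M * |X * Y| := by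
    refine (le_abs_self _).trans ?_
    rw [abs_mul]
    gcongr
  have h2 : 2 * |X * Y| ≤ X ^ 2 + Y ^ 2 := by
    rw [abs_mul]
    nlinarith [sq_nonneg (|X| - |Y|), sq_abs X, sq_abs Y]
  have hM : 0 ≤ M := (abs_nonneg _).trans h00
  nlinarith [abs_le.1 h00, abs_le.1 h11, sq_nonneg X, sq_nonneg Y, mul_le_mul_of_nonneg_left h2 hM]

theorem exists_unit_direction (p₀ p₁ : ℝ) : ∃ q v₀ v₁ : ℝ, 0 ≤ q ∧ v₀ ^ 2 + v₁ ^ 2 = 1 ∧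
    p₀ = -(q * v₀) ∧ p₁ = -(q * v₁) := by
  rcases eq_or_ne (p₀ ^ 2 + p₁ ^ 2) 0 with h | h
  · have h0 : p₀ = 0 := by nlinarith [sq_nonneg p₀, sq_nonneg p₁]
    have h1 : p₁ = 0 := by nlinarith [sq_nonneg p₀, sq_nonneg p₁]
    exact ⟨0, 1, 0, le_rfl, by norm_num, by simp [h0], by simp [h1]⟩
  · have hpos : 0 < p₀ ^ 2 + p₁ ^ 2 := lt_of_le_of_ne (by positivity) h.symm
    have hq : 0 < √(p₀ ^ 2 + p₁ ^ 2) := Real.sqrt_pos.2 hpos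
    refine ⟨√(p₀ ^ 2 + p₁ ^ 2), -p₀ / √(p₀ ^ 2 + p₁ ^ 2), -p₁ / √(p₀ ^ 2 + p₁ ^ 2), hq.le,
      ?_, by field_simp, by field_simp⟩
    rw [div_pow, div_pow, Real.sq_sqrt hpos.le]
    field_simp

set_option maxHeartbeats 1000000 in
/-- Where the bracket is transversal, a short logarithmic loop that swirls fast enough lowers `h` by
`t² / Ω²` up to each time `t ≤ s`, and moves the state by `O(s²)` only, since it is closed. The
swirl `ω` makes the area term dominate the symmetric second-order part, whatever its sign; the axis
of the loop is chosen so that the first-order term is never positive. -/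
theorem loop_descent {n : ℕ} {f : Fin 2 → Euc n → Euc n} {h : Euc n → ℝ} {L k : ℝ}
    (hf : FieldBounds f L k) (hf2 : ∀ i, ContDiff ℝ 2 (f i)) (hh : ContDiff ℝ 2 h) {R D c W Ω s : ℝ}
    {ρ : ℝ} (hc : 0 < c)
    (hD : ∀ i, ∀ x ∈ Metric.closedBall (0 : Euc n) R, ‖fderiv ℝ (lieDeriv f h i) x‖ ≤ D)
    (hW6 : 6 ≤ W) (hW : 8 * (4 * (D * k) + 3) ≤ c * W) (hΩ : Ω = 2 + W)
    (hT : ∀ i, ∀ x ∈ Metric.closedBall (0 : Euc n) R, ∀ y ∈ Metric.closedBall (0 : Euc n) R,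
      ‖y - x‖ ≤ ρ → |lieDeriv f h i y - lieDeriv f h i x - fderiv ℝ (lieDeriv f h i) x (y - x)| ≤
        1 / (2 * k * Ω ^ 2) * ‖y - x‖)
    (hs : 0 < s) (hsρ : k * s ≤ ρ) (hsD : D * (2 * L * k) * s ≤ 1 / (2 * Ω ^ 2))
    {x₀ : Euc n} (hx₀ : x₀ ∈ Metric.closedBall (0 : Euc n) R)
    (hb : c ≤ |fderiv ℝ h x₀ (VectorField.lieBracket ℝ (f 0) (f 1) x₀)|) :
    ∃ V : ℝ → Euc 2, Measurable V ∧ (∀ t, ‖V t‖ ≤ 1) ∧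
      ∀ t₁ z, t₁ ≤ s → IsTrajectory f 0 t₁ V z → z 0 = x₀ →
        (∀ t ∈ Icc 0 t₁, z t ∈ Metric.closedBall (0 : Euc n) R) →
        (∀ t ∈ Icc 0 t₁, h (z t) - h x₀ ≤ -(t ^ 2 / Ω ^ 2)) ∧
          (t₁ = s → ‖z s - x₀‖ ≤ 2 * L * k * s ^ 2) := by
  have hk := hf.k_pos
  have hL := hf.L_pos
  have hΩ0 : 0 < Ω := by linarith
  have hDn : 0 ≤ D := (norm_nonneg _).trans (hD 0 x₀ hx₀)
  set b := fderiv ℝ h x₀ (VectorField.lieBracket ℝ (f 0) (f 1) x₀) with hbdef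
  -- the loop runs in the direction in which the bracket decreases `h`
  obtain ⟨ω, hωabs, hbω⟩ : ∃ ω : ℝ, |ω| = W ∧ b * ω = -(|b| * W) := by
    rcases le_total 0 b with hb0 | hb0
    · exact ⟨-W, by rw [abs_neg, abs_of_nonneg (by linarith)], by rw [abs_of_nonneg hb0]; ring⟩
    · exact ⟨W, abs_of_nonneg (by linarith), by rw [abs_of_nonpos hb0]; ring⟩
  obtain ⟨q, v₀, v₁, hq, hv, hp₀, hp₁⟩ :=
    exists_unit_direction (lieDeriv f h 0 x₀) (lieDeriv f h 1 x₀)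
  set A := loopFst ω Ω s
  set B := loopSnd ω Ω s
  set A' := loopFstVel ω Ω s
  set B' := loopSndVel ω Ω s
  have hA'm : Measurable A' := measurable_loopFstVel
  have hB'm : Measurable B' := measurable_loopSndVel
  have hspeed : ∀ t, A' t ^ 2 + B' t ^ 2 ≤ 1 := fun t => loopVel_sq_le (by rw [hΩ, hωabs])
  have hAd : ∀ r, 0 < r → HasDerivAt A (A' r) r := fun r hr => hasDerivAt_loopFst hs hr
  have hBd : ∀ r, 0 < r → HasDerivAt B (B' r) r := fun r hr => hasDerivAt_loopSnd hs hr
  have hAc : Continuous A := continuous_loopFst hs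
  have hBc : Continuous B := continuous_loopSnd hs
  set X : ℝ → ℝ := fun t => A t * v₀ - B t * v₁ with hX
  set Y : ℝ → ℝ := fun t => A t * v₁ + B t * v₀ with hY
  set X' : ℝ → ℝ := fun t => A' t * v₀ - B' t * v₁ with hX'
  set Y' : ℝ → ℝ := fun t => A' t * v₁ + B' t * v₀ with hY'
  have hXd : ∀ r, 0 < r → HasDerivAt X (X' r) r := fun r hr =>
    ((hAd r hr).mul_const v₀).sub ((hBd r hr).mul_const v₁)
  have hYd : ∀ r, 0 < r → HasDerivAt Y (Y' r) r := fun r hr =>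
    ((hAd r hr).mul_const v₁).add ((hBd r hr).mul_const v₀)
  have hXc : Continuous X := by fun_prop
  have hYc : Continuous Y := by fun_prop
  have hX'm : Measurable X' := by fun_prop
  have hY'm : Measurable Y' := by fun_prop
  have hXY' : ∀ t, X' t ^ 2 + Y' t ^ 2 ≤ 1 := fun t => by
    have : X' t ^ 2 + Y' t ^ 2 = A' t ^ 2 + B' t ^ 2 := by
      simp only [hX', hY']
      linear_combination (A' t ^ 2 + B' t ^ 2) * hv
    rw [this]; exact hspeed t
  have hX'1 : ∀ t, |X' t| ≤ 1 := fun t => by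
    rw [← sq_le_one_iff_abs_le_one]; nlinarith [hXY' t, sq_nonneg (Y' t)]
  have hY'1 : ∀ t, |Y' t| ≤ 1 := fun t => by
    rw [← sq_le_one_iff_abs_le_one]; nlinarith [hXY' t, sq_nonneg (X' t)]
  have hX0 : X 0 = 0 := by simp [hX, A, B, loopFst_zero, loopSnd_zero]
  have hY0 : Y 0 = 0 := by simp [hY, A, B, loopFst_zero, loopSnd_zero]
  set V : ℝ → Euc 2 := fun t => !₂[X' t, Y' t] with hV
  have hV0 : ∀ t, V t 0 = X' t := fun t => rfl
  have hV1 : ∀ t, V t 1 = Y' t := fun t => rfl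
  have hVn : ∀ t, ‖V t‖ ≤ 1 := fun t => by
    have : ‖V t‖ ^ 2 ≤ 1 := by
      rw [EuclideanSpace.norm_sq_eq]
      simp only [Fin.sum_univ_two, Real.norm_eq_abs, sq_abs]
      exact hXY' t
    nlinarith [norm_nonneg (V t)]
  have hVm : Measurable V := by
    have : Measurable fun t => (![X' t, Y' t] : Fin 2 → ℝ) := by
      refine measurable_pi_lambda _ fun i => ?_
      fin_cases i
      · exact hX'm
      · exact hY'm
    exact (PiLp.continuous_toLp 2 _).measurable.comp this
  -- the second-order coefficients `Λ_{lm}` of `h` at `x₀`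
  set l₀₀ := fderiv ℝ (lieDeriv f h 0) x₀ (f 0 x₀) with hl00
  set l₀₁ := fderiv ℝ (lieDeriv f h 0) x₀ (f 1 x₀) with hl01
  set l₁₀ := fderiv ℝ (lieDeriv f h 1) x₀ (f 0 x₀) with hl10
  set l₁₁ := fderiv ℝ (lieDeriv f h 1) x₀ (f 1 x₀) with hl11
  have hlb : l₀₁ - l₁₀ = -b := fderiv_lieDeriv_sub hf2 hh x₀
  have hfk : ∀ i, ‖f i x₀‖ ≤ k := fun i => by
    have := hf.bdd x₀
    fin_cases i
    · exact (le_add_of_nonneg_right (norm_nonneg _)).trans this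
    · exact (le_add_of_nonneg_left (norm_nonneg _)).trans this
  have hlM : ∀ i j, |fderiv ℝ (lieDeriv f h i) x₀ (f j x₀)| ≤ D * k := fun i j =>
    ((fderiv ℝ (lieDeriv f h i) x₀).le_opNorm _).trans (mul_le_mul (hD i x₀ hx₀) (hfk j)
      (norm_nonneg _) hDn)
  -- the second-order model `Q` of `h (z t) - h x₀`
  set Q : ℝ → ℝ := fun t => -(q * A t) +
    1 / 2 * (l₀₀ * (X t * X t) + (l₀₁ + l₁₀) * (X t * Y t) + l₁₁ * (Y t * Y t)) +
    b / 2 * (ω / Ω ^ 2) * loopArea ω s t with hQ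
  set Q' : ℝ → ℝ := fun t =>
    X' t * (lieDeriv f h 0 x₀ + (l₀₀ * X t + l₀₁ * Y t)) +
      Y' t * (lieDeriv f h 1 x₀ + (l₁₀ * X t + l₁₁ * Y t)) with hQ'
  have hQd : ∀ r, 0 < r → HasDerivAt Q (Q' r) r := by
    intro r hr
    have h1 := (((hAd r hr).const_mul q).neg.add (((((hXd r hr).mul (hXd r hr)).const_mul l₀₀).add
      (((hXd r hr).mul (hYd r hr)).const_mul (l₀₁ + l₁₀))).add
      (((hYd r hr).mul (hYd r hr)).const_mul l₁₁) |>.const_mul (1 / 2))).add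
      ((hasDerivAt_loopArea (ω := ω) hs hr).const_mul (b / 2 * (ω / Ω ^ 2)))
    refine h1.congr_deriv ?_
    simp only [hQ', hp₀, hp₁]
    have h2 := loop_rate_eq (q := q) (A := A r) (B := B r) (A' := A' r) (B' := B' r)
      (l₀₀ := l₀₀) (l₁₁ := l₁₁) hv hlb
    have h3 : A r * B' r - B r * A' r = ω / Ω ^ 2 * (r * (1 - Real.cos (loopAngle ω s r))) :=
      loop_wronskian hΩ0.ne'
    rw [h3] at h2
    simp only [hX, hY, hX', hY']
    rw [h2]
    ring
  have hQc : Continuous Q := by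
    have := continuous_loopArea (ω := ω) hs
    fun_prop
  have hQ0 : Q 0 = 0 := by
    simp [hQ, hX0, hY0, loopArea_zero, A, loopFst_zero]
  have hQle : ∀ t, 0 ≤ t → Q t ≤ -(3 * t ^ 2 / Ω ^ 2) := by
    intro t ht
    have h1 : 0 ≤ q * A t := mul_nonneg hq (loopFst_nonneg hΩ0 ht)
    have h2 := half_quadratic_le (X := X t) (Y := Y t) (hlM 0 0) (hlM 0 1) (hlM 1 0) (hlM 1 1)
    have h3 : X t ^ 2 + Y t ^ 2 ≤ 4 * t ^ 2 / Ω ^ 2 := by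
      have : X t ^ 2 + Y t ^ 2 = A t ^ 2 + B t ^ 2 := by
        simp only [hX, hY]
        linear_combination (A t ^ 2 + B t ^ 2) * hv
      rw [this]; exact loop_sq_le hΩ0
    have h4 : b / 2 * (ω / Ω ^ 2) * loopArea ω s t ≤ -(c * W / (2 * Ω ^ 2)) * (t ^ 2 / 4) := by
      have e : b / 2 * (ω / Ω ^ 2) = -(|b| * W / (2 * Ω ^ 2)) := by
        rw [← neg_eq_iff_eq_neg.2 hbω]; field_simp
      rw [e]
      have h5 := loopArea_ge (ω := ω) (s := s) (t := t) (by rw [hωabs]; exact hW6)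
      have h6 : c * W / (2 * Ω ^ 2) ≤ |b| * W / (2 * Ω ^ 2) := by gcongr
      have h7 : 0 ≤ c * W / (2 * Ω ^ 2) := by positivity
      have h8 : c * W / (2 * Ω ^ 2) * (t ^ 2 / 4) ≤ |b| * W / (2 * Ω ^ 2) * loopArea ω s t :=
        mul_le_mul h6 h5 (by positivity) (h7.trans h6)
      linarith
    have h5 : D * k * (X t ^ 2 + Y t ^ 2) ≤ D * k * (4 * t ^ 2 / Ω ^ 2) := by gcongr
    have h6 : D * k * (4 * t ^ 2 / Ω ^ 2) + -(c * W / (2 * Ω ^ 2)) * (t ^ 2 / 4) ≤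
        -(3 * t ^ 2 / Ω ^ 2) := by
      have e : D * k * (4 * t ^ 2 / Ω ^ 2) + -(c * W / (2 * Ω ^ 2)) * (t ^ 2 / 4) =
          (4 * (D * k) - c * W / 8) * (t ^ 2 / Ω ^ 2) := by
        field_simp
        ring
      have e2 : -(3 * t ^ 2 / Ω ^ 2) = (-3) * (t ^ 2 / Ω ^ 2) := by ring
      rw [e, e2]
      gcongr
      linarith
    simp only [hQ]
    linarith
  refine ⟨V, hVm, hVn, fun t₁ z ht₁ hz hz0 hzB => ?_⟩
  -- the primitives of the control
  have hXi : ∀ t, 0 ≤ t → IntervalIntegrable (fun r => V r 0) volume 0 t ∧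
      ∫ r in 0..t, V r 0 = X t := fun t ht =>
    integral_eq_of_hasDerivAt_of_bounded ht hXc hXd hX'm (fun r _ => hX'1 r) hX0
  have hYi : ∀ t, 0 ≤ t → IntervalIntegrable (fun r => V r 1) volume 0 t ∧
      ∫ r in 0..t, V r 1 = Y t := fun t ht =>
    integral_eq_of_hasDerivAt_of_bounded ht hYc hYd hY'm (fun r _ => hY'1 r) hY0
  have hdisp : ∀ r ∈ Icc 0 t₁, ‖z r - x₀ - (X r • f 0 x₀ + Y r • f 1 x₀)‖ ≤
      2 * L * k * r ^ 2 := fun r hr => by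
    have := (hz.restrict hf le_rfl hr.2).norm_sub_frozen_le hf hr.1 (hXi r hr.1).1 (hXi r hr.1).2
      (hYi r hr.1).1 (hYi r hr.1).2
    rwa [hz0] at this
  refine ⟨fun t ht => ?_, fun heq => ?_⟩
  swap
  · have := hdisp s ⟨hs.le, heq.ge⟩
    have hXs : X s = 0 := by simp [hX, A, B, loopFst_end hs.ne', loopSnd_end hs.ne']
    have hYs : Y s = 0 := by simp [hY, A, B, loopFst_end hs.ne', loopSnd_end hs.ne']
    simpa [hXs, hYs] using this
  have h0m : (0 : ℝ) ∈ Icc 0 t₁ := ⟨le_rfl, ht.1.trans ht.2⟩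
  have herr : ∀ i : Fin 2, ∀ r ∈ Icc 0 t, |lieDeriv f h i (z r) - (lieDeriv f h i x₀ +
      (fderiv ℝ (lieDeriv f h i) x₀ (f 0 x₀) * X r +
        fderiv ℝ (lieDeriv f h i) x₀ (f 1 x₀) * Y r))| ≤ t / Ω ^ 2 := by
    intro i r hr
    have hrm : r ∈ Icc 0 t₁ := ⟨hr.1, hr.2.trans ht.2⟩
    have hrs : r ≤ s := hrm.2.trans ht₁
    have hzr : ‖z r - x₀‖ ≤ k * r := by
      have := hz.norm_sub_le hf h0m hrm
      rwa [hz0, sub_zero, abs_of_nonneg hr.1] at this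
    have e1 := hT i x₀ hx₀ (z r) (hzB r hrm) (hzr.trans (by nlinarith))
    have e2 : |fderiv ℝ (lieDeriv f h i) x₀ (z r - x₀ - (X r • f 0 x₀ + Y r • f 1 x₀))| ≤
        D * (2 * L * k * r ^ 2) :=
      ((fderiv ℝ (lieDeriv f h i) x₀).le_opNorm _).trans (mul_le_mul (hD i x₀ hx₀) (hdisp r hrm)
        (norm_nonneg _) hDn)
    have e3 : lieDeriv f h i (z r) - (lieDeriv f h i x₀ +
        (fderiv ℝ (lieDeriv f h i) x₀ (f 0 x₀) * X r +
          fderiv ℝ (lieDeriv f h i) x₀ (f 1 x₀) * Y r)) =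
        (lieDeriv f h i (z r) - lieDeriv f h i x₀ - fderiv ℝ (lieDeriv f h i) x₀ (z r - x₀)) +
        fderiv ℝ (lieDeriv f h i) x₀ (z r - x₀ - (X r • f 0 x₀ + Y r • f 1 x₀)) := by
      rw [map_sub _ (z r - x₀), map_add, map_smul, map_smul, smul_eq_mul, smul_eq_mul]
      ring
    rw [e3]
    refine (abs_add_le _ _).trans ((add_le_add e1 e2).trans ?_)
    calc 1 / (2 * k * Ω ^ 2) * ‖z r - x₀‖ + D * (2 * L * k * r ^ 2)
        ≤ 1 / (2 * k * Ω ^ 2) * (k * r) + (D * (2 * L * k) * s) * r := by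
          gcongr ?_ + ?_
          · gcongr
          · have : D * (2 * L * k * r ^ 2) = (D * (2 * L * k) * r) * r := by ring
            rw [this]
            have hr0 := hr.1
            gcongr
      _ ≤ 1 / (2 * k * Ω ^ 2) * (k * r) + 1 / (2 * Ω ^ 2) * r := by
          have hr0 := hr.1
          gcongr
      _ = r / Ω ^ 2 := by field_simp; ring
      _ ≤ t / Ω ^ 2 := by gcongr; exact hr.2
  have hcomp := hz.comp_sub_eq hf (hh.of_le (by norm_num)) h0m ht
  rw [hz0] at hcomp
  obtain ⟨hQi, hQint⟩ : IntervalIntegrable Q' volume 0 t ∧ ∫ r in 0..t, Q' r = Q t := by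
    have hQ'm : Measurable Q' := by
      have := hXc.measurable
      have := hYc.measurable
      fun_prop
    obtain ⟨MX, hMX⟩ := (isCompact_Icc (a := (0 : ℝ)) (b := t)).exists_bound_of_continuousOn
      (f := fun t => lieDeriv f h 0 x₀ + (l₀₀ * X t + l₀₁ * Y t)) (by fun_prop)
    obtain ⟨MY, hMY⟩ := (isCompact_Icc (a := (0 : ℝ)) (b := t)).exists_bound_of_continuousOn
      (f := fun t => lieDeriv f h 1 x₀ + (l₁₀ * X t + l₁₁ * Y t)) (by fun_prop)
    refine integral_eq_of_hasDerivAt_of_bounded (M := 1 * MX + 1 * MY) ht.1 hQc hQd hQ'm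
      (fun r hr => ?_) hQ0
    refine (abs_add_le _ _).trans (add_le_add ?_ ?_)
    · rw [abs_mul]
      exact mul_le_mul (hX'1 r) (hMX r hr) (abs_nonneg _) zero_le_one
    · rw [abs_mul]
      exact mul_le_mul (hY'1 r) (hMY r hr) (abs_nonneg _) zero_le_one
  have hphi : IntervalIntegrable (fun r => fderiv ℝ h (z r) (dynamics f (z r) (V r)))
      volume 0 t := by
    have h1 := hz.intervalIntegrable hf h0m ht
    have h2 : ContinuousOn (fun r => fderiv ℝ h (z r)) (Icc 0 t) :=
      (hh.continuous_fderiv (by norm_num)).comp_continuousOn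
        (hz.cont.mono (Icc_subset_Icc_right ht.2))
    rw [intervalIntegrable_iff_integrableOn_Icc_of_le ht.1] at h1 ⊢
    obtain ⟨M, hM⟩ := isCompact_Icc.exists_bound_of_continuousOn h2
    refine Integrable.of_bound (C := M * k) ?_ ?_
    · exact ((ContinuousLinearMap.id ℝ (Euc n →L[ℝ] ℝ)).aestronglyMeasurable_comp₂
        (h2.aestronglyMeasurable measurableSet_Icc) h1.aestronglyMeasurable)
    · filter_upwards [ae_restrict_mem measurableSet_Icc] with r hr
      exact ((fderiv ℝ h (z r)).le_opNorm _).trans (mul_le_mul (hM r hr)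
        (hf.dynamics_norm_le _ (hVn r)) (norm_nonneg _) ((norm_nonneg _).trans (hM r hr)))
  have hdiff : ∫ r in 0..t, (fderiv ℝ h (z r) (dynamics f (z r) (V r)) - Q' r) ≤
      ∫ r in 0..t, t / Ω ^ 2 + t / Ω ^ 2 := by
    refine intervalIntegral.integral_mono_on ht.1 (hphi.sub hQi) intervalIntegrable_const
      fun r hr => ?_
    rw [fderiv_dynamics, hV0, hV1]
    have e0 := herr 0 r hr
    have e1 := herr 1 r hr
    have g0 : X' r * (lieDeriv f h 0 (z r) - (lieDeriv f h 0 x₀ + (l₀₀ * X r + l₀₁ * Y r))) ≤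
        t / Ω ^ 2 := by
      refine (le_abs_self _).trans ?_
      rw [abs_mul, ← one_mul (t / Ω ^ 2)]
      exact mul_le_mul (hX'1 r) e0 (abs_nonneg _) zero_le_one
    have g1 : Y' r * (lieDeriv f h 1 (z r) - (lieDeriv f h 1 x₀ + (l₁₀ * X r + l₁₁ * Y r))) ≤
        t / Ω ^ 2 := by
      refine (le_abs_self _).trans ?_
      rw [abs_mul, ← one_mul (t / Ω ^ 2)]
      exact mul_le_mul (hY'1 r) e1 (abs_nonneg _) zero_le_one
    simp only [hQ']
    linarith
  rw [intervalIntegral.integral_sub hphi hQi, hQint, ← hcomp, intervalIntegral.integral_const,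
    sub_zero, smul_eq_mul] at hdiff
  have := hQle t ht.1
  have e : t * (t / Ω ^ 2 + t / Ω ^ 2) = 2 * t ^ 2 / Ω ^ 2 := by ring
  have e2 : (3 * t ^ 2 / Ω ^ 2) = 2 * t ^ 2 / Ω ^ 2 + t ^ 2 / Ω ^ 2 := by ring
  linarith

theorem exists_descent_of_bracket {n : ℕ} {f : Fin 2 → Euc n → Euc n} {h : Euc n → ℝ} {L k : ℝ}
    (hf : FieldBounds f L k) (hf2 : ∀ i, ContDiff ℝ 2 (f i)) (hh : ContDiff ℝ 2 h) (R : ℝ) {c : ℝ}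
    (hc : 0 < c) : ∃ κ > 0, ∃ C > 0, ∃ m₀ > 0, ∀ x₀ ∈ Metric.closedBall (0 : Euc n) R,
      c ≤ |fderiv ℝ h x₀ (VectorField.lieBracket ℝ (f 0) (f 1) x₀)| → ∀ m ∈ Ioc 0 m₀,
        ∃ U, IsDescentControl f h (Metric.closedBall 0 R) x₀ (κ * √m) m C U := by
  have hk := hf.k_pos
  have hL := hf.L_pos
  obtain ⟨D₀, hD₀, hb₀⟩ := exists_fderiv_bound (contDiff_lieDeriv hf2 hh 0) R
  obtain ⟨D₁, hD₁, hb₁⟩ := exists_fderiv_bound (contDiff_lieDeriv hf2 hh 1) R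
  set D := D₀ + D₁
  have hD : ∀ i, ∀ x ∈ Metric.closedBall (0 : Euc n) R, ‖fderiv ℝ (lieDeriv f h i) x‖ ≤ D := by
    intro i x hx
    fin_cases i
    · exact (hb₀ x hx).trans (le_add_of_nonneg_right hD₁.le)
    · exact (hb₁ x hx).trans (le_add_of_nonneg_left hD₀.le)
  have hDpos : 0 < D := by positivity
  obtain ⟨W, hW6, hW⟩ : ∃ W : ℝ, 6 ≤ W ∧ 8 * (4 * (D * k) + 3) ≤ c * W := by
    refine ⟨max 6 (8 * (4 * (D * k) + 3) / c), le_max_left _ _, ?_⟩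
    rw [← div_le_iff₀' hc]
    exact le_max_right _ _
  obtain ⟨Ω, hΩ⟩ : ∃ Ω, Ω = 2 + W := ⟨_, rfl⟩
  have hΩ0 : 0 < Ω := by linarith
  have hε : 0 < 1 / (2 * k * Ω ^ 2) := by positivity
  obtain ⟨ρ₀, hρ₀, hT₀⟩ := uniform_taylor (contDiff_lieDeriv hf2 hh 0) R hε
  obtain ⟨ρ₁, hρ₁, hT₁⟩ := uniform_taylor (contDiff_lieDeriv hf2 hh 1) R hε
  set ρ := min ρ₀ ρ₁
  have hρ : 0 < ρ := lt_min hρ₀ hρ₁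
  -- the longest duration of the loop for which the expansion is accurate enough
  set s₀ := min (ρ / k) (1 / (2 * Ω ^ 2) / (D * (2 * L * k)))
  have hs₀ : 0 < s₀ := by positivity
  refine ⟨Ω, hΩ0, 2 * L * k * Ω ^ 2, by positivity, (s₀ / Ω) ^ 2, by positivity,
    fun x₀ hx₀ hb m hm => ?_⟩
  have hm0 := hm.1
  have hsm : Ω * √m ≤ s₀ := by
    have : √m ≤ s₀ / Ω := by
      rw [← Real.sqrt_sq (show 0 ≤ s₀ / Ω by positivity)]
      exact Real.sqrt_le_sqrt hm.2
    rwa [le_div_iff₀' hΩ0] at this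
  have hs : 0 < Ω * √m := mul_pos hΩ0 (Real.sqrt_pos.2 hm0)
  have hs2 : (Ω * √m) ^ 2 = Ω ^ 2 * m := by rw [mul_pow, Real.sq_sqrt hm0.le]
  obtain ⟨V, hVm, hV1, H⟩ := loop_descent (s := Ω * √m) (ρ := ρ) hf hf2 hh hc hD hW6 hW hΩ
    (by
      intro i x hx y hy hxy
      fin_cases i
      · exact hT₀ x hx y hy (hxy.trans (min_le_left _ _))
      · exact hT₁ x hx y hy (hxy.trans (min_le_right _ _)))
    hs
    (by rw [← le_div_iff₀' hk]; exact hsm.trans (min_le_left _ _))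
    (by rw [← le_div_iff₀' (by positivity)]; exact hsm.trans (min_le_right _ _)) hx₀ hb
  refine ⟨_, isDescentControl_of_le hf hs hVm hV1 (fun t₁ z ht₁ hz hz0 hzB => ?_) hm0⟩
  obtain ⟨h1, h2⟩ := H t₁ z ht₁ hz hz0 hzB
  refine ⟨fun t ht => ?_, fun heq => ⟨?_, ?_⟩⟩
  · have := h1 t ⟨ht.1.le, ht.2⟩
    have ht0 := ht.1
    have : 0 < t ^ 2 / Ω ^ 2 := by positivity
    linarith
  · have := h1 (Ω * √m) ⟨hs.le, heq.ge⟩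
    rw [hs2, mul_div_cancel_left₀ m (by positivity)] at this
    linarith
  · have := h2 heq
    rw [hs2] at this
    linarith

/-- On a bounded part of `{h ≤ 0}` either a derivative of `h` along the fields or the derivative
along their bracket is bounded away from zero, by compactness. -/
theorem exists_transversality_constant {n : ℕ} {f : Fin 2 → Euc n → Euc n} {h : Euc n → ℝ}
    (hf2 : ∀ i, ContDiff ℝ 2 (f i)) (hh : ContDiff ℝ 2 h) (H4 : HypH4 f h) (R : ℝ) :
    ∃ c > 0, ∀ x ∈ Metric.closedBall (0 : Euc n) R, h x ≤ 0 →
      c ≤ √(lieDeriv f h 0 x ^ 2 + lieDeriv f h 1 x ^ 2) ∨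
        c ≤ |fderiv ℝ h x (VectorField.lieBracket ℝ (f 0) (f 1) x)| := by
  have hK : IsCompact (Metric.closedBall (0 : Euc n) R ∩ {x | h x ≤ 0}) :=
    (isCompact_closedBall _ _).inter_right (isClosed_le hh.continuous continuous_const)
  have hc0 := (contDiff_lieDeriv hf2 hh 0).continuous
  have hc1 := (contDiff_lieDeriv hf2 hh 1).continuous
  have hbr : Continuous fun x => VectorField.lieBracket ℝ (f 0) (f 1) x := by
    have d0 : Continuous (fderiv ℝ (f 0)) := (hf2 0).continuous_fderiv (by norm_num)
    have d1 : Continuous (fderiv ℝ (f 1)) := (hf2 1).continuous_fderiv (by norm_num)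
    have e0 := (hf2 0).continuous
    have e1 := (hf2 1).continuous
    simp only [VectorField.lieBracket]
    fun_prop
  have hdh : Continuous (fderiv ℝ h) := hh.continuous_fderiv (by norm_num)
  have hg : Continuous fun x => max (√(lieDeriv f h 0 x ^ 2 + lieDeriv f h 1 x ^ 2))
      |fderiv ℝ h x (VectorField.lieBracket ℝ (f 0) (f 1) x)| := by fun_prop
  rcases (Metric.closedBall (0 : Euc n) R ∩ {x | h x ≤ 0}).eq_empty_or_nonempty with he | hne
  · refine ⟨1, one_pos, fun x hx hx0 => ?_⟩
    have : x ∈ (∅ : Set (Euc n)) := he ▸ ⟨hx, hx0⟩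
    exact this.elim
  obtain ⟨x₀, hx₀, hmin⟩ := hK.exists_isMinOn hne hg.continuousOn
  refine ⟨_, ?_, fun x hx hx0 => le_max_iff.1 (hmin ⟨hx, hx0⟩)⟩
  obtain ⟨α, hα, H⟩ := H4
  by_contra hle
  rw [not_lt, max_le_iff] at hle
  have hsq : lieDeriv f h 0 x₀ ^ 2 + lieDeriv f h 1 x₀ ^ 2 ≤ 0 := Real.sqrt_eq_zero'.1
    (le_antisymm hle.1 (Real.sqrt_nonneg _))
  have h0 : lieDeriv f h 0 x₀ = 0 := by
    nlinarith [sq_nonneg (lieDeriv f h 0 x₀), sq_nonneg (lieDeriv f h 1 x₀)]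
  have h1 : lieDeriv f h 1 x₀ = 0 := by
    nlinarith [sq_nonneg (lieDeriv f h 0 x₀), sq_nonneg (lieDeriv f h 1 x₀)]
  have := H x₀ ⟨hx₀.2, fun i => by fin_cases i <;> assumption⟩
  linarith

/-- Descent controls exist at every point of a bounded part of `{h ≤ 0}`, with uniform constants:
`h` can be lowered by `m` in time `κ √m` with a net displacement of at most `C m`. -/
theorem exists_descent {n : ℕ} {f : Fin 2 → Euc n → Euc n} {h : Euc n → ℝ} {L k : ℝ}
    (hf : FieldBounds f L k) (hf2 : ∀ i, ContDiff ℝ 2 (f i)) (hh : ContDiff ℝ 2 h)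
    (H4 : HypH4 f h) (R : ℝ) :
    ∃ κ > 0, ∃ C > 0, ∃ m₀ > 0, ∀ x₀ ∈ Metric.closedBall (0 : Euc n) R, h x₀ ≤ 0 →
      ∀ m ∈ Ioc 0 m₀, ∃ U, IsDescentControl f h (Metric.closedBall 0 R) x₀ (κ * √m) m C U := by
  obtain ⟨c, hc, H⟩ := exists_transversality_constant hf2 hh H4 R
  obtain ⟨κ₁, hκ₁, C₁, hC₁, m₁, hm₁, H₁⟩ := exists_descent_of_lieDeriv hf hf2 hh R hc
  obtain ⟨κ₂, hκ₂, C₂, hC₂, m₂, hm₂, H₂⟩ := exists_descent_of_bracket hf hf2 hh R hc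
  refine ⟨max κ₁ κ₂, by positivity, max C₁ C₂, by positivity, min m₁ m₂, by positivity,
    fun x₀ hx₀ hx₀h m hm => ?_⟩
  rcases H x₀ hx₀ hx₀h with hc' | hc'
  · obtain ⟨U, hU⟩ := H₁ x₀ hx₀ hc' m ⟨hm.1, hm.2.trans (min_le_left _ _)⟩
    exact ⟨U, hU.mono (mul_le_mul_of_nonneg_right (le_max_left _ _) (Real.sqrt_nonneg _)) hm.1.le
      (le_max_left _ _)⟩
  · obtain ⟨U, hU⟩ := H₂ x₀ hx₀ hc' m ⟨hm.1, hm.2.trans (min_le_right _ _)⟩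
    exact ⟨U, hU.mono (mul_le_mul_of_nonneg_right (le_max_right _ _) (Real.sqrt_nonneg _)) hm.1.le
      (le_max_right _ _)⟩

/-! ### One correction step -/

theorem IsTrajectory.shift_to_zero {n : ℕ} {f : Fin 2 → Euc n → Euc n} {a b : ℝ} {u : ℝ → Euc 2}
    {x : ℝ → Euc n} (h : IsTrajectory f a b u x) :
    IsTrajectory f 0 (b - a) (fun t => u (t + a)) (fun t => x (t + a)) := by
  have := h.shift (-a)
  simpa [sub_eq_add_neg] using this

theorem IsTrajectory.mem_closedBall {n : ℕ} {f : Fin 2 → Euc n → Euc n} {L k T R : ℝ}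
    {u : ℝ → Euc 2} {x : ℝ → Euc n} (h : IsTrajectory f 0 T u x) (hf : FieldBounds f L k)
    (hR : ‖x 0‖ + k * T ≤ R) {t : ℝ} (ht : t ∈ Icc 0 T) :
    x t ∈ Metric.closedBall (0 : Euc n) R := by
  rw [mem_closedBall_zero_iff]
  have h1 := h.norm_sub_le hf ⟨le_rfl, ht.1.trans ht.2⟩ ht
  rw [sub_zero, abs_of_nonneg ht.1] at h1
  have h2 : k * t ≤ k * T := mul_le_mul_of_nonneg_left ht.2 hf.k_pos.le
  have h3 := norm_add_le (x 0) (x t - x 0)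
  rw [add_sub_cancel] at h3
  linarith

/-- The control that follows `u` until `t₀`, applies `U` from `t₀` to `t₀ + τ`, and then follows
`u` with delay `τ`. -/
noncomputable def splicedControl (u U : ℝ → Euc 2) (t₀ τ : ℝ) : ℝ → Euc 2 := fun t =>
  if t < t₀ then u t else if t ≤ t₀ + τ then U (t - t₀) else u (t - τ)

theorem splicedControl_admissible {u U : ℝ → Euc 2} {T : ℝ} (t₀ τ : ℝ)
    (hu : AEStronglyMeasurable u (volume.restrict (Icc 0 T)))
    (hb : ∀ᵐ t ∂(volume.restrict (Icc 0 T)), ‖u t‖ ≤ 1) (hU : Measurable U)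
    (hU1 : ∀ t, ‖U t‖ ≤ 1) (ht₀ : 0 ≤ t₀) (hτ : 0 ≤ τ) :
    AEStronglyMeasurable (splicedControl u U t₀ τ) (volume.restrict (Icc 0 T)) ∧
      ∀ᵐ t ∂(volume.restrict (Icc 0 T)), ‖splicedControl u U t₀ τ t‖ ≤ 1 := by
  set v : ℝ → Euc 2 := (Icc 0 T).indicator u with hv
  have hvm : AEStronglyMeasurable v volume :=
    (aestronglyMeasurable_indicator_iff measurableSet_Icc).2 hu
  have hvb : ∀ᵐ t, ‖v t‖ ≤ 1 := by
    filter_upwards [(ae_restrict_iff' measurableSet_Icc).1 hb] with t ht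
    by_cases hm : t ∈ Icc 0 T
    · rw [hv, indicator_of_mem hm]; exact ht hm
    · rw [hv, indicator_of_notMem hm]; simp
  have hmp := measurePreserving_sub_right (volume : Measure ℝ) τ
  have hvm' : AEStronglyMeasurable (fun t => v (t - τ)) volume := hvm.comp_measurePreserving hmp
  have hvb' : ∀ᵐ t, ‖v (t - τ)‖ ≤ 1 := hmp.quasiMeasurePreserving.ae hvb
  have hUm : AEStronglyMeasurable (fun t => U (t - t₀)) volume :=
    (hU.comp (measurable_sub_const t₀)).aestronglyMeasurable
  have hEq : EqOn (splicedControl u U t₀ τ) (splicedControl v U t₀ τ) (Icc 0 T) := by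
    intro t ht
    simp only [splicedControl]
    split_ifs with h1 h2
    · rw [hv, indicator_of_mem ht]
    · rfl
    · have hmem : t - τ ∈ Icc 0 T := ⟨by linarith, by linarith [ht.2]⟩
      rw [hv, indicator_of_mem hmem]
  have hm : AEStronglyMeasurable (splicedControl v U t₀ τ) volume := by
    have h1 : AEStronglyMeasurable ((Iic (t₀ + τ)).piecewise (fun t => U (t - t₀))
        (fun t => v (t - τ))) volume :=
      AEStronglyMeasurable.piecewise measurableSet_Iic hUm.restrict hvm'.restrict
    have h2 : AEStronglyMeasurable ((Iio t₀).piecewise v ((Iic (t₀ + τ)).piecewise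
        (fun t => U (t - t₀)) (fun t => v (t - τ)))) volume :=
      AEStronglyMeasurable.piecewise measurableSet_Iio hvm.restrict h1.restrict
    exact h2
  have hbd : ∀ᵐ t, ‖splicedControl v U t₀ τ t‖ ≤ 1 := by
    filter_upwards [hvb, hvb'] with t h1 h2
    simp only [splicedControl]
    split_ifs
    · exact h1
    · exact hU1 _
    · exact h2
  refine ⟨hm.restrict.congr ?_, ?_⟩
  · filter_upwards [ae_restrict_mem measurableSet_Icc] with t ht using (hEq ht).symm
  · filter_upwards [ae_restrict_mem measurableSet_Icc, ae_restrict_of_ae hbd] with t ht h1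
    rw [hEq ht]; exact h1

/-- If `h` on one trajectory starts `m` below `h` on another trajectory of the same control, and
the two stay `δ`-close, the advantage decreases at most at a rate proportional to `δ`. -/
theorem comp_sub_le_of_close {n : ℕ} {f : Fin 2 → Euc n → Euc n} {h : Euc n → ℝ} {L k : ℝ}
    (hf : FieldBounds f L k) (hf2 : ∀ i, ContDiff ℝ 2 (f i)) (hh : ContDiff ℝ 2 h) {R D : ℝ}
    (hD : ∀ i, ∀ x ∈ Metric.closedBall (0 : Euc n) R, ‖fderiv ℝ (lieDeriv f h i) x‖ ≤ D)
    {a b δ : ℝ} {u : ℝ → Euc 2} {x y : ℝ → Euc n} (hx : IsTrajectory f a b u x)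
    (hy : IsTrajectory f a b u y) (hxB : ∀ t ∈ Icc a b, x t ∈ Metric.closedBall (0 : Euc n) R)
    (hyB : ∀ t ∈ Icc a b, y t ∈ Metric.closedBall (0 : Euc n) R)
    (hδ : ∀ t ∈ Icc a b, ‖y t - x t‖ ≤ δ) {t : ℝ} (ht : t ∈ Icc a b) :
    h (y t) - h (x t) ≤ h (y a) - h (x a) + 2 * D * δ * (t - a) := by
  have ha : a ∈ Icc a b := ⟨le_rfl, ht.1.trans ht.2⟩
  have hDn : 0 ≤ D := (norm_nonneg _).trans (hD 0 _ (hxB a ha))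
  have e1 := hx.comp_sub_eq hf (hh.of_le (by norm_num)) ha ht
  have e2 := hy.comp_sub_eq hf (hh.of_le (by norm_num)) ha ht
  have hint : ∀ z : ℝ → Euc n, IsTrajectory f a b u z →
      IntervalIntegrable (fun r => fderiv ℝ h (z r) (dynamics f (z r) (u r))) volume a t := by
    intro z hz
    have h1 := hz.intervalIntegrable hf ha ht
    have h2 : ContinuousOn (fun r => fderiv ℝ h (z r)) (Icc a t) :=
      (hh.continuous_fderiv (by norm_num)).comp_continuousOn
        (hz.cont.mono (Icc_subset_Icc_right ht.2))
    rw [intervalIntegrable_iff_integrableOn_Icc_of_le ht.1] at h1 ⊢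
    obtain ⟨M, hM⟩ := isCompact_Icc.exists_bound_of_continuousOn h2
    refine Integrable.of_bound (C := M * k) ?_ ?_
    · exact ((ContinuousLinearMap.id ℝ (Euc n →L[ℝ] ℝ)).aestronglyMeasurable_comp₂
        (h2.aestronglyMeasurable measurableSet_Icc) h1.aestronglyMeasurable)
    · filter_upwards [ae_restrict_mem measurableSet_Icc,
        ae_mono (Measure.restrict_mono (Icc_subset_Icc_right ht.2) le_rfl) hz.bound] with r hr hu
      exact ((fderiv ℝ h (z r)).le_opNorm _).trans (mul_le_mul (hM r hr)
        (hf.dynamics_norm_le _ hu) (norm_nonneg _) ((norm_nonneg _).trans (hM r hr)))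
  have e3 : (h (y t) - h (y a)) - (h (x t) - h (x a)) = ∫ r in a..t,
      (fderiv ℝ h (y r) (dynamics f (y r) (u r)) - fderiv ℝ h (x r) (dynamics f (x r) (u r))) := by
    rw [e1, e2, intervalIntegral.integral_sub (hint y hy) (hint x hx)]
  have e4 := intervalIntegral.norm_integral_le_of_norm_le_const_ae (a := a) (b := t)
    (f := fun r => fderiv ℝ h (y r) (dynamics f (y r) (u r)) -
      fderiv ℝ h (x r) (dynamics f (x r) (u r))) (C := 2 * D * δ) ?_
  · rw [← e3, abs_of_nonneg (sub_nonneg.2 ht.1)] at e4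
    have := (le_abs_self _).trans e4
    linarith
  · filter_upwards [(ae_restrict_iff' measurableSet_Icc).1 hx.bound] with r hr hrt
    rw [uIoc_of_le ht.1] at hrt
    have hrm : r ∈ Icc a b := ⟨hrt.1.le, hrt.2.trans ht.2⟩
    have hu := hr hrm
    rw [fderiv_dynamics, fderiv_dynamics, Real.norm_eq_abs]
    have g : ∀ i, |(u r) i * (lieDeriv f h i (y r) - lieDeriv f h i (x r))| ≤ D * δ := by
      intro i
      rw [abs_mul, ← one_mul (D * δ)]
      refine mul_le_mul (abs_coord_le_one hu i) ?_ (abs_nonneg _) zero_le_one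
      exact (abs_sub_le_of_fderiv_bound (contDiff_lieDeriv hf2 hh i) (hD i) (hxB r hrm)
        (hyB r hrm)).trans (mul_le_mul_of_nonneg_left (hδ r hrm) hDn)
    have e : (u r) 0 * lieDeriv f h 0 (y r) + (u r) 1 * lieDeriv f h 1 (y r) -
        ((u r) 0 * lieDeriv f h 0 (x r) + (u r) 1 * lieDeriv f h 1 (x r)) =
        (u r) 0 * (lieDeriv f h 0 (y r) - lieDeriv f h 0 (x r)) +
          (u r) 1 * (lieDeriv f h 1 (y r) - lieDeriv f h 1 (x r)) := by ring
    rw [e]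
    exact (abs_add_le _ _).trans (by linarith [g 0, g 1])

/-- One correction step. A trajectory which violates the constraint by at most `e` is modified from
time `t₀` on: a descent control is inserted during the time `τ`, and afterwards the original control
is followed with delay `τ`. The new trajectory is strictly feasible during a time `σ` that does not
depend on `e`, and its violation has grown at most by the factor `C`. -/
theorem exists_correction_step {n : ℕ} {f : Fin 2 → Euc n → Euc n} {h : Euc n → ℝ} {L k : ℝ}
    (hf : FieldBounds f L k) (hf2 : ∀ i, ContDiff ℝ 2 (f i)) (hh : ContDiff ℝ 2 h)
    (H4 : HypH4 f h) (R T : ℝ) :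
    ∃ κ > 0, ∃ C ≥ 1, ∃ σ > 0, ∃ e₀ > 0, ∀ u x, IsTrajectory f 0 T u x → ‖x 0‖ + k * T ≤ R →
      ∀ t₀ ∈ Ico 0 T, h (x t₀) ≤ 0 → ∀ e ∈ Ioc 0 e₀, (∀ t ∈ Icc 0 T, h (x t) ≤ e) →
        ∀ τ, κ * √e ≤ τ → ∃ w y, IsTrajectory f 0 T w y ∧ (∀ t ∈ Icc 0 t₀, y t = x t) ∧
          (∀ t ∈ Ioc t₀ (t₀ + σ), t ≤ T → h (y t) < 0) ∧ (∀ t ∈ Icc 0 T, h (y t) ≤ C * e) ∧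
          (∀ t ∈ Icc (t₀ + τ) T, ‖y t - x (t - τ)‖ ≤ C * e) ∧
          (∀ t ∈ Ico 0 t₀, w t = u t) ∧ (∀ t ∈ Ioc (t₀ + τ) T, w t = u (t - τ)) := by
  have hk := hf.k_pos
  have hL := hf.L_pos
  obtain ⟨κ, hκ, C₀, hC₀, m₀, hm₀, hdesc⟩ := exists_descent hf hf2 hh H4 R
  obtain ⟨D₀, hD₀, hb₀⟩ := exists_fderiv_bound (contDiff_lieDeriv hf2 hh 0) R
  obtain ⟨D₁, hD₁, hb₁⟩ := exists_fderiv_bound (contDiff_lieDeriv hf2 hh 1) R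
  obtain ⟨M, hM, hbM⟩ := exists_fderiv_bound (hh.of_le (by norm_num)) R
  set D := D₀ + D₁
  have hDpos : 0 < D := by positivity
  have hD : ∀ i, ∀ x ∈ Metric.closedBall (0 : Euc n) R, ‖fderiv ℝ (lieDeriv f h i) x‖ ≤ D := by
    intro i x hx
    fin_cases i
    · exact (hb₀ x hx).trans (le_add_of_nonneg_right hD₁.le)
    · exact (hb₁ x hx).trans (le_add_of_nonneg_left hD₀.le)
  -- the distance to the delayed trajectory is at most `C₁ e`
  set C₁ := 4 * C₀ * Real.exp (2 * L * |T|) with hC₁def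
  have hC₁ : 0 < C₁ := by positivity
  refine ⟨2 * κ, by positivity, 1 + C₁ + M * C₁, ?_, 1 / (D * C₁), by positivity, m₀ / 4,
    by positivity, fun u x hx hR t₀ ht₀ hxt₀ e he hxe τ hτ => ?_⟩
  · nlinarith [mul_pos hM hC₁]
  have he0 := he.1
  have hτ0 : 0 ≤ τ := le_trans (by positivity) hτ
  have ht₀m : t₀ ∈ Icc 0 T := ⟨ht₀.1, ht₀.2.le⟩
  have hT : 0 ≤ T := ht₀.1.trans ht₀.2.le
  have hs : κ * √(4 * e) ≤ τ := by
    have : √(4 * e) = 2 * √e := by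
      rw [Real.sqrt_mul (by norm_num), show (4 : ℝ) = 2 ^ 2 by norm_num,
        Real.sqrt_sq (by norm_num)]
    rw [this]; linarith
  have hxB : ∀ t ∈ Icc 0 T, x t ∈ Metric.closedBall (0 : Euc n) R := fun t ht =>
    hx.mem_closedBall hf hR ht
  obtain ⟨U, hUm, hU1, HU⟩ := hdesc (x t₀) (hxB t₀ ht₀m) hxt₀ (4 * e)
    ⟨by positivity, by linarith [he.2]⟩
  obtain ⟨hwm, hwb⟩ := splicedControl_admissible t₀ τ hx.meas hx.bound hUm hU1 ht₀.1 hτ0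
  set w := splicedControl u U t₀ τ with hw
  obtain ⟨y, hy0, hy⟩ := exists_isTrajectory hf hT hwm hwb (x 0)
  have hyB : ∀ t ∈ Icc 0 T, y t ∈ Metric.closedBall (0 : Euc n) R := fun t ht =>
    hy.mem_closedBall hf (by rwa [hy0]) ht
  have hwu : ∀ t ∈ Ico 0 t₀, w t = u t := fun t ht => by
    simp only [hw, splicedControl, if_pos ht.2]
  have hwd : ∀ t ∈ Ioc (t₀ + τ) T, w t = u (t - τ) := fun t ht => by
    simp only [hw, splicedControl]
    rw [if_neg (by linarith [ht.1]), if_neg (by linarith [ht.1])]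
  have hbefore : ∀ t ∈ Icc 0 t₀, y t = x t := by
    intro t ht
    have h1 : IsTrajectory f 0 t₀ u y := (hy.restrict hf le_rfl ht₀.2.le).congr_control
      fun r hr => (hwu r ⟨hr.1.le, hr.2⟩).symm
    have := (hx.restrict hf le_rfl ht₀.2.le).norm_sub_le_exp hf h1 ht
    rw [hy0, sub_self, norm_zero, zero_mul] at this
    exact sub_eq_zero.1 (norm_le_zero_iff.1 this)
  have hyt₀ : y t₀ = x t₀ := hbefore t₀ ⟨ht₀.1, le_rfl⟩
  -- during the descent
  obtain ⟨hdown, hend⟩ := HU (min (t₀ + τ) T - t₀) (fun t => y (t + t₀))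
    (((hy.restrict hf ht₀.1 (min_le_right _ _)).shift_to_zero).congr_control fun t ht => by
      have h1 : t + t₀ ≤ t₀ + τ := by
        have := ht.2.le.trans (sub_le_sub_right (min_le_left (t₀ + τ) T) t₀)
        linarith
      simp only [hw, splicedControl]
      rw [if_neg (by linarith [ht.1]), if_pos h1, add_sub_cancel_right])
    (by simpa using hyt₀)
    (fun t ht => hyB _ ⟨by linarith [ht.1, ht₀.1], by
      have := ht.2.trans (sub_le_sub_right (min_le_right (t₀ + τ) T) t₀)
      linarith⟩)
  have hdescent : ∀ t ∈ Ioc t₀ (t₀ + τ), t ≤ T → h (y t) < 0 := by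
    intro t ht htT
    have := hdown (t - t₀) ⟨by linarith [ht.1], sub_le_sub_right (le_min ht.2 htT) _⟩
    simp only [sub_add_cancel] at this
    linarith
  -- after the descent
  have hafter : ∀ t ∈ Icc (t₀ + τ) T, ‖y t - x (t - τ)‖ ≤ C₁ * e ∧
      h (y t) - h (x (t - τ)) ≤ -(4 * e) + 2 * D * (C₁ * e) * (t - (t₀ + τ)) := by
    intro t ht
    have hle : t₀ + τ ≤ T := ht.1.trans ht.2
    obtain ⟨hend1, hend2⟩ := hend τ ⟨hτ0, by rw [min_eq_left hle]; linarith⟩ hs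
    simp only [add_comm τ t₀] at hend1 hend2
    have hx' : IsTrajectory f t₀ (T - τ) u x := hx.restrict hf ht₀.1 (by linarith)
    have hxs := hx'.shift τ
    rw [sub_add_cancel] at hxs
    have hys : IsTrajectory f (t₀ + τ) T (fun t => u (t - τ)) y :=
      (hy.restrict hf (by linarith [ht₀.1]) le_rfl).congr_control fun r hr =>
        (hwd r ⟨hr.1, hr.2.le⟩).symm
    have hclose : ∀ r ∈ Icc (t₀ + τ) T, ‖y r - x (r - τ)‖ ≤ C₁ * e := by
      intro r hr
      have h1 := hx'.norm_sub_shift_le hf (y := y) (by rwa [sub_add_cancel])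
        (by rwa [sub_add_cancel])
      refine h1.trans ?_
      have h2 : Real.exp (2 * L * (r - (t₀ + τ))) ≤ Real.exp (2 * L * |T|) := by
        gcongr
        rw [abs_of_nonneg hT]
        linarith [hr.2, ht₀.1]
      calc _ ≤ C₀ * (4 * e) * Real.exp (2 * L * |T|) := by gcongr
        _ = C₁ * e := by rw [hC₁def]; ring
    refine ⟨hclose t ht, ?_⟩
    have h1 := comp_sub_le_of_close hf hf2 hh hD hxs hys
      (fun r hr => hxB _ ⟨by linarith [hr.1, ht₀.1], by linarith [hr.2]⟩)
      (fun r hr => hyB _ ⟨by linarith [hr.1, ht₀.1], hr.2⟩) hclose ht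
    simp only [add_sub_cancel_right] at h1
    linarith
  refine ⟨w, y, hy, hbefore, fun t ht htT => ?_, fun t ht => ?_, fun t ht => ?_, hwu, hwd⟩
  · rcases le_or_gt t (t₀ + τ) with htτ | htτ
    · exact hdescent t ⟨ht.1, htτ⟩ htT
    · have h1 := (hafter t ⟨htτ.le, htT⟩).2
      have h2 := hxe (t - τ) ⟨by linarith [ht₀.1], by linarith⟩
      have h3 : t - (t₀ + τ) ≤ 1 / (D * C₁) := by linarith [ht.2]
      have h4 : 2 * D * (C₁ * e) * (t - (t₀ + τ)) ≤ 2 * e := by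
        calc _ ≤ 2 * D * (C₁ * e) * (1 / (D * C₁)) := by gcongr
          _ = 2 * e := by field_simp
      linarith
  · have hCe : e ≤ (1 + C₁ + M * C₁) * e := by nlinarith [mul_pos hM hC₁, mul_pos hC₁ he0]
    rcases le_or_gt t t₀ with htt | htt
    · rw [hbefore t ⟨ht.1, htt⟩]
      exact (hxe t ht).trans hCe
    rcases le_or_gt t (t₀ + τ) with htτ | htτ
    · exact (hdescent t ⟨htt, htτ⟩ ht.2).le.trans (he0.le.trans hCe)
    · have hm : t - τ ∈ Icc 0 T := ⟨by linarith [ht₀.1], by linarith [ht.2]⟩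
      have h1 := (hafter t ⟨htτ.le, ht.2⟩).1
      have h2 := abs_sub_le_of_fderiv_bound (hh.of_le (by norm_num)) hbM (hxB _ hm) (hyB _ ht)
      have h3 := (le_abs_self _).trans (h2.trans (mul_le_mul_of_nonneg_left h1 hM.le))
      have h4 := hxe _ hm
      nlinarith [mul_pos hC₁ he0]
  · refine (hafter t ht).1.trans ?_
    nlinarith [mul_pos hM hC₁, mul_pos (mul_pos hM hC₁) he0]

/-! ### Integral estimates for delayed functions -/

theorem normLp_one_eq {m : ℕ} (I : Set ℝ) (g : ℝ → Euc m) :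
    normLp 1 I g = ∫⁻ t in I, ‖g t‖ₑ := by
  rw [normLp, eLpNorm_one_eq_lintegral_enorm]

theorem measurePreserving_sub_Ioo (a b τ : ℝ) :
    MeasurePreserving (fun t : ℝ => t - τ) (volume.restrict (Ioo (a + τ) b))
      (volume.restrict (Ioo a (b - τ))) := by
  have := (measurePreserving_sub_right (volume : Measure ℝ) τ).restrict_preimage
    (measurableSet_Ioo (a := a) (b := b - τ))
  simpa using this

theorem setLIntegral_comp_sub (F : ℝ → ℝ≥0∞) (a b τ : ℝ) :
    ∫⁻ t in Ioo (a + τ) b, F (t - τ) = ∫⁻ t in Ioo a (b - τ), F t :=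
  (measurePreserving_sub_Ioo a b τ).lintegral_comp_emb (measurableEmbedding_subRight τ) F

/-- Effect of one correction step on `L¹` distances: if `g'` agrees with `g` before `t₀`, differs
from it by at most `M` up to `t₀ + τ`, and is `δ`-close to the delayed `g` afterwards, then its
`L¹` distance to `g₀` is controlled by that of `g` and by the effect of the delay on `g₀`. -/
theorem lintegral_delay_le {m : ℕ} {g₀ g g' : ℝ → Euc m} {T t₁ t₀ τ M δ : ℝ}
    (hg₀ : AEStronglyMeasurable g₀ (volume.restrict (Ioo 0 T)))
    (hg : AEStronglyMeasurable g (volume.restrict (Ioo 0 T)))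
    (ht₁ : t₁ ≤ t₀) (ht₀ : 0 ≤ t₀) (ht₀T : t₀ ≤ T) (hτ : 0 ≤ τ) (hM : 0 ≤ M) (hδ : 0 ≤ δ)
    (h1 : ∀ᵐ t, t ∈ Ioo 0 t₀ → g' t = g t)
    (h2 : ∀ᵐ t, t ∈ Ioo 0 T → ‖g' t - g t‖ ≤ M)
    (h3 : ∀ᵐ t, t ∈ Ioo (t₀ + τ) T → ‖g' t - g (t - τ)‖ ≤ δ) :
    ∫⁻ t in Ioo 0 T, ‖g' t - g₀ t‖ₑ ≤ 3 * (∫⁻ t in Ioo 0 T, ‖g t - g₀ t‖ₑ) +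
      (ENNReal.ofReal (M * τ + δ * T) + ∫⁻ t in Ioo (t₁ + τ) T, ‖g₀ (t - τ) - g₀ t‖ₑ) := by
  set E := ∫⁻ t in Ioo 0 T, ‖g t - g₀ t‖ₑ with hE
  set W := ∫⁻ t in Ioo (t₁ + τ) T, ‖g₀ (t - τ) - g₀ t‖ₑ with hW
  have hT : 0 ≤ T := ht₀.trans ht₀T
  have hJ : Ioo (t₀ + τ) T ⊆ Ioo 0 T := Ioo_subset_Ioo_left (by linarith)
  have hJ' : Ioo t₀ (T - τ) ⊆ Ioo 0 T := Ioo_subset_Ioo ht₀ (by linarith)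
  have hdm : AEStronglyMeasurable (fun t => g t - g₀ t) (volume.restrict (Ioo 0 T)) := hg.sub hg₀
  have hsum : ∫⁻ t in Ioo 0 T, ‖g' t - g₀ t‖ₑ ≤ E + ∫⁻ t in Ioo 0 T, ‖g' t - g t‖ₑ := by
    rw [hE, ← lintegral_add_left' hdm.enorm]
    refine lintegral_mono fun t => ?_
    have : g' t - g₀ t = (g t - g₀ t) + (g' t - g t) := by abel
    rw [this]
    exact enorm_add_le _ _
  have hcover : Ioo 0 T ⊆ (Ioo 0 t₀ ∪ (Icc t₀ (t₀ + τ) ∩ Ioo 0 T)) ∪ Ioo (t₀ + τ) T := by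
    intro t ht
    rcases lt_or_ge t t₀ with h | h
    · exact Or.inl (Or.inl ⟨ht.1, h⟩)
    · rcases le_or_gt t (t₀ + τ) with h' | h'
      · exact Or.inl (Or.inr ⟨⟨h, h'⟩, ht⟩)
      · exact Or.inr ⟨h', ht.2⟩
  have hsplit : ∫⁻ t in Ioo 0 T, ‖g' t - g t‖ₑ ≤ (∫⁻ t in Ioo 0 t₀, ‖g' t - g t‖ₑ) +
      (∫⁻ t in Icc t₀ (t₀ + τ) ∩ Ioo 0 T, ‖g' t - g t‖ₑ) +
      ∫⁻ t in Ioo (t₀ + τ) T, ‖g' t - g t‖ₑ :=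
    (lintegral_mono_set hcover).trans ((lintegral_union_le _ _ _).trans
      (add_le_add_left (lintegral_union_le _ _ _) _))
  have hA : ∫⁻ t in Ioo 0 t₀, ‖g' t - g t‖ₑ = 0 := by
    refine (lintegral_congr_ae ?_).trans lintegral_zero
    filter_upwards [(ae_restrict_iff' measurableSet_Ioo).2 h1] with t ht
    simp [ht]
  have hB : ∫⁻ t in Icc t₀ (t₀ + τ) ∩ Ioo 0 T, ‖g' t - g t‖ₑ ≤ ENNReal.ofReal (M * τ) := by
    calc _ ≤ ∫⁻ t in Icc t₀ (t₀ + τ) ∩ Ioo 0 T, ENNReal.ofReal M := by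
          refine lintegral_mono_ae
            ((ae_restrict_iff' (measurableSet_Icc.inter measurableSet_Ioo)).2 ?_)
          filter_upwards [h2] with t ht htm
          rw [← ofReal_norm]
          exact ENNReal.ofReal_le_ofReal (ht htm.2)
      _ ≤ ∫⁻ t in Icc t₀ (t₀ + τ), ENNReal.ofReal M := lintegral_mono_set inter_subset_left
      _ = ENNReal.ofReal (M * τ) := by
          rw [setLIntegral_const, Real.volume_Icc, add_sub_cancel_left, ENNReal.ofReal_mul hM]
  have hshiftm : AEStronglyMeasurable (fun t => g (t - τ) - g₀ (t - τ))
      (volume.restrict (Ioo (t₀ + τ) T)) :=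
    (hdm.mono_measure (Measure.restrict_mono hJ' le_rfl)).comp_measurePreserving
      (measurePreserving_sub_Ioo t₀ T τ)
  have hdm' : AEStronglyMeasurable (fun t => g₀ t - g t) (volume.restrict (Ioo (t₀ + τ) T)) :=
    (hg₀.sub hg).mono_measure (Measure.restrict_mono hJ le_rfl)
  have hC : ∫⁻ t in Ioo (t₀ + τ) T, ‖g' t - g t‖ₑ ≤
      ENNReal.ofReal (δ * T) + E + (W + E) := by
    calc _ ≤ ∫⁻ t in Ioo (t₀ + τ) T, ((ENNReal.ofReal δ + ‖g (t - τ) - g₀ (t - τ)‖ₑ) +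
            (‖g₀ (t - τ) - g₀ t‖ₑ + ‖g₀ t - g t‖ₑ)) := by
          refine lintegral_mono_ae ?_
          filter_upwards [(ae_restrict_iff' measurableSet_Ioo).2 h3] with t ht
          have e : g' t - g t = ((g' t - g (t - τ)) + (g (t - τ) - g₀ (t - τ))) +
              ((g₀ (t - τ) - g₀ t) + (g₀ t - g t)) := by abel
          rw [e]
          refine (enorm_add_le _ _).trans (add_le_add ((enorm_add_le _ _).trans
            (add_le_add_left ?_ _)) (enorm_add_le _ _))
          rw [← ofReal_norm]
          exact ENNReal.ofReal_le_ofReal ht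
      _ = ((∫⁻ t in Ioo (t₀ + τ) T, ENNReal.ofReal δ) +
            ∫⁻ t in Ioo (t₀ + τ) T, ‖g (t - τ) - g₀ (t - τ)‖ₑ) +
            ((∫⁻ t in Ioo (t₀ + τ) T, ‖g₀ (t - τ) - g₀ t‖ₑ) +
              ∫⁻ t in Ioo (t₀ + τ) T, ‖g₀ t - g t‖ₑ) := by
          have haux : AEMeasurable (fun t => ENNReal.ofReal δ + ‖g (t - τ) - g₀ (t - τ)‖ₑ)
              (volume.restrict (Ioo (t₀ + τ) T)) := aemeasurable_const.add hshiftm.enorm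
          rw [lintegral_add_left' haux, lintegral_add_left' aemeasurable_const,
            lintegral_add_right' _ hdm'.enorm]
      _ ≤ _ := by
          refine add_le_add (add_le_add ?_ ?_) (add_le_add ?_ ?_)
          · rw [setLIntegral_const, Real.volume_Ioo, ← ENNReal.ofReal_mul hδ]
            refine ENNReal.ofReal_le_ofReal (mul_le_mul_of_nonneg_left ?_ hδ)
            linarith
          · rw [setLIntegral_comp_sub (fun t => ‖g t - g₀ t‖ₑ) t₀ T τ]
            exact lintegral_mono_set hJ'
          · exact lintegral_mono_set (Ioo_subset_Ioo_left (by linarith))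
          · rw [hE]
            simp_rw [enorm_sub_rev (g₀ _) (g _)]
            exact lintegral_mono_set hJ
  calc _ ≤ E + ((0 + ENNReal.ofReal (M * τ)) + (ENNReal.ofReal (δ * T) + E + (W + E))) := by
        refine hsum.trans (add_le_add_right (hsplit.trans ?_) _)
        exact add_le_add (add_le_add hA.le hB) hC
    _ = _ := by
        rw [ENNReal.ofReal_add (by positivity) (by positivity)]
        ring

/-- `L¹` continuity of translations of one function, on a bounded interval. -/
theorem exists_translation_le {m : ℕ} {T : ℝ} {g : ℝ → Euc m}
    (hg : Integrable g (volume.restrict (Icc 0 T))) {ε : ℝ≥0∞} (hε : 0 < ε) :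
    ∃ ρ > 0, ∀ τ, 0 ≤ τ → τ ≤ ρ → ∫⁻ t in Ioo τ T, ‖g (t - τ) - g t‖ₑ ≤ ε := by
  rcases eq_or_ne ε ∞ with rfl | hε'
  · exact ⟨1, one_pos, fun _ _ _ => le_top⟩
  obtain ⟨φ, hφs, hφ, hφc, hφi⟩ := hg.exists_hasCompactSupport_lintegral_sub_le
    (ε := ε / 3) (by simpa using hε.ne')
  have huc : UniformContinuous φ := hφs.uniformContinuous_of_continuous hφc
  set η := (ε / 3).toReal / (|T| + 1) with hη
  have hε3 : 0 < (ε / 3).toReal := ENNReal.toReal_pos (by simpa using hε.ne')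
    (ENNReal.div_ne_top hε' (by norm_num))
  have hηpos : 0 < η := by positivity
  obtain ⟨ρ, hρ, H⟩ := Metric.uniformContinuous_iff_le.1 huc η hηpos
  refine ⟨ρ, hρ, fun τ hτ hτρ => ?_⟩
  have hJ : Ioo τ T ⊆ Icc 0 T := fun t ht => ⟨hτ.trans ht.1.le, ht.2.le⟩
  have hJ' : Ioo 0 (T - τ) ⊆ Icc 0 T := fun t ht => ⟨ht.1.le, by linarith [ht.2]⟩
  have hdm : AEStronglyMeasurable (fun t => g t - φ t) (volume.restrict (Icc 0 T)) :=
    hg.aestronglyMeasurable.sub hφi.aestronglyMeasurable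
  have hmp : MeasurePreserving (fun t : ℝ => t - τ) (volume.restrict (Ioo τ T))
      (volume.restrict (Ioo 0 (T - τ))) := by
    simpa using measurePreserving_sub_Ioo 0 T τ
  have hshiftm : AEStronglyMeasurable (fun t => g (t - τ) - φ (t - τ))
      (volume.restrict (Ioo τ T)) :=
    (hdm.mono_measure (Measure.restrict_mono hJ' le_rfl)).comp_measurePreserving hmp
  have hdm' : AEStronglyMeasurable (fun t => φ t - g t) (volume.restrict (Ioo τ T)) :=
    (hφi.aestronglyMeasurable.sub hg.aestronglyMeasurable).mono_measure
      (Measure.restrict_mono hJ le_rfl)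
  calc ∫⁻ t in Ioo τ T, ‖g (t - τ) - g t‖ₑ
      ≤ ∫⁻ t in Ioo τ T, ((‖g (t - τ) - φ (t - τ)‖ₑ + ENNReal.ofReal η) + ‖φ t - g t‖ₑ) := by
        refine lintegral_mono fun t => ?_
        have e : g (t - τ) - g t =
            ((g (t - τ) - φ (t - τ)) + (φ (t - τ) - φ t)) + (φ t - g t) := by abel
        rw [e]
        refine (enorm_add_le _ _).trans (add_le_add_left ((enorm_add_le _ _).trans
          (add_le_add_right ?_ _)) _)
        rw [← ofReal_norm]
        refine ENNReal.ofReal_le_ofReal ?_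
        rw [← dist_eq_norm]
        refine H ?_
        rw [dist_eq_norm, sub_sub_cancel_left, norm_neg, Real.norm_eq_abs, abs_of_nonneg hτ]
        exact hτρ
    _ = (∫⁻ t in Ioo τ T, ‖g (t - τ) - φ (t - τ)‖ₑ) + (∫⁻ t in Ioo τ T, ENNReal.ofReal η) +
          ∫⁻ t in Ioo τ T, ‖φ t - g t‖ₑ := by
        rw [lintegral_add_right' _ hdm'.enorm, lintegral_add_left' hshiftm.enorm]
    _ ≤ ε / 3 + ε / 3 + ε / 3 := by
        gcongr
        · rw [hmp.lintegral_comp_emb (measurableEmbedding_subRight τ) (fun t => ‖g t - φ t‖ₑ)]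
          exact (lintegral_mono_set hJ').trans hφ
        · rw [setLIntegral_const, Real.volume_Ioo, ← ENNReal.ofReal_mul hηpos.le]
          refine ENNReal.ofReal_le_of_le_toReal ?_
          rw [hη, div_mul_eq_mul_div, div_le_iff₀ (by positivity)]
          gcongr
          linarith [le_abs_self T]
        · simp_rw [enorm_sub_rev (φ _) (g _)]
          exact (lintegral_mono_set hJ).trans hφ
    _ = ε := ENNReal.add_thirds ε

/-- `L¹` continuity of translations, uniformly on a compact subset of `L¹(0, T)`. -/
theorem exists_translation_le_of_isCompact {m : ℕ} {T : ℝ}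
    {G : Set (Lp (Euc m) 1 (volume.restrict (Icc 0 T)))} (hG : IsCompact G) {ε : ℝ≥0∞}
    (hε : 0 < ε) : ∃ ρ > 0, ∀ τ, 0 ≤ τ → τ ≤ ρ → ∀ g ∈ G,
      ∫⁻ t in Ioo τ T, ‖g (t - τ) - g t‖ₑ ≤ ε := by
  have hε3 : 0 < ε / 3 := by simpa using hε.ne'
  have key : ∀ g₀ : Lp (Euc m) 1 (volume.restrict (Icc 0 T)), ∃ ρ > 0, ∀ τ, 0 ≤ τ → τ ≤ ρ →
      ∀ g ∈ Metric.eball g₀ (ε / 3), ∫⁻ t in Ioo τ T, ‖g (t - τ) - g t‖ₑ ≤ ε := by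
    intro g₀
    obtain ⟨ρ, hρ, H⟩ := exists_translation_le (L1.integrable_coeFn g₀) hε3
    refine ⟨ρ, hρ, fun τ hτ hτρ g hg => ?_⟩
    have hdist : ∫⁻ t in Icc 0 T, ‖g t - g₀ t‖ₑ ≤ ε / 3 := by
      have h1 : edist g g₀ < ε / 3 := hg
      rw [Lp.edist_def, eLpNorm_one_eq_lintegral_enorm] at h1
      exact h1.le
    have hJ : Ioo τ T ⊆ Icc 0 T := fun t ht => ⟨hτ.trans ht.1.le, ht.2.le⟩
    have hJ' : Ioo 0 (T - τ) ⊆ Icc 0 T := fun t ht => ⟨ht.1.le, by linarith [ht.2]⟩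
    have hdm : AEStronglyMeasurable (fun t => g t - g₀ t) (volume.restrict (Icc 0 T)) :=
      (Lp.aestronglyMeasurable g).sub (Lp.aestronglyMeasurable g₀)
    have hmp : MeasurePreserving (fun t : ℝ => t - τ) (volume.restrict (Ioo τ T))
        (volume.restrict (Ioo 0 (T - τ))) := by
      simpa using measurePreserving_sub_Ioo 0 T τ
    have hshiftm : AEStronglyMeasurable (fun t => g (t - τ) - g₀ (t - τ))
        (volume.restrict (Ioo τ T)) :=
      (hdm.mono_measure (Measure.restrict_mono hJ' le_rfl)).comp_measurePreserving hmp
    have hdm' : AEStronglyMeasurable (fun t => g₀ t - g t) (volume.restrict (Ioo τ T)) :=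
      ((Lp.aestronglyMeasurable g₀).sub (Lp.aestronglyMeasurable g)).mono_measure
        (Measure.restrict_mono hJ le_rfl)
    calc ∫⁻ t in Ioo τ T, ‖g (t - τ) - g t‖ₑ
        ≤ ∫⁻ t in Ioo τ T, ((‖g (t - τ) - g₀ (t - τ)‖ₑ + ‖g₀ (t - τ) - g₀ t‖ₑ) +
            ‖g₀ t - g t‖ₑ) := by
          refine lintegral_mono fun t => ?_
          have e : g (t - τ) - g t =
              ((g (t - τ) - g₀ (t - τ)) + (g₀ (t - τ) - g₀ t)) + (g₀ t - g t) := by abel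
          rw [e]
          exact (enorm_add_le _ _).trans (add_le_add_left (enorm_add_le _ _) _)
      _ = (∫⁻ t in Ioo τ T, ‖g (t - τ) - g₀ (t - τ)‖ₑ) +
            (∫⁻ t in Ioo τ T, ‖g₀ (t - τ) - g₀ t‖ₑ) + ∫⁻ t in Ioo τ T, ‖g₀ t - g t‖ₑ := by
          rw [lintegral_add_right' _ hdm'.enorm, lintegral_add_left' hshiftm.enorm]
      _ ≤ ε / 3 + ε / 3 + ε / 3 := by
          gcongr
          · rw [hmp.lintegral_comp_emb (measurableEmbedding_subRight τ) (fun t => ‖g t - g₀ t‖ₑ)]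
            exact (lintegral_mono_set hJ').trans hdist
          · exact H τ hτ hτρ
          · simp_rw [enorm_sub_rev (g₀ _) (g _)]
            exact (lintegral_mono_set hJ).trans hdist
      _ = ε := ENNReal.add_thirds ε
  choose ρ hρ H using key
  obtain ⟨S, -, hS⟩ := hG.elim_nhds_subcover (fun g₀ => Metric.eball g₀ (ε / 3))
    fun g₀ _ => Metric.eball_mem_nhds g₀ hε3
  rcases S.eq_empty_or_nonempty with rfl | hne
  · exact ⟨1, one_pos, fun τ _ _ g hg => by simpa using hS hg⟩
  refine ⟨S.inf' hne ρ, (Finset.lt_inf'_iff hne).2 fun g₀ _ => hρ g₀, fun τ hτ hτρ g hg => ?_⟩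
  obtain ⟨g₀, hg₀, hgm⟩ := mem_iUnion₂.1 (hS hg)
  exact H g₀ τ hτ (hτρ.trans (Finset.inf'_le _ hg₀)) g hgm

/-- A delay `τ` moves a function of bounded variation by at most `τ` times its variation in `L¹`. -/
theorem lintegral_translation_le_variation {m : ℕ} {T τ : ℝ} {v : ℝ → Euc m}
    (hv : BoundedVariationOn v (Icc 0 T)) (hτ : 0 ≤ τ) :
    ∫⁻ t in Ioo τ T, ‖v (t - τ) - v t‖ₑ ≤ ENNReal.ofReal τ * eVariationOn v (Icc 0 T) := by
  rcases le_or_gt T τ with hTτ | hτT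
  · simp [Ioo_eq_empty (not_lt.2 hTτ)]
  set φ : ℝ → ℝ≥0∞ := fun t => eVariationOn v (Icc 0 t) with hφ
  have hmono : Monotone φ := fun s t hst => eVariationOn.mono v (Icc_subset_Icc_right hst)
  have hφm : Measurable φ := hmono.measurable
  have hfin : ∀ t ≤ T, φ t ≠ ∞ := fun t ht =>
    ne_top_of_le_ne_top hv (eVariationOn.mono v (Icc_subset_Icc_right ht))
  have hpt : ∀ t ∈ Ioo τ T, ‖v (t - τ) - v t‖ₑ + φ (t - τ) ≤ φ t := by
    intro t ht
    have h1 : φ (t - τ) + eVariationOn v (Icc (t - τ) t) = φ t := by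
      have := eVariationOn.Icc_add_Icc v (s := univ) (a := 0) (b := t - τ) (c := t)
        (by linarith [ht.1]) (by linarith) (mem_univ _)
      simpa using this
    rw [← h1, add_comm]
    gcongr
    rw [← edist_eq_enorm_sub]
    exact eVariationOn.edist_le v ⟨le_rfl, by linarith⟩ ⟨by linarith, le_rfl⟩
  have h1 : (∫⁻ t in Ioo τ T, ‖v (t - τ) - v t‖ₑ) + ∫⁻ t in Ioo τ T, φ (t - τ) ≤
      ∫⁻ t in Ioo τ T, φ t := by
    have hφm' : Measurable fun t => φ (t - τ) := hφm.comp (measurable_sub_const τ)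
    rw [← lintegral_add_right _ hφm']
    exact setLIntegral_mono' measurableSet_Ioo hpt
  have h2 : ∫⁻ t in Ioo τ T, φ (t - τ) = ∫⁻ t in Ioo 0 (T - τ), φ t := by
    have := setLIntegral_comp_sub φ 0 T τ
    rwa [zero_add] at this
  have h3 : ∫⁻ t in Ioo τ T, φ t ≤ (∫⁻ t in Ioo 0 (T - τ), φ t) +
      ENNReal.ofReal τ * eVariationOn v (Icc 0 T) := by
    have hsub : Ioo τ T ⊆ Ioo 0 (T - τ) ∪ Ico (T - τ) T := fun t ht => by
      rcases lt_or_ge t (T - τ) with h | h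
      · exact Or.inl ⟨hτ.trans_lt ht.1, h⟩
      · exact Or.inr ⟨h, ht.2⟩
    refine (lintegral_mono_set hsub).trans ((lintegral_union_le _ _ _).trans ?_)
    gcongr
    calc ∫⁻ t in Ico (T - τ) T, φ t ≤ ∫⁻ t in Ico (T - τ) T, φ T :=
          setLIntegral_mono' measurableSet_Ico fun t ht => hmono ht.2.le
      _ = _ := by
          rw [setLIntegral_const, Real.volume_Ico, sub_sub_cancel, mul_comm]
  have h4 : ∫⁻ t in Ioo 0 (T - τ), φ t ≠ ∞ := by
    refine ne_top_of_le_ne_top (b := φ T * volume (Ioo 0 (T - τ))) ?_ ?_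
    · exact ENNReal.mul_ne_top (hfin T le_rfl) (by simp)
    · rw [← setLIntegral_const]
      exact setLIntegral_mono' measurableSet_Ioo fun t ht => hmono (by linarith [ht.2])
  rw [h2] at h1
  have h5 := h1.trans h3
  rw [add_comm (∫⁻ t in Ioo 0 (T - τ), φ t)] at h5
  exact ENNReal.le_of_add_le_add_right h4 h5

/-! ### Iteration of the correction step -/

section Iteration

variable {n : ℕ} {f : Fin 2 → Euc n → Euc n} {L k : ℝ}

theorem IsTrajectory.ae_deriv_eq {a b : ℝ} {u : ℝ → Euc 2} {x : ℝ → Euc n}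
    (h : IsTrajectory f a b u x) (hf : FieldBounds f L k) :
    ∀ᵐ t, t ∈ Icc a b → ‖u t‖ ≤ 1 ∧ deriv x t = dynamics f (x t) (u t) := by
  filter_upwards [(ae_restrict_iff' measurableSet_Icc).1 (h.ae_hasDerivAt hf),
    (ae_restrict_iff' measurableSet_Icc).1 h.bound] with t h1 h2 ht
  exact ⟨h2 ht, (h1 ht).deriv⟩

theorem ae_comp_sub {P : ℝ → Prop} (h : ∀ᵐ t, P t) (τ : ℝ) : ∀ᵐ t, P (t - τ) :=
  (measurePreserving_sub_right (volume : Measure ℝ) τ).quasiMeasurePreserving.ae h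

/-- The `L¹` estimate of one correction step for the controls. -/
theorem control_step_le {T t₁ t₀ τ : ℝ} {u v w : ℝ → Euc 2} {x y z : ℝ → Euc n}
    (hx : IsTrajectory f 0 T u x) (hy : IsTrajectory f 0 T v y) (hz : IsTrajectory f 0 T w z)
    (ht₁ : t₁ ≤ t₀) (ht₀ : t₀ ∈ Ico 0 T) (hτ : 0 ≤ τ) (h1 : ∀ t ∈ Ico 0 t₀, w t = v t)
    (h3 : ∀ t ∈ Ioc (t₀ + τ) T, w t = v (t - τ)) :
    ∫⁻ t in Ioo 0 T, ‖w t - u t‖ₑ ≤ 3 * (∫⁻ t in Ioo 0 T, ‖v t - u t‖ₑ) +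
      (ENNReal.ofReal (2 * τ) + ∫⁻ t in Ioo (t₁ + τ) T, ‖u (t - τ) - u t‖ₑ) := by
  have hm : ∀ {r : ℝ → Euc 2} {q : ℝ → Euc n}, IsTrajectory f 0 T r q →
      AEStronglyMeasurable r (volume.restrict (Ioo 0 T)) := fun h =>
    h.meas.mono_measure (Measure.restrict_mono Ioo_subset_Icc_self le_rfl)
  have := lintegral_delay_le (g' := w) (M := 2) (δ := 0) (hm hx) (hm hy) ht₁ ht₀.1 ht₀.2.le hτ
    (by norm_num) le_rfl (Filter.Eventually.of_forall fun t ht => h1 t ⟨ht.1.le, ht.2⟩) ?_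
    (Filter.Eventually.of_forall fun t ht => by rw [h3 t ⟨ht.1, ht.2.le⟩, sub_self, norm_zero])
  · simpa using this
  · filter_upwards [(ae_restrict_iff' measurableSet_Icc).1 hz.bound,
      (ae_restrict_iff' measurableSet_Icc).1 hy.bound] with t hw hv ht
    have := norm_sub_le (w t) (v t)
    linarith [hw (Ioo_subset_Icc_self ht), hv (Ioo_subset_Icc_self ht)]

/-- The `L¹` estimate of one correction step for the derivatives. -/
theorem deriv_step_le (hf : FieldBounds f L k) {T t₁ t₀ τ δ : ℝ} {v w : ℝ → Euc 2}
    {x y z : ℝ → Euc n} (hy : IsTrajectory f 0 T v y)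
    (hz : IsTrajectory f 0 T w z) (ht₁ : t₁ ≤ t₀) (ht₀ : t₀ ∈ Ico 0 T) (hτ : 0 ≤ τ)
    (hδ : 0 ≤ δ) (h1 : ∀ t ∈ Icc 0 t₀, z t = y t)
    (h3 : ∀ t ∈ Ioc (t₀ + τ) T, w t = v (t - τ))
    (h4 : ∀ t ∈ Icc (t₀ + τ) T, ‖z t - y (t - τ)‖ ≤ δ) :
    ∫⁻ t in Ioo 0 T, ‖deriv z t - deriv x t‖ₑ ≤ 3 * (∫⁻ t in Ioo 0 T, ‖deriv y t - deriv x t‖ₑ) +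
      (ENNReal.ofReal (2 * k * τ + 2 * L * δ * T) +
        ∫⁻ t in Ioo (t₁ + τ) T, ‖deriv x (t - τ) - deriv x t‖ₑ) := by
  have hL := hf.L_pos
  have hk := hf.k_pos
  refine lintegral_delay_le (stronglyMeasurable_deriv x).aestronglyMeasurable
    (stronglyMeasurable_deriv y).aestronglyMeasurable ht₁ ht₀.1 ht₀.2.le hτ
    (by positivity) (by positivity) (Filter.Eventually.of_forall fun t ht => ?_) ?_ ?_
  · refine Filter.EventuallyEq.deriv_eq ?_
    filter_upwards [Ioo_mem_nhds ht.1 ht.2] with r hr using h1 r (Ioo_subset_Icc_self hr)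
  · filter_upwards [hz.ae_deriv_eq hf, hy.ae_deriv_eq hf] with t hzt hyt ht
    obtain ⟨hz1, hz2⟩ := hzt (Ioo_subset_Icc_self ht)
    obtain ⟨hy1, hy2⟩ := hyt (Ioo_subset_Icc_self ht)
    rw [hz2, hy2]
    refine (norm_sub_le _ _).trans ?_
    linarith [hf.dynamics_norm_le (z t) hz1, hf.dynamics_norm_le (y t) hy1]
  · filter_upwards [hz.ae_deriv_eq hf, ae_comp_sub (hy.ae_deriv_eq hf) τ] with t hzt hyt ht
    have hm : t - τ ∈ Icc 0 T := ⟨by linarith [ht.1, ht₀.1], by linarith [ht.2]⟩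
    obtain ⟨hz1, hz2⟩ := hzt ⟨by linarith [ht.1, ht₀.1], ht.2.le⟩
    obtain ⟨hy1, hy2⟩ := hyt hm
    rw [hz2, hy2, h3 t ⟨ht.1, ht.2.le⟩]
    refine (hf.dynamics_sub_le _ _ hy1).trans ?_
    gcongr
    exact h4 t (Ioo_subset_Icc_self ht)

/-- The uniform estimate of one correction step. -/
theorem state_step_le (hf : FieldBounds f L k) {T t₀ τ δ : ℝ} {v w : ℝ → Euc 2}
    {y z : ℝ → Euc n} (hy : IsTrajectory f 0 T v y) (hz : IsTrajectory f 0 T w z)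
    (ht₀ : t₀ ∈ Ico 0 T) (hτ : 0 ≤ τ) (hδ : 0 ≤ δ) (h1 : ∀ t ∈ Icc 0 t₀, z t = y t)
    (h4 : ∀ t ∈ Icc (t₀ + τ) T, ‖z t - y (t - τ)‖ ≤ δ) :
    ∀ t ∈ Icc 0 T, ‖z t - y t‖ ≤ 2 * k * τ + δ := by
  have hk := hf.k_pos
  have hkτ : 0 ≤ k * τ := by positivity
  intro t ht
  rcases le_or_gt t t₀ with h | h
  · rw [h1 t ⟨ht.1, h⟩, sub_self, norm_zero]
    linarith
  have ht₀m : t₀ ∈ Icc 0 T := ⟨ht₀.1, ht₀.2.le⟩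
  rcases le_or_gt t (t₀ + τ) with h' | h'
  · have e : z t - y t = (z t - z t₀) - (y t - y t₀) := by
      rw [h1 t₀ ⟨ht₀.1, le_rfl⟩]; abel
    rw [e]
    have a1 := hz.norm_sub_le hf ht₀m ht
    have a2 := hy.norm_sub_le hf ht₀m ht
    have a3 : k * |t - t₀| ≤ k * τ := by
      rw [abs_of_pos (sub_pos.2 h)]
      gcongr
      linarith
    refine (norm_sub_le _ _).trans ?_
    linarith
  · have hm : t - τ ∈ Icc 0 T := ⟨by linarith [ht₀.1], by linarith [ht.2]⟩
    have a1 := h4 t ⟨h'.le, ht.2⟩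
    have a2 := hy.norm_sub_le hf ht hm
    rw [sub_sub_cancel_left, abs_neg, abs_of_nonneg hτ] at a2
    have e : z t - y t = (z t - y (t - τ)) + (y (t - τ) - y t) := by abel
    rw [e]
    refine (norm_add_le _ _).trans ?_
    linarith

theorem iterate_bound {j : ℕ} {A B β : ℝ≥0∞} (hA : A ≤ 3 * B + β)
    (hB : B ≤ ((4 ^ j - 1 : ℕ) : ℝ≥0∞) * β) : A ≤ ((4 ^ (j + 1) - 1 : ℕ) : ℝ≥0∞) * β := by
  have hj : 0 < 4 ^ j := by positivity
  have hle : 3 * (4 ^ j - 1) + 1 ≤ 4 ^ (j + 1) - 1 := by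
    rw [pow_succ]; omega
  calc A ≤ 3 * (((4 ^ j - 1 : ℕ) : ℝ≥0∞) * β) + β := hA.trans (by gcongr)
    _ = ((3 * (4 ^ j - 1) + 1 : ℕ) : ℝ≥0∞) * β := by push_cast; ring
    _ ≤ _ := by gcongr

/-- After `j` correction steps with the same delay `τ`, started at the times `t₁ + i σ`, the
trajectory is strictly feasible on `(t₁, t₁ + j σ]`. -/
theorem exists_iterated_correction {h : Euc n → ℝ} (hf : FieldBounds f L k)
    (hf2 : ∀ i, ContDiff ℝ 2 (f i)) (hh : ContDiff ℝ 2 h)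
    (H4 : HypH4 f h) (R T : ℝ) :
    ∃ κ > 0, ∃ C ≥ 1, ∃ σ > 0, ∃ e₀ > 0, ∀ N : ℕ, ∀ u x, IsTrajectory f 0 T u x →
      ‖x 0‖ + k * T ≤ R → ∀ t₁ ∈ Icc 0 T, h (x t₁) ≤ 0 → ∀ d, 0 < d → C ^ N * d ≤ e₀ →
      (∀ t ∈ Icc 0 T, h (x t) ≤ d) → ∀ τ, κ * √(C ^ N * d) ≤ τ → ∀ j ≤ N, ∃ w y,
        IsTrajectory f 0 T w y ∧ (∀ t ∈ Icc 0 t₁, y t = x t) ∧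
        (∀ t ∈ Ioc t₁ (t₁ + j * σ), t ≤ T → h (y t) < 0) ∧
        (∀ t ∈ Icc 0 T, h (y t) ≤ C ^ j * d) ∧
        (∀ t ∈ Icc 0 T, ‖y t - x t‖ ≤ j * (2 * k * τ + C ^ (N + 1) * d)) ∧
        ∫⁻ t in Ioo 0 T, ‖w t - u t‖ₑ ≤ ((4 ^ j - 1 : ℕ) : ℝ≥0∞) *
          (ENNReal.ofReal (2 * τ) + ∫⁻ t in Ioo (t₁ + τ) T, ‖u (t - τ) - u t‖ₑ) ∧
        ∫⁻ t in Ioo 0 T, ‖deriv y t - deriv x t‖ₑ ≤ ((4 ^ j - 1 : ℕ) : ℝ≥0∞) *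
          (ENNReal.ofReal (2 * k * τ + 2 * L * (C ^ (N + 1) * d) * T) +
            ∫⁻ t in Ioo (t₁ + τ) T, ‖deriv x (t - τ) - deriv x t‖ₑ) := by
  obtain ⟨κ, hκ, C, hC, σ, hσ, e₀, he₀, hstep⟩ := exists_correction_step hf hf2 hh H4 R T
  have hk := hf.k_pos
  have hC0 : 0 < C := by linarith
  refine ⟨κ, hκ, C, hC, σ, hσ, e₀, he₀, fun N u x hx hR t₁ ht₁ hxt₁ d hd hdN hxd τ hτ j => ?_⟩
  have hτ0 : 0 ≤ τ := le_trans (by positivity) hτ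
  have hG : 0 ≤ C ^ (N + 1) * d := by positivity
  induction j with
  | zero =>
    intro _
    refine ⟨u, x, hx, fun _ _ => rfl, fun t ht => ?_, by simpa using hxd, by simp, by simp, by simp⟩
    have := ht.1.trans_le ht.2
    simp at this
  | succ j ih =>
    intro hj
    obtain ⟨v, y, hy, hyx, hyneg, hyd, hysup, hyu, hyder⟩ := ih (by omega)
    rcases le_or_gt T (t₁ + j * σ) with hTj | hTj
    · -- the horizon is already reached
      have hpow : C ^ j ≤ C ^ (j + 1) := pow_le_pow_right₀ hC (by omega)
      have hnat : 4 ^ j - 1 ≤ 4 ^ (j + 1) - 1 :=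
        Nat.sub_le_sub_right (Nat.pow_le_pow_right (by norm_num) (by omega)) 1
      refine ⟨v, y, hy, hyx, fun t ht htT => hyneg t ⟨ht.1, htT.trans hTj⟩ htT,
        fun t ht => (hyd t ht).trans (by gcongr), fun t ht => (hysup t ht).trans ?_,
        hyu.trans (by gcongr), hyder.trans (by gcongr)⟩
      gcongr
      exact_mod_cast Nat.le_succ j
    -- one more step, started at `t₁ + j σ`
    have ht₀ : t₁ + j * σ ∈ Ico 0 T := ⟨by have := ht₁.1; positivity, hTj⟩
    have hle : t₁ ≤ t₁ + j * σ := by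
      have : 0 ≤ (j : ℝ) * σ := by positivity
      linarith
    have hy0 : h (y (t₁ + j * σ)) ≤ 0 := by
      rcases hle.eq_or_lt with heq | hlt
      · rw [← heq, hyx t₁ ⟨ht₁.1, le_rfl⟩]; exact hxt₁
      · exact (hyneg _ ⟨hlt, le_rfl⟩ hTj.le).le
    have hCj : C ^ j * d ≤ C ^ N * d :=
      mul_le_mul_of_nonneg_right (pow_le_pow_right₀ hC (by omega)) hd.le
    have hx0 : y 0 = x 0 := hyx 0 ⟨le_rfl, ht₁.1⟩
    obtain ⟨w, z, hz, hzy, hzneg, hzd, hzclose, hwv, hwd⟩ := hstep v y hy (by rwa [hx0])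
      (t₁ + j * σ) ht₀ hy0 (C ^ j * d) ⟨by positivity, hCj.trans hdN⟩ hyd τ
      (le_trans (by gcongr) hτ)
    have hδ : C * (C ^ j * d) ≤ C ^ (N + 1) * d := by
      rw [pow_succ', mul_assoc]
      gcongr
    have hclose : ∀ t ∈ Icc (t₁ + j * σ + τ) T, ‖z t - y (t - τ)‖ ≤ C ^ (N + 1) * d :=
      fun t ht => (hzclose t ht).trans hδ
    refine ⟨w, z, hz, fun t ht => ?_, fun t ht htT => ?_, fun t ht => ?_, fun t ht => ?_, ?_, ?_⟩
    · rw [hzy t ⟨ht.1, ht.2.trans hle⟩, hyx t ht]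
    · rcases le_or_gt t (t₁ + j * σ) with h | h
      · rw [hzy t ⟨ht₁.1.trans ht.1.le, h⟩]
        exact hyneg t ⟨ht.1, h⟩ htT
      · refine hzneg t ⟨h, ?_⟩ htT
        have := ht.2
        push_cast at this
        linarith
    · refine (hzd t ht).trans (le_of_eq ?_)
      rw [pow_succ']; ring
    · have a1 := state_step_le hf hy hz ht₀ hτ0 hG hzy hclose t ht
      have a2 := hysup t ht
      have e : z t - x t = (z t - y t) + (y t - x t) := by abel
      rw [e]
      refine (norm_add_le _ _).trans ?_
      push_cast
      linarith
    · exact iterate_bound (control_step_le hx hy hz hle ht₀ hτ0 hwv hwd) hyu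
    · exact iterate_bound (deriv_step_le hf hy hz hle ht₀ hτ0 hG hzy hwd hclose) hyder

end Iteration

/-! ### Bounded variation of the derivative -/

theorem BoundedVariationOn.fun_add {α E : Type*} [LinearOrder α] [SeminormedAddCommGroup E]
    {f g : α → E} {s : Set α} (hf : BoundedVariationOn f s) (hg : BoundedVariationOn g s) :
    BoundedVariationOn (fun x => f x + g x) s := by
  refine ne_top_of_le_ne_top (ENNReal.add_ne_top.2 ⟨hf, hg⟩) (iSup_le ?_)
  rintro ⟨N, u, hu, us⟩
  calc ∑ i ∈ Finset.range N, edist (f (u (i + 1)) + g (u (i + 1))) (f (u i) + g (u i))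
      ≤ ∑ i ∈ Finset.range N, (edist (f (u (i + 1))) (f (u i)) +
          edist (g (u (i + 1))) (g (u i))) :=
        Finset.sum_le_sum fun i _ => edist_add_add_le _ _ _ _
    _ = (∑ i ∈ Finset.range N, edist (f (u (i + 1))) (f (u i))) +
          ∑ i ∈ Finset.range N, edist (g (u (i + 1))) (g (u i)) := Finset.sum_add_distrib
    _ ≤ _ := add_le_add (eVariationOn.sum_le hu us) (eVariationOn.sum_le hu us)

/-- If the control has bounded variation, so has the derivative of the trajectory. -/
theorem exists_isBVRepresentative_deriv {n : ℕ} {f : Fin 2 → Euc n → Euc n} {L k T : ℝ}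
    (hf : FieldBounds f L k) (hT : 0 ≤ T) {u : ℝ → Euc 2} {x : ℝ → Euc n}
    (hx : IsTrajectory f 0 T u x) {w : ℝ → Euc 2} (hw : IsBVRepresentative T u w) :
    ∃ v, IsBVRepresentative T (deriv x) v := by
  have h0 : (0 : ℝ) ∈ Icc 0 T := ⟨le_rfl, hT⟩
  have hTm : T ∈ Icc 0 T := ⟨hT, le_rfl⟩
  have hxl : LipschitzOnWith ⟨k, hf.k_pos.le⟩ x (Icc 0 T) :=
    LipschitzOnWith.of_dist_le_mul fun r hr r' hr' => by
      rw [dist_eq_norm, dist_eq_norm]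
      exact hx.norm_sub_le hf hr' hr
  have hxv : BoundedVariationOn x (Icc 0 T) := by
    simpa using hxl.locallyBoundedVariationOn 0 T h0 hTm
  have hfx : ∀ i, BoundedVariationOn (fun t => f i (x t)) (Icc 0 T) := fun i => by
    have hl : LipschitzWith ⟨L, hf.L_pos.le⟩ (f i) := LipschitzWith.of_dist_le_mul fun y z => by
      rw [dist_eq_norm, dist_eq_norm]
      exact hf.lip i y z
    exact hl.comp_boundedVariationOn hxv
  have hwi : ∀ i, BoundedVariationOn (fun t => w t i) (Icc 0 T) := fun i =>
    (EuclideanSpace.proj i : Euc 2 →L[ℝ] ℝ).lipschitz.comp_boundedVariationOn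
      hw.1
  refine ⟨fun t => dynamics f (x t) (w t), ?_, ?_⟩
  · simp only [dynamics_eq]
    exact ((hwi 0).smul (hfx 0)).fun_add ((hwi 1).smul (hfx 1))
  · filter_upwards [hx.ae_hasDerivAt hf, hw.2] with t h1 h2
    rw [h1.deriv, h2]

/-! ### The first violation time -/

section Violation

variable {n : ℕ} {h : Euc n → ℝ} {T : ℝ} {x : ℝ → Euc n}

theorem le_violation (hh : Continuous h) (hx : ContinuousOn x (Icc 0 T)) {t : ℝ}
    (ht : t ∈ Icc 0 T) : max (h (x t)) 0 ≤ violation h T x := by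
  have hc : ContinuousOn (fun t => max (h (x t)) 0) (Icc 0 T) :=
    (hh.comp_continuousOn hx).sup continuousOn_const
  exact le_csSup (isCompact_Icc.image_of_continuousOn hc).bddAbove (mem_image_of_mem _ ht)

theorem violation_nonneg (hh : Continuous h) (hx : ContinuousOn x (Icc 0 T)) (hT : 0 ≤ T) :
    0 ≤ violation h T x :=
  (le_max_right _ _).trans (le_violation hh hx (left_mem_Icc.2 hT))

theorem violationTime_of_eq_zero (hd : violation h T x = 0) : violationTime h T x = T := by
  rw [violationTime, if_pos hd]

theorem exists_pos_of_violation_ne_zero (hT : 0 ≤ T) (h0 : h (x 0) ≤ 0)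
    (hd : violation h T x ≠ 0) : ∃ t ∈ Ioc 0 T, 0 < h (x t) := by
  by_contra! hcon
  refine hd ?_
  have hle : ∀ t ∈ Icc 0 T, max (h (x t)) 0 = 0 := fun t ht => by
    rcases ht.1.eq_or_lt with rfl | hpos
    · exact max_eq_right h0
    · exact max_eq_right (hcon t ⟨hpos, ht.2⟩)
  rw [violation, image_congr hle, (nonempty_Icc.2 hT).image_const, csSup_singleton]

theorem violationTime_mem (hT : 0 ≤ T) (h0 : h (x 0) ≤ 0) : violationTime h T x ∈ Icc 0 T := by
  by_cases hd : violation h T x = 0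
  · rw [violationTime_of_eq_zero hd]
    exact ⟨hT, le_rfl⟩
  · obtain ⟨t, ht, htpos⟩ := exists_pos_of_violation_ne_zero hT h0 hd
    rw [violationTime, if_neg hd]
    have hbdd : BddBelow {t | t ∈ Ioc 0 T ∧ 0 < h (x t)} := ⟨0, fun s hs => hs.1.1.le⟩
    exact ⟨le_csInf ⟨t, ht, htpos⟩ fun s hs => hs.1.1.le,
      (csInf_le hbdd ⟨ht, htpos⟩).trans ht.2⟩

theorem apply_violationTime_le (hh : Continuous h) (hx : ContinuousOn x (Icc 0 T)) (hT : 0 ≤ T)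
    (h0 : h (x 0) ≤ 0) (hd : violation h T x ≠ 0) : h (x (violationTime h T x)) ≤ 0 := by
  set t₁ := violationTime h T x with ht₁def
  have ht₁ : t₁ ∈ Icc 0 T := violationTime_mem hT h0
  by_contra! hpos
  have ht₁0 : 0 < t₁ := lt_of_le_of_ne ht₁.1 fun heq => by
    rw [← heq] at hpos
    linarith
  have hcw : ContinuousWithinAt (fun t => h (x t)) (Ioo 0 t₁) t₁ :=
    ((hh.comp_continuousOn hx) t₁ ht₁).mono fun t ht => ⟨ht.1.le, ht.2.le.trans ht₁.2⟩
  have : (nhdsWithin t₁ (Ioo 0 t₁)).NeBot := by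
    rw [nhdsWithin_Ioo_eq_nhdsLT ht₁0]; infer_instance
  obtain ⟨t, htpos, htm⟩ :=
    ((hcw.eventually (lt_mem_nhds hpos)).and self_mem_nhdsWithin).exists
  have hle : t₁ ≤ t := by
    have hbdd : BddBelow {t | t ∈ Ioc 0 T ∧ 0 < h (x t)} := ⟨0, fun s hs => hs.1.1.le⟩
    rw [ht₁def, violationTime, if_neg hd]
    exact csInf_le hbdd ⟨⟨htm.1, htm.2.le.trans ht₁.2⟩, htpos⟩
  exact absurd htm.2 (not_lt.2 hle)

end Violation

/-! ### Neighbouring feasible trajectories -/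

theorem ofReal_add_le_mul {a B s : ℝ} {W : ℝ≥0∞} (hB : 1 ≤ B) (ha : a ≤ B * s) :
    ENNReal.ofReal a + W ≤ ENNReal.ofReal B * (ENNReal.ofReal s + W) := by
  rw [mul_add, ← ENNReal.ofReal_mul (by linarith)]
  refine add_le_add (ENNReal.ofReal_le_ofReal ha) ?_
  calc W = 1 * W := (one_mul W).symm
    _ ≤ _ := by
      gcongr
      rwa [ENNReal.one_le_ofReal]

theorem natCast_mul_le_ofReal {c c' : ℕ} {B K : ℝ} {A β γ : ℝ≥0∞}
    (hA : A ≤ (c : ℝ≥0∞) * β) (hβ : β ≤ ENNReal.ofReal B * γ) (hc : c ≤ c')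
    (hK : c' * B ≤ K) : A ≤ ENNReal.ofReal K * γ := by
  calc A ≤ (c' : ℝ≥0∞) * (ENNReal.ofReal B * γ) :=
        hA.trans (mul_le_mul' (by exact_mod_cast hc) hβ)
    _ = ENNReal.ofReal (c' * B) * γ := by
        rw [ENNReal.ofReal_mul (by positivity), ENNReal.ofReal_natCast, mul_assoc]
    _ ≤ _ := by gcongr

/-- The neighbouring feasible trajectory theorem for a single reference process. The delay is
`Kτ √d`, and enough correction steps are made to reach the end of the time interval. -/
theorem exists_neighbouring {n : ℕ} {f : Fin 2 → Euc n → Euc n} {h : Euc n → ℝ} {L k : ℝ}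
    (hf : FieldBounds f L k) (hf2 : ∀ i, ContDiff ℝ 2 (f i)) (hh : ContDiff ℝ 2 h)
    (H4 : HypH4 f h) (R : ℝ) {T : ℝ} (hT : 0 < T) :
    ∃ K Kτ dmax : ℝ, 0 < dmax ∧ 0 ≤ Kτ ∧ Kτ ≤ K ∧ 1 ≤ K ∧
      ∀ p, IsReference f h T p → ‖p.1 0‖ ≤ R → violation h T p.1 ≤ dmax →
        ∃ q, IsNeighbouring f h T K (fun d => Kτ * √d) p q := by
  obtain ⟨κ, hκ, C, hC, σ, hσ, e₀, he₀, H⟩ :=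
    exists_iterated_correction hf hf2 hh H4 (R + k * T) T
  have hk := hf.k_pos
  have hL := hf.L_pos
  have hC0 : 0 < C := by linarith
  obtain ⟨N, hN⟩ : ∃ N : ℕ, T ≤ N * σ := by
    obtain ⟨N, hN⟩ := exists_nat_ge (T / σ)
    exact ⟨N, by rwa [div_le_iff₀ hσ] at hN⟩
  set Kτ := κ * √(C ^ N) with hKτ
  have hKτ0 : 0 ≤ Kτ := by positivity
  set B := 1 + 2 * Kτ + 2 * k * Kτ + 2 * L * C ^ (N + 1) * T with hB
  have hB1 : 1 ≤ B := by
    have : 0 ≤ 2 * Kτ + 2 * k * Kτ + 2 * L * C ^ (N + 1) * T := by positivity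
    linarith
  set K := B + N * (2 * k * Kτ + C ^ (N + 1)) + (4 ^ N : ℕ) * B with hK
  have hK4 : ((4 ^ N : ℕ) : ℝ) * B ≤ K := by
    have : 0 ≤ B + N * (2 * k * Kτ + C ^ (N + 1)) := by positivity
    linarith
  have hKN : N * (2 * k * Kτ + C ^ (N + 1)) ≤ K := by
    have : 0 ≤ B + (4 ^ N : ℕ) * B := by positivity
    linarith
  have hKB : B ≤ K := by
    have : 0 ≤ N * (2 * k * Kτ + C ^ (N + 1)) + (4 ^ N : ℕ) * B := by positivity
    linarith
  have hBτ : Kτ ≤ B := by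
    have : 0 ≤ 1 + Kτ + 2 * k * Kτ + 2 * L * C ^ (N + 1) * T := by positivity
    linarith
  refine ⟨K, Kτ, min 1 (e₀ / C ^ N), by positivity, hKτ0, hBτ.trans hKB, hB1.trans hKB,
    fun p hp hpR hpd => ?_⟩
  have hx := isProcess_iff_isTrajectory.1 hp.1
  have hxc := hp.1.state_continuous
  by_cases hd : violation h T p.1 = 0
  · refine ⟨p, hp.1, fun _ _ => rfl, fun t ht => ?_, ?_, ?_, ?_⟩
    · rw [violationTime_of_eq_zero hd] at ht
      exact absurd ht.1 (not_lt.2 ht.2)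
    · rw [normLp, eLpNorm_exponent_top]
      refine eLpNormEssSup_le_of_ae_bound (Filter.Eventually.of_forall fun t => ?_)
      rw [sub_self, norm_zero]
      positivity
    · simp [normLp]
    · simp [normLp]
  set d := violation h T p.1 with hddef
  set t₁ := violationTime h T p.1 with ht₁def
  have hd0 : 0 < d := lt_of_le_of_ne (violation_nonneg hh.continuous hxc hT.le) (Ne.symm hd)
  have hd1 : d ≤ 1 := hpd.trans (min_le_left _ _)
  have hde : C ^ N * d ≤ e₀ := by
    rw [← le_div_iff₀' (by positivity)]
    exact hpd.trans (min_le_right _ _)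
  have hdsqrt : d ≤ √d := Real.le_sqrt_of_sq_le (by nlinarith)
  have ht₁ : t₁ ∈ Icc 0 T := violationTime_mem hT.le hp.2
  obtain ⟨w, y, hy, hyx, hyneg, -, hysup, hyu, hyder⟩ := H N p.2 p.1 hx (by linarith) t₁ ht₁
    (apply_violationTime_le hh.continuous hxc hT.le hp.2 hd) d hd0 hde
    (fun t ht => (le_max_left _ _).trans (le_violation hh.continuous hxc ht)) (Kτ * √d)
    (le_of_eq (by rw [hKτ, Real.sqrt_mul (by positivity), mul_assoc])) N le_rfl
  have hCd : C ^ (N + 1) * d ≤ C ^ (N + 1) * √d := by gcongr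
  refine ⟨(y, w), isProcess_iff_isTrajectory.2 hy, hyx, fun t ht => ?_, ?_, ?_, ?_⟩
  · have hneg : h (y t) < 0 := hyneg t ⟨ht.1, by linarith [ht.2, ht₁.1]⟩ ht.2
    refine ⟨mem_interior.2 ⟨{z | h z < 0}, fun z hz => show h z ≤ 0 from le_of_lt hz,
      isOpen_lt hh.continuous continuous_const, hneg⟩, hneg⟩
  · rw [normLp, eLpNorm_exponent_top]
    refine eLpNormEssSup_le_of_ae_bound ?_
    filter_upwards [ae_restrict_mem measurableSet_Ioo] with t ht
    refine (hysup t (Ioo_subset_Icc_self ht)).trans ?_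
    calc (N : ℝ) * (2 * k * (Kτ * √d) + C ^ (N + 1) * d)
        ≤ N * (2 * k * (Kτ * √d) + C ^ (N + 1) * √d) := by gcongr
      _ = N * (2 * k * Kτ + C ^ (N + 1)) * √d := by ring
      _ ≤ K * √d := by gcongr
  · rw [normLp_one_eq, normLp_one_eq]
    refine natCast_mul_le_ofReal hyu (ofReal_add_le_mul hB1 ?_) (Nat.sub_le _ _) hK4
    have : 0 ≤ (1 + 2 * k * Kτ + 2 * L * C ^ (N + 1) * T) * √d := by positivity
    rw [hB]
    linarith
  · rw [normLp_one_eq, normLp_one_eq]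
    refine natCast_mul_le_ofReal hyder (ofReal_add_le_mul hB1 ?_) (Nat.sub_le _ _) hK4
    have h1 : 0 ≤ (1 + 2 * Kτ) * √d := by positivity
    have h2 : 2 * L * T * (C ^ (N + 1) * d) ≤ 2 * L * T * (C ^ (N + 1) * √d) := by gcongr
    rw [hB]
    linarith

theorem lintegral_translation_congr {m : ℕ} {T t₁ τ : ℝ} (ht₁ : 0 ≤ t₁) (hτ : 0 ≤ τ)
    {g v : ℝ → Euc m} (hgv : g =ᵐ[volume.restrict (Icc 0 T)] v) :
    ∫⁻ t in Ioo (t₁ + τ) T, ‖g (t - τ) - g t‖ₑ ≤ ∫⁻ t in Ioo τ T, ‖v (t - τ) - v t‖ₑ := by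
  refine (lintegral_mono_set (Ioo_subset_Ioo_left (by linarith))).trans (lintegral_mono_ae ?_)
  have h1 := (ae_restrict_iff' measurableSet_Icc).1 hgv
  refine (ae_restrict_iff' measurableSet_Ioo).2 ?_
  filter_upwards [h1, ae_comp_sub h1 τ] with t h2 h3 ht
  rw [h2 ⟨hτ.trans ht.1.le, ht.2.le⟩, h3 ⟨by linarith [ht.1], by linarith [ht.2]⟩]

/-- The convergence of the derivatives, uniformly on compact families, from the `L¹` estimate. -/
theorem exists_violation_bound {n : ℕ} {f : Fin 2 → Euc n → Euc n} {h : Euc n → ℝ} {T K Kτ : ℝ}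
    (hT : 0 ≤ T) (hK : 0 < K) (hKτ : 0 ≤ Kτ)
    {G : Set (Lp (Euc n) 1 (volume.restrict (Icc 0 T)))} (hG : IsCompact G) {ε : ℝ} (hε : 0 < ε) :
    ∃ η > 0, ∀ p q, h (p.1 0) ≤ 0 → IsNeighbouring f h T K (fun d => Kτ * √d) p q →
      violation h T p.1 ≤ η → (∃ g ∈ G, deriv p.1 =ᵐ[volume.restrict (Icc 0 T)] g) →
        normLp 1 (Ioo 0 T) (fun t => deriv q.1 t - deriv p.1 t) ≤ ENNReal.ofReal ε := by
  have hε' : 0 < ε / (2 * K) := by positivity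
  obtain ⟨ρ, hρ, H⟩ := exists_translation_le_of_isCompact hG (ENNReal.ofReal_pos.2 hε')
  have hρ' : 0 < ρ / (Kτ + 1) := by positivity
  refine ⟨min (ε / (2 * K)) (ρ / (Kτ + 1)) ^ 2, by positivity, fun p q hp hq hd hg => ?_⟩
  obtain ⟨g, hgG, hg⟩ := hg
  have hsqrt : √(violation h T p.1) ≤ min (ε / (2 * K)) (ρ / (Kτ + 1)) := by
    rw [← Real.sqrt_sq (show 0 ≤ min (ε / (2 * K)) (ρ / (Kτ + 1)) by positivity)]
    exact Real.sqrt_le_sqrt hd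
  have hτ0 : 0 ≤ Kτ * √(violation h T p.1) := by positivity
  have hτρ : Kτ * √(violation h T p.1) ≤ ρ := by
    calc _ ≤ Kτ * (ρ / (Kτ + 1)) := by
          gcongr
          exact hsqrt.trans (min_le_right _ _)
      _ ≤ (Kτ + 1) * (ρ / (Kτ + 1)) := by gcongr; linarith
      _ = ρ := by field_simp
  refine hq.deriv_bound.trans ?_
  have hW := (lintegral_translation_congr (t₁ := violationTime h T p.1)
    (violationTime_mem hT hp).1 hτ0 hg).trans (H _ hτ0 hτρ g hgG)
  rw [normLp_one_eq]
  calc _ ≤ ENNReal.ofReal K * (ENNReal.ofReal (ε / (2 * K)) + ENNReal.ofReal (ε / (2 * K))) := by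
        gcongr
        exact hsqrt.trans (min_le_left _ _)
    _ = ENNReal.ofReal ε := by
        rw [← ENNReal.ofReal_add hε'.le hε'.le, ← ENNReal.ofReal_mul hK.le]
        congr 1
        field_simp
        norm_num

/-- The `W^{1,1}` estimate for a derivative of bounded variation, from the `L¹` estimate. -/
theorem normW11_le_of_isBVRepresentative {n : ℕ} {f : Fin 2 → Euc n → Euc n} {h : Euc n → ℝ}
    {L k T K Kτ : ℝ} (hf : FieldBounds f L k) (hT : 0 ≤ T) (hK : 0 < K) (hKτ : 0 ≤ Kτ)
    {p q : StateControl n} (hp : IsReference f h T p)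
    (hq : IsNeighbouring f h T K (fun d => Kτ * √d) p q) {v : ℝ → Euc n}
    (hv : IsBVRepresentative T (deriv p.1) v) :
    normW11 T (fun t => q.1 t - p.1 t) ≤
      ENNReal.ofReal (K * (1 + Kτ) * √(violation h T p.1)) * (1 + eVariationOn v (Icc 0 T)) := by
  set d := violation h T p.1
  have hτ0 : 0 ≤ Kτ * √d := by positivity
  have ht₁ := violationTime_mem (x := p.1) hT hp.2
  have h0 : q.1 0 - p.1 0 = 0 := by rw [hq.eq_before 0 ⟨le_rfl, ht₁.1⟩, sub_self]
  have hder : normLp 1 (Ioo 0 T) (deriv fun t => q.1 t - p.1 t) =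
      normLp 1 (Ioo 0 T) (fun t => deriv q.1 t - deriv p.1 t) := by
    refine eLpNorm_congr_ae ?_
    rw [restrict_Ioo_eq_restrict_Icc]
    filter_upwards [(isProcess_iff_isTrajectory.1 hp.1).ae_hasDerivAt hf,
      (isProcess_iff_isTrajectory.1 hq.isProcess).ae_hasDerivAt hf] with t h1 h2
    rw [(h2.fun_sub h1).deriv, h1.deriv, h2.deriv]
  have hW : normLp 1 (Ioo (violationTime h T p.1 + Kτ * √d) T)
      (fun t => deriv p.1 (t - Kτ * √d) - deriv p.1 t) ≤
        ENNReal.ofReal (Kτ * √d) * eVariationOn v (Icc 0 T) := by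
    rw [normLp_one_eq]
    exact (lintegral_translation_congr ht₁.1 hτ0 hv.2).trans
      (lintegral_translation_le_variation hv.1 hτ0)
  rw [normW11, h0, enorm_zero, zero_add, hder]
  refine hq.deriv_bound.trans ?_
  calc _ ≤ ENNReal.ofReal K * (ENNReal.ofReal √d +
        ENNReal.ofReal (Kτ * √d) * eVariationOn v (Icc 0 T)) := by gcongr
    _ ≤ ENNReal.ofReal K * (ENNReal.ofReal ((1 + Kτ) * √d) +
        ENNReal.ofReal ((1 + Kτ) * √d) * eVariationOn v (Icc 0 T)) := by
        gcongr
        · nlinarith [Real.sqrt_nonneg d]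
        · linarith
    _ = _ := by
        rw [mul_assoc K, ENNReal.ofReal_mul hK.le]
        ring

theorem HypH1.exists_fieldBounds {n : ℕ} {f : Fin 2 → Euc n → Euc n} (H1 : HypH1 f) :
    ∃ L k, FieldBounds f L k := by
  obtain ⟨-, ⟨kf, hkf⟩, k₀, hk₀, hb⟩ := H1
  refine ⟨kf + 1, k₀, by positivity, hk₀, fun i x y => ?_, hb⟩
  have := (hkf i).dist_le_mul x y
  rw [dist_eq_norm, dist_eq_norm] at this
  nlinarith [norm_nonneg (x - y)]

theorem theorem1 {n : ℕ} (f : Fin 2 → Euc n → Euc n) (h : Euc n → ℝ) (T : ℝ) (hT : 0 < T)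
    (H1 : HypH1 f) (H3 : HypH3 h) (H4 : HypH4 f h) (H5 : HypH5 f h) (H6 : HypH6 f h)
    (X₀ : Set (Euc n)) (hX₀ : IsCompact X₀) :
    ∃ (K K' dmax : ℝ) (τ : ℝ → ℝ) (Φ : StateControl n → StateControl n),
      0 < dmax ∧ (∀ d, 0 ≤ τ d ∧ τ d ≤ K * √d) ∧
      -- the neighbouring process `Φ p` and its estimates
      (∀ p, IsReference f h T p → p.1 0 ∈ X₀ → violation h T p.1 ≤ dmax →
        IsNeighbouring f h T K τ p (Φ p)) ∧
      -- convergence of the derivatives in `L¹`, uniformly on compact families of derivatives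
      (∀ 𝒢 : Set (Lp (Euc n) 1 (volume.restrict (Icc 0 T))), IsCompact 𝒢 →
        ∀ ε : ℝ, 0 < ε → ∃ η : ℝ, 0 < η ∧
          ∀ p, IsReference f h T p → p.1 0 ∈ X₀ → violation h T p.1 ≤ η →
            (∃ g ∈ 𝒢, deriv p.1 =ᵐ[volume.restrict (Icc 0 T)] g) →
            normLp 1 (Ioo 0 T) (fun t => deriv (Φ p).1 t - deriv p.1 t) ≤ ENNReal.ofReal ε) ∧
      -- the `W^{1,1}` estimate when the derivative has bounded variation
      (∀ p, IsReference f h T p → p.1 0 ∈ X₀ → violation h T p.1 ≤ dmax →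
        ∀ v, IsBVRepresentative T (deriv p.1) v →
          normW11 T (fun t => (Φ p).1 t - p.1 t) ≤
            ENNReal.ofReal (K' * √(violation h T p.1)) * (1 + eVariationOn v (Icc 0 T))) ∧
      -- which holds if the control has bounded variation
      (∀ p, IsReference f h T p → (∃ w, IsBVRepresentative T p.2 w) →
        ∃ v, IsBVRepresentative T (deriv p.1) v) := by
  classical
  obtain ⟨L, k, hf⟩ := H1.exists_fieldBounds
  obtain ⟨R, hR⟩ := hX₀.isBounded.subset_closedBall 0
  obtain ⟨K, Kτ, dmax, hdmax, hKτ, hKK, hK1, H⟩ := exists_neighbouring hf H1.1 H3.1 H4 R hT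
  have hK : 0 < K := by linarith
  -- the map `Φ` is a choice of neighbouring processes, irrelevant where there are none
  set Φ : StateControl n → StateControl n := fun p =>
    if hp : ∃ q, IsNeighbouring f h T K (fun d => Kτ * √d) p q then hp.choose else p with hΦ
  have hN : ∀ p, IsReference f h T p → p.1 0 ∈ X₀ → violation h T p.1 ≤ dmax →
      IsNeighbouring f h T K (fun d => Kτ * √d) p (Φ p) := fun p hp hpX hpd => by
    have hex := H p hp (mem_closedBall_zero_iff.1 (hR hpX)) hpd
    simp only [hΦ, dif_pos hex]
    exact hex.choose_spec
  refine ⟨K, K * (1 + Kτ), dmax, fun d => Kτ * √d, Φ, hdmax, fun d =>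
    ⟨by positivity, mul_le_mul_of_nonneg_right hKK (Real.sqrt_nonneg d)⟩,
    hN, fun G hG ε hε => ?_, fun p hp hpX hpd v hv => ?_, fun p hp hw => ?_⟩
  · obtain ⟨η, hη, hη'⟩ := exists_violation_bound (f := f) (h := h) hT.le hK hKτ hG hε
    exact ⟨min η dmax, by positivity, fun p hp hpX hpd hg => hη' p (Φ p) hp.2
      (hN p hp hpX (hpd.trans (min_le_right _ _))) (hpd.trans (min_le_left _ _)) hg⟩
  · exact normW11_le_of_isBVRepresentative hf hT.le hK hKτ hp (hN p hp hpX hpd) hv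
  · obtain ⟨w, hw⟩ := hw
    exact exists_isBVRepresentative_deriv hf hT.le (isProcess_iff_isTrajectory.1 hp.1) hw
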